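/- **Theorem 6.1 (Well-definedness of the Conley index).** Let $R$ be a ring, let $X$ be a finite $T_0$ topological space, and let $F:X\multimap X$ be a multivalued map (a function assigning to each $x\in X$ a subset $F(x)\subseteq X$) which is lower semicontinuous (for every closed $H\subseteq X$ the set $\{x : F(x)\subseteq H\}$ is closed) and has closed and acyclic values. Here $H_*$ denotes singular homology with coefficients in $R$, and a space is acyclic if its map to a one-point space induces isomorphisms on $H_n$ for all $n\ge 0$. For $A\subseteq X$ put $F(A)=\bigcup_{x\in A}F(x)$. *Dynamics.* A full solution in $A\subseteq X$ is a map $\sigma:\mathbb Z\to A$ with $\sigma(i+1)\in F(\sigma(i))$ for all $i$; a path in $A$ is a map $\sigma:\mathbb Z\cap[m,n]\to A$, $m\le n$, with $\sigma(i+1)\in F(\sigma(i))$ for $m\le i<n$, and its endpoints are $\sigma(m),\sigma(n)$. $\operatorname{Inv}(A)$ is the set of $x\in A$ through which a full solution in $A$ passes; $A$ is invariant if $\operatorname{Inv}(A)=A$. A closed set $N\subseteq X$ is an isolating set for an invariant set $S$ if (IS1) every path in $N$ with both endpoints in $S$ has all its values in $S$, and (IS2) $S\cap\operatorname{cl}(F(S)\setminus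 N)=\emptyset$; if such an $N$ exists, $S$ is an isolated invariant set. An index pair for $S$ in the isolating set $N$ is a pair $P=(P_1,P_2)$ of closed sets $P_2\subseteq P_1\subseteq N$ such that (IP1) $F(P_i)\cap N\subseteq P_i$ for $i=1,2$, (IP2) $P_1\cap\operatorname{cl}(F(P_1)\setminus N)\subseteq P_2$, and (IP3) $S=\operatorname{Inv}(P_1\setminus P_2)$. *Index map.* For an index pair $P$ in $N$ let $\bar P=(\bar P_1,\bar P_2)$ with $\bar P_i=P_i\cup\operatorname{cl}(F(P_1)\setminus N)$; then $P_i\subseteq\bar P_i$ and $F(P_i)\subseteq\bar P_i$. Let $\Gamma_P=(\Gamma_1,\Gamma_2)$ with $\Gamma_i=\{(x,y)\in X\times X : x\in P_i,\ y\in F(x)\}$, and let $p_1:\Gamma_P\to P$, $p_2:\Gamma_P\to\bar P$ be the two projections and $\iota_P:P\to\bar P$ the inclusion, all regarded as maps of pairs. The index map is the endomorphism $$I_P=(\iota_P)_*^{-1}\circ(p_2)_*\circ(p_1)_*^{-1}$$ of the graded $R$-module $H_*(P)=H_*(P_1,P_2)$. *Normal functors.* Let $\mathrm{Mod}$ be the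 category of graded $R$-modules and homomorphisms of degree zero. The objects of $\operatorname{Endo}(\mathrm{Mod})$ are pairs $(A,a)$ with $a:A\to A$ in $\mathrm{Mod}$; morphisms $(A,a)\to(B,b)$ are the morphisms $\varphi:A\to B$ with $\varphi a=b\varphi$. A functor $L:\operatorname{Endo}(\mathrm{Mod})\to\mathcal C$ to a category $\mathcal C$ (for example to the full subcategory $\operatorname{Auto}(\mathrm{Mod})$ of the pairs $(A,a)$ with $a$ an isomorphism) is normal if for every object $(A,a)$ the morphism $L(a)$ is an isomorphism, where $a$ is regarded as a morphism $(A,a)\to(A,a)$. *Claim.* Let $L:\operatorname{Endo}(\mathrm{Mod})\to\mathcal C$ be a normal functor and let $S\subseteq X$ be an isolated invariant set. For every isolating set $N$ for $S$ and every index pair $P$ for $S$ in $N$, the homomorphisms $(p_1)_*$ and $(\iota_P)_*$ are isomorphisms, so that $I_P$ is defined. The isomorphism class of $L(H_*(P),I_P)$ in $\mathcal C$ depends neither on $N$ nor on $P$: if $N$ and $M$ are isolating sets for $S$, $P$ is an index pair for $S$ in $N$ and $Q$ is an index pair for $S$ in $M$, then $L(H_*(P),I_P)\cong L(H_*(Q),I_Q)$.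 -/

import Mathlib

open CategoryTheory

universe u

namespace Conley

/-! ### Multivalued dynamics

A multivalued map `X ⊸ Y` is a function `F : X → Set Y`. -/

section Dynamics

variable {X : Type u}

/-- The image `F(A)`, the union of the values `F x` for `x ∈ A`. -/
def image {Y : Type u} (F : X → Set Y) (A : Set X) : Set Y := ⋃ x ∈ A, F x

/-- `σ` is a full solution of `F` with values in `A`. -/
def IsFullSolution (F : X → Set X) (A : Set X) (σ : ℤ → X) : Prop :=
  (∀ i, σ i ∈ A) ∧ ∀ i, σ (i + 1) ∈ F (σ i)

/-- The restriction of `σ` to the nonempty integer interval `[m, n]` is a path of `F` in `A`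
(the values of `σ` outside `[m, n]` play no role). -/
def IsPath (F : X → Set X) (A : Set X) (m n : ℤ) (σ : ℤ → X) : Prop :=
  m ≤ n ∧ (∀ i ∈ Set.Icc m n, σ i ∈ A) ∧ ∀ i ∈ Set.Ico m n, σ (i + 1) ∈ F (σ i)

/-- The invariant part of `A`: the points of `A` through which a full solution in `A` passes. -/
def inv (F : X → Set X) (A : Set X) : Set X :=
  {x ∈ A | ∃ σ, IsFullSolution F A σ ∧ ∃ i, σ i = x}

/-- Through every point of `A` passes a full solution in `A`. -/
def IsInvariant (F : X → Set X) (A : Set X) : Prop :=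
  ∀ x ∈ A, ∃ σ, IsFullSolution F A σ ∧ ∃ i, σ i = x

/-- A pair `(fst, snd)` of subsets of `X` with `snd ⊆ fst`. -/
structure SetPair (X : Type u) where
  fst : Set X
  snd : Set X
  snd_subset : snd ⊆ fst

/-- `F` restricts to a multivalued map of pairs `P ⊸ Q`. -/
def MultiMapsTo {Y : Type u} (F : X → Set Y) (P : SetPair X) (Q : SetPair Y) : Prop :=
  (∀ x ∈ P.fst, F x ⊆ Q.fst) ∧ ∀ x ∈ P.snd, F x ⊆ Q.snd

/-- The graph of `F` over the pair `P`, as a pair of subsets of the product. -/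
def graphPair {Y : Type u} (F : X → Set Y) (P : SetPair X) : SetPair (X × Y) where
  fst := {q | q.1 ∈ P.fst ∧ q.2 ∈ F q.1}
  snd := {q | q.1 ∈ P.snd ∧ q.2 ∈ F q.1}
  snd_subset _ hq := ⟨P.snd_subset hq.1, hq.2⟩

variable [TopologicalSpace X]

/-- The closed set `N` is an isolating set for the invariant set `S`. -/
structure IsIsolatingSet (F : X → Set X) (S N : Set X) : Prop where
  invariant : IsInvariant F S
  closed : IsClosed N
  path_subset : ∀ m n σ, IsPath F N m n σ → σ m ∈ S → σ n ∈ S → ∀ i ∈ Set.Icc m n, σ i ∈ S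
  disjoint : S ∩ closure (image F S \ N) = ∅

/-- `P` is an index pair for `S` in `N`. -/
structure IsIndexPair (F : X → Set X) (S N : Set X) (P : SetPair X) : Prop where
  isolating : IsIsolatingSet F S N
  closed_fst : IsClosed P.fst
  closed_snd : IsClosed P.snd
  fst_subset : P.fst ⊆ N
  image_fst : image F P.fst ∩ N ⊆ P.fst
  image_snd : image F P.snd ∩ N ⊆ P.snd
  exit : P.fst ∩ closure (image F P.fst \ N) ⊆ P.snd
  inv_eq : S = inv F (P.fst \ P.snd)

/-- The extended pair `P̄ = (P₁ ∪ cl (F(P₁) \ N), P₂ ∪ cl (F(P₁) \ N))`. -/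
def barPair (F : X → Set X) (N : Set X) (P : SetPair X) : SetPair X where
  fst := P.fst ∪ closure (image F P.fst \ N)
  snd := P.snd ∪ closure (image F P.fst \ N)
  snd_subset := Set.union_subset_union_left _ P.snd_subset

theorem IsIndexPair.multiMapsTo {F : X → Set X} {S N : Set X} {P : SetPair X}
    (hP : IsIndexPair F S N P) : MultiMapsTo F P (barPair F N P) := by
  have key : ∀ x ∈ P.fst, ∀ y ∈ F x, y ∉ N → y ∈ closure (image F P.fst \ N) :=
    fun x hx y hy hN ↦ subset_closure ⟨Set.mem_biUnion hx hy, hN⟩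
  refine ⟨fun x hx y hy ↦ ?_, fun x hx y hy ↦ ?_⟩
  · by_cases hN : y ∈ N
    · exact Or.inl (hP.image_fst ⟨Set.mem_biUnion hx hy, hN⟩)
    · exact Or.inr (key x hx y hy hN)
  · by_cases hN : y ∈ N
    · exact Or.inl (hP.image_snd ⟨Set.mem_biUnion hx hy, hN⟩)
    · exact Or.inr (key x (P.snd_subset hx) y hy hN)

end Dynamics

/-! ### Singular homology of spaces and pairs, with coefficients in a ring -/

section Homology

variable (R : Type u) [Ring R]

/-- Graded `R`-modules and homomorphisms of degree zero. -/
abbrev GrMod := GradedObject ℕ (ModuleCat.{u} R)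

/-- The singular chain complex `S_*(Y; R)`. -/
noncomputable abbrev singularChains : TopCat.{u} ⥤ ChainComplex (ModuleCat.{u} R) ℕ :=
  (AlgebraicTopology.singularChainComplexFunctor (ModuleCat.{u} R)).obj (ModuleCat.of R R)

/-- The relative singular chain complex: the cokernel of `S_*(B; R) ⟶ S_*(A; R)` for a
topological pair `(A, B)`. -/
noncomputable def relChains : TopPair.{u} ⥤ ChainComplex (ModuleCat.{u} R) ℕ :=
  MorphismProperty.Arrow.forget _ _ _ ⋙ (singularChains R).mapArrow ⋙ Limits.coker _

/-- Relative singular homology `H_*(A, B; R)`, as a graded module. -/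
noncomputable def relHomology : TopPair.{u} ⥤ GrMod R :=
  relChains R ⋙ HomologicalComplex.gradedHomologyFunctor _ _

/-- The space `Y` is acyclic: the map from `Y` to a point induces isomorphisms in homology
in all degrees. -/
def IsAcyclic (Y : Type u) [TopologicalSpace Y] : Prop :=
  ∀ n : ℕ, IsIso (((AlgebraicTopology.singularHomologyFunctor (ModuleCat.{u} R) n).obj
    (ModuleCat.of R R)).map (TopCat.ofHom (ContinuousMap.const Y PUnit.unit.{u + 1})))

variable {X Y : Type u} [TopologicalSpace X] [TopologicalSpace Y]

/-- A pair of subsets of `X`, with the subspace topologies, as a topological pair. -/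
def SetPair.toTopPair (P : SetPair X) : TopPair.{u} :=
  TopPair.of (A := TopCat.of P.snd) (X := TopCat.of P.fst)
    (TopCat.ofHom ⟨Set.inclusion P.snd_subset, continuous_inclusion P.snd_subset⟩)
    (Topology.IsEmbedding.inclusion P.snd_subset)

/-- The map of topological pairs `P ⟶ Q` which is the restriction of `f`. -/
def SetPair.mapHom {P : SetPair X} {Q : SetPair Y} (f : C(X, Y))
    (h₁ : Set.MapsTo f P.fst Q.fst) (h₂ : Set.MapsTo f P.snd Q.snd) :
    P.toTopPair ⟶ Q.toTopPair :=
  TopPair.ofHom (X := P.toTopPair) (Y := Q.toTopPair)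
    (TopCat.ofHom ⟨h₁.restrict, f.continuous.restrict h₁⟩)
    (TopCat.ofHom ⟨h₂.restrict, f.continuous.restrict h₂⟩) rfl

/-- The graded module `H_*(P) = H_*(P₁, P₂; R)`. -/
noncomputable abbrev SetPair.homology (P : SetPair X) : GrMod R :=
  (relHomology R).obj P.toTopPair

/-- The homomorphism `H_*(P) ⟶ H_*(Q)` induced by the continuous map `f`. -/
noncomputable abbrev SetPair.homologyMap {P : SetPair X} {Q : SetPair Y} (f : C(X, Y))
    (h₁ : Set.MapsTo f P.fst Q.fst) (h₂ : Set.MapsTo f P.snd Q.snd) :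
    P.homology R ⟶ Q.homology R :=
  (relHomology R).map (SetPair.mapHom f h₁ h₂)

/-- The inverse of `f` if `f` is an isomorphism, and `0` otherwise. -/
noncomputable def invOrZero {A B : GrMod R} (f : A ⟶ B) : B ⟶ A :=
  open Classical in if _ : IsIso f then CategoryTheory.inv f else fun _ ↦ 0

/-- `(p₁)_*`, induced by the projection of the graph of `F` over `P` onto `P`. -/
noncomputable def projFst (F : X → Set Y) (P : SetPair X) :
    (graphPair F P).homology R ⟶ P.homology R :=
  SetPair.homologyMap R ContinuousMap.fst (fun _ h ↦ h.1) (fun _ h ↦ h.1)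

/-- `(p₂)_*`, induced by the projection of the graph of `F` over `P` to `Q`. -/
noncomputable def projSnd (F : X → Set Y) {P : SetPair X} {Q : SetPair Y}
    (h : MultiMapsTo F P Q) : (graphPair F P).homology R ⟶ Q.homology R :=
  SetPair.homologyMap R ContinuousMap.snd (fun q hq ↦ h.1 q.1 hq.1 hq.2)
    (fun q hq ↦ h.2 q.1 hq.1 hq.2)

/-- `F_* = (p₂)_* ∘ (p₁)_*⁻¹ : H_*(P) ⟶ H_*(Q)`, for a multivalued map of pairs `P ⊸ Q` for
which `(p₁)_*` is an isomorphism. -/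
noncomputable def multiMap (F : X → Set Y) {P : SetPair X} {Q : SetPair Y}
    (h : MultiMapsTo F P Q) : P.homology R ⟶ Q.homology R :=
  invOrZero R (projFst R F P) ≫ projSnd R F h

/-- `(ι_P)_* : H_*(P) ⟶ H_*(P̄)`, induced by the inclusion. -/
noncomputable def inclBar (F : X → Set X) (N : Set X) (P : SetPair X) :
    P.homology R ⟶ (barPair F N P).homology R :=
  SetPair.homologyMap R (ContinuousMap.id X) (fun _ h ↦ Or.inl h) (fun _ h ↦ Or.inl h)

/-- The index map `I_P = (ι_P)_*⁻¹ ∘ (F_P)_*`, an endomorphism of `H_*(P)`. -/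
noncomputable def indexMap {F : X → Set X} {S N : Set X} {P : SetPair X}
    (hP : IsIndexPair F S N P) : P.homology R ⟶ P.homology R :=
  multiMap R F hP.multiMapsTo ≫ invOrZero R (inclBar R F N P)

end Homology

/-! ### The category of endomorphisms, and normal functors -/

section Endo

/-- An object of `Endo(E)`: an object of `E` with an endomorphism. -/
structure EndoObj (E : Type*) [Category* E] where
  pt : E
  endo : pt ⟶ pt

variable {E : Type*} [Category* E]

/-- A morphism `φ : (A, a) ⟶ (B, b)` of `Endo(E)`: a morphism of `E` with `φ ∘ a = b ∘ φ`. -/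
@[ext]
structure EndoObj.Hom (A B : EndoObj E) where
  hom : A.pt ⟶ B.pt
  comm : A.endo ≫ hom = hom ≫ B.endo

instance : Category (EndoObj E) where
  Hom := EndoObj.Hom
  id A := ⟨𝟙 A.pt, by simp⟩
  comp f g := ⟨f.hom ≫ g.hom, by
    rw [← Category.assoc, f.comm, Category.assoc, g.comm, Category.assoc]⟩
  id_comp f := EndoObj.Hom.ext (Category.id_comp _)
  comp_id f := EndoObj.Hom.ext (Category.comp_id _)
  assoc f g h := EndoObj.Hom.ext (Category.assoc _ _ _)

/-- The induced morphism `a : (A, a) ⟶ (A, a)`. -/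
def EndoObj.induced (A : EndoObj E) : A ⟶ A := EndoObj.Hom.mk A.endo rfl

/-- A functor on `Endo(E)` is normal if it sends all induced morphisms to isomorphisms. -/
def IsNormal {C : Type*} [Category* C] (L : EndoObj E ⥤ C) : Prop :=
  ∀ A : EndoObj E, IsIso (L.map A.induced)

end Endo

end Conley

/-!
The homology of the subspaces `A` of a space `X` is computed by one differential module: the module
`Tot R (Sing X)` freely generated by all singular simplices, of all degrees, with the submodules
`chainsOn R (simplicesIn A)`. In this form, subdivision, Mayer–Vietoris arguments and the five lemma
are manipulations of elements. The comparison with the singular homology and relative homology of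
Mathlib is made once, in `isQuasiIso_totMap_iff` and `isIso_homologyMap`.

*Excision for closed sets.* Barycentric subdivision gives small simplices for covers by relatively
open sets (`relAcyclic_of_isOpen`). In a finite `T₀` space every point has a smallest neighbourhood,
which is contractible by a cone construction, and an induction on the number of points replaces all
singular chains by those supported on *flags*, the simplices whose value at a point depends only on
the last nonzero coordinate (`relAcyclic_flags`, a form of McCord's theorem). A flag lies in the
closure of the value at its last vertex, so a flag in a union of two closed sets lies in one
of them. Hence excision holds for closed covers (`relAcyclic_of_isClosed`), which makes `(ι_P)_*` an
isomorphism.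

*The Vietoris–Begle theorem.* If `a` is in the closure of `x`, then `F a ⊆ F x` by lower
semicontinuity. So the graph of `F` over the closure of `x` retracts by a homotopy to the acyclic
set `F x`, because maps which are comparable for specialization are homotopic. An induction on the
number of points, with the Mayer–Vietoris principle for closed covers, shows that the graph over any
closed set has the homology of that set (`isQuasiIso_fst`); thus `(p₁)_*` is an isomorphism.

*Independence.* A normal functor `L` identifies two endomorphisms of the forms `g ∘ f` and `f ∘ g`
(`IsNormal.nonempty_iso`). Such a factorization of index maps exists for index pairs `P ⊆ Q` in `N`
if `F` maps `Q` to `P` up to a suitable exit set (`IsIndexPair.nonempty_iso_of_image_subset`), and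
if the inclusion is an isomorphism by excision (`IsIndexPair.nonempty_iso_of_excision`). By a chain
of such comparisons every index pair in `N` has the same index as the canonical one: the pair of
`reach F S N`, the set of points reachable from `S` by paths in `N`, and its closed
subset `reach F S N \ S`. The canonical pairs of `N`, of `N ∩ M` and of `M` have the same
difference `S`, and agree by excision.
-/

/-! ### Differential modules -/

namespace Conley

section DifferentialModule

variable {R : Type*} [Ring R] {M M' N N' : Type*} [AddCommGroup M] [Module R M]
  [AddCommGroup M'] [Module R M'] [AddCommGroup N] [Module R N] [AddCommGroup N'] [Module R N']

/-- Every cycle of the differential `d` in `S` is the boundary of an element of `S`. -/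
def Acyclic (d : M →ₗ[R] M) (S : Submodule R M) : Prop :=
  ∀ c ∈ S, d c = 0 → ∃ b ∈ S, d b = c

/-- The homology of `T` relative to `S` vanishes: a chain in `T` with boundary in `S` is
homologous, through `T`, to a chain in `S`. -/
def RelAcyclic (d : M →ₗ[R] M) (T S : Submodule R M) : Prop :=
  ∀ c ∈ T, d c ∈ S → ∃ b ∈ T, c - d b ∈ S

/-- The differential `(m, m') ↦ (d m, f m - d' m')` of the mapping cone of `f`. -/
def coneDiff (d : M →ₗ[R] M) (d' : M' →ₗ[R] M') (f : M →ₗ[R] M') : (M × M') →ₗ[R] M × M' :=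
  (d ∘ₗ LinearMap.fst R M M').prod (f ∘ₗ LinearMap.fst R M M' - d' ∘ₗ LinearMap.snd R M M')

/-- The chain map `f` restricts to a quasi-isomorphism from `S` to `S'`, in the form that its
mapping cone is acyclic. -/
def IsQuasiIso (d : M →ₗ[R] M) (d' : M' →ₗ[R] M') (f : M →ₗ[R] M') (S : Submodule R M)
    (S' : Submodule R M') : Prop :=
  Acyclic (coneDiff d d' f) (S.prod S')

variable {d : M →ₗ[R] M} {d' : M' →ₗ[R] M'} {f : M →ₗ[R] M'}

@[simp]
theorem coneDiff_apply (m : M) (m' : M') : coneDiff d d' f (m, m') = (d m, f m - d' m') := rfl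

theorem isQuasiIso_iff {S : Submodule R M} {S' : Submodule R M'} :
    IsQuasiIso d d' f S S' ↔ ∀ s ∈ S, ∀ s' ∈ S', d s = 0 → f s = d' s' →
      ∃ t ∈ S, ∃ t' ∈ S', d t = s ∧ f t - d' t' = s' := by
  constructor
  · intro h s hs s' hs' h1 h2
    obtain ⟨⟨t, t'⟩, ⟨ht, ht'⟩, htt⟩ := h (s, s') ⟨hs, hs'⟩ (by simp [h1, h2])
    simp only [coneDiff_apply, Prod.mk.injEq] at htt
    exact ⟨t, ht, t', ht', htt⟩
  · rintro h ⟨s, s'⟩ ⟨hs, hs'⟩ h0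
    simp only [coneDiff_apply, Prod.mk_eq_zero, sub_eq_zero] at h0
    obtain ⟨t, ht, t', ht', h1, h2⟩ := h s hs s' hs' h0.1 h0.2
    exact ⟨(t, t'), ⟨ht, ht'⟩, by simp [h1, h2]⟩

theorem isQuasiIso_top_iff (hf : ∀ x, f (d x) = d' (f x)) :
    IsQuasiIso d d' f ⊤ ⊤ ↔ (∀ z, d z = 0 → (∃ s, f z = d' s) → ∃ t, d t = z) ∧
      ∀ z', d' z' = 0 → ∃ z, d z = 0 ∧ ∃ t, f z - d' t = z' := by
  simp only [isQuasiIso_iff, Submodule.mem_top, true_and, forall_const]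
  refine ⟨fun h ↦ ⟨fun z hz ⟨s, hs⟩ ↦ ?_, fun z' hz' ↦ ?_⟩, fun ⟨h1, h2⟩ s s' hs hss ↦ ?_⟩
  · obtain ⟨t, -, ht, -⟩ := h z s hz hs
    exact ⟨t, ht⟩
  · obtain ⟨t, t', h1, h2⟩ := h 0 z' (map_zero _) (by simp [hz'])
    exact ⟨t, h1, t', h2⟩
  · obtain ⟨t, ht⟩ := h1 s hs ⟨s', hss⟩
    obtain ⟨z, hz, w, hw⟩ := h2 (s' - f t) (by rw [map_sub, ← hf, ht, hss, sub_self])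
    refine ⟨t + z, w, by rw [map_add, ht, hz, add_zero], ?_⟩
    rw [map_add, add_sub_assoc, hw, add_sub_cancel]

theorem Acyclic.sup (hd : ∀ x, d (d x) = 0) {A B : Submodule R M}
    (hAd : ∀ x ∈ A, d x ∈ A) (hBd : ∀ x ∈ B, d x ∈ B)
    (hA : Acyclic d A) (hB : Acyclic d B) (hAB : Acyclic d (A ⊓ B)) : Acyclic d (A ⊔ B) := by
  intro c hc h0
  obtain ⟨a, ha, b, hb, rfl⟩ := Submodule.mem_sup.1 hc
  have hab : d a = - d b := by
    rw [map_add] at h0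
    exact eq_neg_of_add_eq_zero_left h0
  obtain ⟨e, he, hde⟩ := hAB (d a) ⟨hAd a ha, by rw [hab]; exact B.neg_mem (hBd b hb)⟩ (hd a)
  obtain ⟨α, hα, hdα⟩ := hA (a - e) (A.sub_mem ha he.1) (by rw [map_sub, hde, sub_self])
  obtain ⟨β, hβ, hdβ⟩ := hB (b + e) (B.add_mem hb he.2) (by rw [map_add, hde, hab]; simp)
  exact ⟨α + β, Submodule.add_mem_sup hα hβ, by rw [map_add, hdα, hdβ]; abel⟩

/-- The Mayer–Vietoris principle for quasi-isomorphisms. -/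
theorem IsQuasiIso.sup (hd : ∀ x, d (d x) = 0) (hd' : ∀ x, d' (d' x) = 0)
    (hf : ∀ x, f (d x) = d' (f x)) {A B : Submodule R M} {A' B' : Submodule R M'}
    (hAd : ∀ x ∈ A, d x ∈ A) (hBd : ∀ x ∈ B, d x ∈ B)
    (hAd' : ∀ x ∈ A', d' x ∈ A') (hBd' : ∀ x ∈ B', d' x ∈ B')
    (hAf : ∀ x ∈ A, f x ∈ A') (hBf : ∀ x ∈ B, f x ∈ B')
    (hA : IsQuasiIso d d' f A A') (hB : IsQuasiIso d d' f B B')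
    (hAB : IsQuasiIso d d' f (A ⊓ B) (A' ⊓ B')) : IsQuasiIso d d' f (A ⊔ B) (A' ⊔ B') := by
  unfold IsQuasiIso at *
  rw [← Submodule.prod_sup_prod]
  rw [← Submodule.prod_inf_prod] at hAB
  refine Acyclic.sup ?_ ?_ ?_ hA hB hAB
  · rintro ⟨x, y⟩
    simp [hd, hd', hf]
  · rintro ⟨x, y⟩ ⟨hx, hy⟩
    exact ⟨hAd x hx, A'.sub_mem (hAf x hx) (hAd' y hy)⟩
  · rintro ⟨x, y⟩ ⟨hx, hy⟩
    exact ⟨hBd x hx, B'.sub_mem (hBf x hx) (hBd' y hy)⟩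

theorem relAcyclic_iff_isQuasiIso {S T : Submodule R M}
    (hd : ∀ x, d (d x) = 0) :
    RelAcyclic d T S ↔ IsQuasiIso d d LinearMap.id S T := by
  rw [isQuasiIso_iff]
  constructor
  · intro h s hs t ht h0 h1
    obtain ⟨b, hb, hcb⟩ := h t ht (by simpa [← h1] using hs)
    exact ⟨t - d b, hcb, -b, T.neg_mem hb, by simpa [hd] using h1.symm, by simp⟩
  · intro h c hc hdc
    obtain ⟨t, ht, t', ht', h1, h2⟩ := h (d c) hdc c hc (hd c) rfl
    refine ⟨-t', T.neg_mem ht', ?_⟩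
    rw [← h2]
    simpa using ht

/-- The Mayer–Vietoris principle for the vanishing of relative homology. -/
theorem RelAcyclic.sup (hd : ∀ x, d (d x) = 0) {A B A' B' : Submodule R M}
    (hAd : ∀ x ∈ A, d x ∈ A) (hBd : ∀ x ∈ B, d x ∈ B)
    (hAd' : ∀ x ∈ A', d x ∈ A') (hBd' : ∀ x ∈ B', d x ∈ B') (hAA : A ≤ A') (hBB : B ≤ B')
    (hA : RelAcyclic d A' A) (hB : RelAcyclic d B' B) (hAB : RelAcyclic d (A' ⊓ B') (A ⊓ B)) :
    RelAcyclic d (A' ⊔ B') (A ⊔ B) := by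
  rw [relAcyclic_iff_isQuasiIso hd]
  rw [relAcyclic_iff_isQuasiIso hd] at hA
  rw [relAcyclic_iff_isQuasiIso hd] at hB
  rw [relAcyclic_iff_isQuasiIso hd] at hAB
  exact IsQuasiIso.sup (f := LinearMap.id) hd hd (fun _ ↦ rfl) hAd hBd
    (fun x hx ↦ hAd' x hx) (fun x hx ↦ hBd' x hx)
    (fun _ hx ↦ hAA hx) (fun _ hx ↦ hBB hx) hA hB hAB

theorem RelAcyclic.trans (hd : ∀ x, d (d x) = 0) {A B C : Submodule R M} (hAB : A ≤ B)
    (hBC : B ≤ C) (hCB : RelAcyclic d C B) (hBA : RelAcyclic d B A) : RelAcyclic d C A := by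
  intro c hc hdc
  obtain ⟨b, hb, h1⟩ := hCB c hc (hAB hdc)
  obtain ⟨b', hb', h2⟩ := hBA _ h1 (by simpa [hd] using hdc)
  exact ⟨b + b', C.add_mem hb (hBC hb'), by simpa [sub_sub] using h2⟩

theorem RelAcyclic.of_relAcyclic (hd : ∀ x, d (d x) = 0) {A B C : Submodule R M} (hAB : A ≤ B)
    (hBC : B ≤ C) (hCA : RelAcyclic d C A) (hBA : RelAcyclic d B A) : RelAcyclic d C B := by
  intro c hc hdc
  obtain ⟨w, hw, h1⟩ := hBA (d c) hdc (by rw [hd]; exact A.zero_mem)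
  obtain ⟨b, hb, h2⟩ := hCA (c - w) (C.sub_mem hc (hBC hw)) (by simpa using h1)
  refine ⟨b, hb, ?_⟩
  have := B.add_mem (hAB h2) hw
  convert this using 1
  abel

/-- A quasi-isomorphism on subcomplexes with vanishing relative homology extends. -/
theorem IsQuasiIso.extend (hd : ∀ x, d (d x) = 0) (hd' : ∀ x, d' (d' x) = 0)
    (hf : ∀ x, f (d x) = d' (f x)) {S T : Submodule R M} {S' T' : Submodule R M'}
    (hSf : ∀ x ∈ S, f x ∈ S') (hTf : ∀ x ∈ T, f x ∈ T') (hST : S ≤ T) (hST' : S' ≤ T')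
    (h : IsQuasiIso d d' f S S') (hT : RelAcyclic d T S) (hT' : RelAcyclic d' T' S') :
    IsQuasiIso d d' f T T' := by
  rw [isQuasiIso_iff] at *
  intro s hs s' hs' h0 h1
  obtain ⟨b, hb, hsb⟩ := hT s hs (by rw [h0]; exact S.zero_mem)
  obtain ⟨b', hb', hsb'⟩ := hT' (s' - f b) (T'.sub_mem hs' (hTf b hb)) (by
    rw [map_sub, ← h1, ← hf, ← map_sub]
    exact hSf _ hsb)
  obtain ⟨t, ht, t', ht', h2, h3⟩ := h _ hsb _ hsb' (by simp [h0, hd]) (by simp [h1, hf, hd'])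
  refine ⟨t + b, T.add_mem (hST ht) hb, t' - b', T'.sub_mem (hST' ht') hb', by simp [h2], ?_⟩
  rw [map_add, map_sub, ← sub_eq_zero]
  rw [← sub_eq_zero] at h3
  rw [← h3]
  abel

theorem isQuasiIso_range_iff {e : N →ₗ[R] N} {e' : N' →ₗ[R] N'} {g : N →ₗ[R] N'}
    {i : N →ₗ[R] M} {i' : N' →ₗ[R] M'} (hi : Function.Injective i) (hi' : Function.Injective i')
    (hid : ∀ x, i (e x) = d (i x)) (hid' : ∀ x, i' (e' x) = d' (i' x))
    (hig : ∀ x, i' (g x) = f (i x)) :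
    IsQuasiIso d d' f (LinearMap.range i) (LinearMap.range i') ↔ IsQuasiIso e e' g ⊤ ⊤ := by
  simp only [isQuasiIso_iff, LinearMap.mem_range, forall_exists_index,
    forall_apply_eq_imp_iff, exists_exists_eq_and, ← hid, ← hid', ← hig, ← map_sub, hi.eq_iff,
    hi'.eq_iff, map_eq_zero_iff i hi, Submodule.mem_top, true_and, forall_const]

end DifferentialModule

end Conley

/-! ### Quasi-isomorphisms of complexes of modules, in terms of elements -/

namespace Conley

section Elements

variable {R : Type u} [Ring R] {K L : ChainComplex (ModuleCat.{u} R) ℕ} (φ : K ⟶ L)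

theorem exists_cycle_of_d_eq_zero (K : ChainComplex (ModuleCat.{u} R) ℕ) (n : ℕ) (x : K.X n)
    (hx : (K.dFrom n) x = 0) : ∃ z : K.cycles n, K.iCycles n z = x := by
  have := (ShortComplex.exact_of_f_is_kernel (ShortComplex.mk (K.iCycles n)
    (K.d n (ComplexShape.down ℕ|>.next n)) (by simp)) (K.cyclesIsKernel n _ rfl))
  rw [ShortComplex.moduleCat_exact_iff] at this
  exact this x hx

theorem exists_toCycles_of_homologyπ_eq_zero (K : ChainComplex (ModuleCat.{u} R) ℕ) (n : ℕ)
    (z : K.cycles n) (hz : K.homologyπ n z = 0) :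
    ∃ x : K.X (n + 1), K.d (n + 1) n x = K.iCycles n z := by
  have := (ShortComplex.exact_of_g_is_cokernel (ShortComplex.mk (K.toCycles (n + 1) n)
    (K.homologyπ n) (by simp)) (K.homologyIsCokernel (n + 1) n (by simp)))
  rw [ShortComplex.moduleCat_exact_iff] at this
  obtain ⟨x, hx⟩ := this z hz
  refine ⟨x, ?_⟩
  rw [← K.toCycles_i (n + 1) n, ModuleCat.comp_apply]
  exact congrArg _ hx

theorem homologyπ_surjective (K : ChainComplex (ModuleCat.{u} R) ℕ) (n : ℕ) :
    Function.Surjective (K.homologyπ n) :=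
  (ModuleCat.epi_iff_surjective _).1 inferInstance

theorem iCycles_injective (K : ChainComplex (ModuleCat.{u} R) ℕ) (n : ℕ) :
    Function.Injective (K.iCycles n) :=
  (ModuleCat.mono_iff_injective _).1 inferInstance

theorem homologyπ_eq_zero_of_d (K : ChainComplex (ModuleCat.{u} R) ℕ) (n : ℕ)
    (z : K.cycles n) (x : K.X (n + 1)) (hx : K.d (n + 1) n x = K.iCycles n z) :
    K.homologyπ n z = 0 := by
  have : K.toCycles (n + 1) n x = z := by
    apply iCycles_injective K n
    rw [← ModuleCat.comp_apply, K.toCycles_i, hx]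
  rw [← this, ← ModuleCat.comp_apply, K.toCycles_comp_homologyπ]
  rfl

theorem dFrom_iCycles (K : ChainComplex (ModuleCat.{u} R) ℕ) (n : ℕ) (z : K.cycles n) :
    K.dFrom n (K.iCycles n z) = 0 := by
  have := K.iCycles_d n (ComplexShape.down ℕ|>.next n)
  exact congr($this z)

theorem homologyMap_homologyπ (n : ℕ) (z : K.cycles n) :
    HomologicalComplex.homologyMap φ n (K.homologyπ n z) =
      L.homologyπ n (HomologicalComplex.cyclesMap φ n z) :=
  congr($(HomologicalComplex.homologyπ_naturality φ n) z)

theorem iCycles_cyclesMap (n : ℕ) (z : K.cycles n) :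
    L.iCycles n (HomologicalComplex.cyclesMap φ n z) = φ.f n (K.iCycles n z) :=
  congr($(HomologicalComplex.cyclesMap_i φ n) z)

/-- A chain map is a quasi-isomorphism if and only if it is injective and surjective on
homology classes of cycles. -/
theorem quasiIso_iff_elements : QuasiIso φ ↔ ∀ n,
    (∀ z : K.X n, K.dFrom n z = 0 → (∃ s : L.X (n + 1), φ.f n z = L.d (n + 1) n s) →
      ∃ t : K.X (n + 1), K.d (n + 1) n t = z) ∧
    (∀ z' : L.X n, L.dFrom n z' = 0 → ∃ z : K.X n, K.dFrom n z = 0 ∧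
      ∃ t : L.X (n + 1), φ.f n z - L.d (n + 1) n t = z') := by
  rw [quasiIso_iff]
  refine forall_congr' fun n ↦ ?_
  rw [quasiIsoAt_iff_isIso_homologyMap, ConcreteCategory.isIso_iff_bijective]
  refine and_congr ?_ ?_
  · constructor
    · rintro h z hz ⟨s, hs⟩
      obtain ⟨z, rfl⟩ := exists_cycle_of_d_eq_zero K n z hz
      apply exists_toCycles_of_homologyπ_eq_zero
      apply h
      rw [homologyMap_homologyπ, map_zero]
      exact homologyπ_eq_zero_of_d _ _ _ s (by rw [iCycles_cyclesMap, hs])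
    · intro h
      refine (injective_iff_map_eq_zero
        (HomologicalComplex.homologyMap φ n).hom).2 fun a ha ↦ ?_
      obtain ⟨z, rfl⟩ := homologyπ_surjective K n a
      replace ha : (HomologicalComplex.homologyMap φ n) (K.homologyπ n z) = 0 := ha
      rw [homologyMap_homologyπ] at ha
      obtain ⟨s, hs⟩ := exists_toCycles_of_homologyπ_eq_zero _ _ _ ha
      obtain ⟨t, ht⟩ := h (K.iCycles n z) (dFrom_iCycles _ _ _)
        ⟨s, by rw [hs, iCycles_cyclesMap]⟩
      exact homologyπ_eq_zero_of_d _ _ _ t ht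
  · constructor
    · intro h z' hz'
      obtain ⟨z', rfl⟩ := exists_cycle_of_d_eq_zero L n z' hz'
      obtain ⟨a, ha⟩ := h (L.homologyπ n z')
      obtain ⟨z, rfl⟩ := homologyπ_surjective K n a
      rw [homologyMap_homologyπ, ← sub_eq_zero, ← map_sub] at ha
      obtain ⟨t, ht⟩ := exists_toCycles_of_homologyπ_eq_zero _ _ _ ha
      refine ⟨K.iCycles n z, dFrom_iCycles _ _ _, t, ?_⟩
      rw [ht, map_sub, iCycles_cyclesMap, sub_sub_cancel]
    · intro h a
      obtain ⟨z', rfl⟩ := homologyπ_surjective L n a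
      obtain ⟨z, hz, t, ht⟩ := h (L.iCycles n z') (dFrom_iCycles _ _ _)
      obtain ⟨z, rfl⟩ := exists_cycle_of_d_eq_zero K n z hz
      refine ⟨K.homologyπ n z, ?_⟩
      rw [homologyMap_homologyπ, ← sub_eq_zero, ← map_sub]
      refine homologyπ_eq_zero_of_d _ _ _ t ?_
      rw [map_sub, iCycles_cyclesMap, ← ht]
      abel

end Elements

end Conley

/-! ### The total complex of a simplicial set -/

namespace Conley

section TotalComplex

variable (R : Type u) [Ring R]

/-- The chains of a simplicial set in all degrees: the free `R`-module on all simplices. -/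
abbrev Tot (Z : SSet.{u}) : Type u := (Σ n : ℕ, Z.obj (.op (.mk n))) →₀ R

/-- The basis element of the total complex given by a simplex. -/
noncomputable def chain {Z : SSet.{u}} {n : ℕ} (z : Z.obj (.op (.mk n))) : Tot R Z :=
  Finsupp.single ⟨n, z⟩ 1

/-- The boundary of a simplex. -/
noncomputable def bdSimplex (Z : SSet.{u}) : (Σ n : ℕ, Z.obj (.op (.mk n))) → Tot R Z
  | ⟨0, _⟩ => 0
  | ⟨n + 1, z⟩ => ∑ i : Fin (n + 2), (-1 : ℤ) ^ (i : ℕ) • chain R (Z.δ i z)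

open Simplicial Limits

/-- The differential of the total complex. -/
noncomputable def bd (Z : SSet.{u}) : Tot R Z →ₗ[R] Tot R Z :=
  Finsupp.linearCombination R (bdSimplex R Z)

variable {Z Z' Z'' : SSet.{u}}

/-- The map of total complexes induced by a map of simplicial sets. -/
noncomputable def totMap (f : Z ⟶ Z') : Tot R Z →ₗ[R] Tot R Z' :=
  Finsupp.lmapDomain R R fun z ↦ ⟨z.1, f.app _ z.2⟩

variable {R}

@[simp]
theorem bd_chain_zero (z : Z _⦋0⦌) : bd R Z (chain R z) = 0 := by
  simp [bd, bdSimplex, chain]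

theorem bd_chain_succ {n : ℕ} (z : Z _⦋n + 1⦌) : bd R Z (chain R z) =
    ∑ i : Fin (n + 2), (-1 : ℤ) ^ (i : ℕ) • chain R (Z.δ i z) := by
  rw [bd, chain, Finsupp.linearCombination_single, one_smul]
  rfl

@[simp]
theorem totMap_chain (f : Z ⟶ Z') {n : ℕ} (z : Z _⦋n⦌) :
    totMap R f (chain R z) = chain R (f.app _ z) := by
  simp [totMap, chain]

theorem tot_hom_ext {M : Type*} [AddCommGroup M] [Module R M] {f g : Tot R Z →ₗ[R] M}
    (h : ∀ (n : ℕ) (z : Z _⦋n⦌), f (chain R z) = g (chain R z)) : f = g :=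
  Finsupp.lhom_ext' fun ⟨n, z⟩ ↦ LinearMap.ext_ring (h n z)

theorem totMap_comp (f : Z ⟶ Z') (g : Z' ⟶ Z'') (c : Tot R Z) :
    totMap R (f ≫ g) c = totMap R g (totMap R f c) :=
  congr($(tot_hom_ext (f := totMap R (f ≫ g)) (g := totMap R g ∘ₗ totMap R f)
    (by intros; simp)) c)

theorem totMap_id (c : Tot R Z) : totMap R (𝟙 Z) c = c :=
  congr($(tot_hom_ext (f := totMap R (𝟙 Z)) (g := LinearMap.id) (by intros; simp)) c)

theorem totMap_bd (f : Z ⟶ Z') (c : Tot R Z) : totMap R f (bd R Z c) = bd R Z' (totMap R f c) :=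
  congr($(tot_hom_ext (f := totMap R f ∘ₗ bd R Z) (g := bd R Z' ∘ₗ totMap R f) (by
    rintro (_ | n) z
    · simp
    · simp [bd_chain_succ, SSet.δ_naturality_apply])) c)

theorem totMap_injective (f : Z ⟶ Z') [Mono f] : Function.Injective (totMap R f) := by
  refine Finsupp.mapDomain_injective ?_
  rintro ⟨n, z⟩ ⟨m, w⟩ h
  obtain rfl : n = m := congrArg Sigma.fst h
  rw [Sigma.mk.injEq, heq_eq_eq] at h ⊢
  exact ⟨rfl, (mono_iff_injective _).1 ((NatTrans.mono_iff_mono_app f).1 inferInstance _) h.2⟩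

/-! The comparison with the complex of modules defined in Mathlib. -/

variable (R)

/-- The simplicial chain complex, as a complex of modules, with coefficients in `R`. -/
noncomputable abbrev chains (Z : SSet.{u}) : ChainComplex (ModuleCat.{u} R) ℕ :=
  Z.chainComplex (ModuleCat.of R R)

/-- The inclusion of the chains of degree `n` in the total complex. -/
noncomputable def toTot (Z : SSet.{u}) (n : ℕ) : (chains R Z).X n →ₗ[R] Tot R Z :=
  (Limits.Sigma.desc fun z : Z _⦋n⦌ ↦
    ModuleCat.ofHom (Finsupp.lsingle (R := R) (M := R) (⟨n, z⟩ : Σ n : ℕ, Z _⦋n⦌)) :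
      (∐ fun _ : Z _⦋n⦌ ↦ ModuleCat.of R R) ⟶ ModuleCat.of R (Tot R Z)).hom

/-- The generator of the module of chains given by a simplex. -/
noncomputable def gen {Z : SSet.{u}} {n : ℕ} (z : Z _⦋n⦌) : (chains R Z).X n :=
  Z.ιChainComplex (R := ModuleCat.of R R) z (1 : R)

/-- The projection of the total complex to the chains of degree `n`. -/
noncomputable def ofTot (Z : SSet.{u}) (n : ℕ) : Tot R Z →ₗ[R] (chains R Z).X n :=
  Finsupp.linearCombination R fun z ↦
    if h : z.1 = n then gen R (h ▸ z.2) else 0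

variable {R}

theorem toTot_gen {n : ℕ} (z : Z _⦋n⦌) :
    toTot R Z n (gen R z) = chain R z :=
  DFunLike.congr_fun (congrArg ModuleCat.Hom.hom (Limits.Sigma.ι_desc (fun z : Z _⦋n⦌ ↦
    ModuleCat.ofHom (Finsupp.lsingle (R := R) (M := R) (⟨n, z⟩ : Σ n : ℕ, Z _⦋n⦌))) z)) (1 : R)

theorem ofTot_chain {n : ℕ} (z : Z _⦋n⦌) :
    ofTot R Z n (chain R z) = gen R z := by
  simp [ofTot, chain]

theorem ofTot_chain_of_ne {n m : ℕ} (z : Z _⦋n⦌) (h : n ≠ m) :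
    ofTot R Z m (chain R z) = 0 := by
  simp [ofTot, chain, h]

theorem chains_hom_ext {M : Type u} [AddCommGroup M] [Module R M] {n : ℕ}
    {f g : (chains R Z).X n →ₗ[R] M}
    (h : ∀ z : Z _⦋n⦌, f (gen R z) =
      g (gen R z)) : f = g := by
  have : ModuleCat.ofHom f = ModuleCat.ofHom g := by
    refine SSet.chainComplex_hom_ext fun z ↦ ?_
    ext
    exact h z
  exact congr(ModuleCat.Hom.hom $this)

theorem ofTot_toTot {n : ℕ} (c : (chains R Z).X n) : ofTot R Z n (toTot R Z n c) = c :=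
  congr($(chains_hom_ext (f := ofTot R Z n ∘ₗ toTot R Z n) (g := LinearMap.id)
    (by intro z; rw [LinearMap.comp_apply, toTot_gen, ofTot_chain, LinearMap.id_apply])) c)

theorem d_gen {n : ℕ} (z : Z _⦋n + 1⦌) :
    (chains R Z).d (n + 1) n (gen R z) =
    ∑ i : Fin (n + 2), (-1 : ℤ) ^ (i : ℕ) •
      gen R (Z.δ i z) := by
  have := congr($(Z.ιChainComplex_d (R := ModuleCat.of R R) z) (1 : R))
  refine this.trans ?_
  simp [gen]

theorem bd_toTot {n : ℕ} (c : (chains R Z).X (n + 1)) :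
    bd R Z (toTot R Z (n + 1) c) = toTot R Z n ((chains R Z).d (n + 1) n c) :=
  congr($(chains_hom_ext (f := bd R Z ∘ₗ toTot R Z (n + 1))
    (g := toTot R Z n ∘ₗ ((chains R Z).d (n + 1) n).hom)
    (by
      intro z
      change bd R Z (toTot R Z (n + 1) (gen R z)) =
        toTot R Z n ((chains R Z).d (n + 1) n (gen R z))
      simp [toTot_gen, bd_chain_succ, d_gen])) c)

theorem bd_toTot_zero (c : (chains R Z).X 0) : bd R Z (toTot R Z 0 c) = 0 :=
  congr($(chains_hom_ext (f := bd R Z ∘ₗ toTot R Z 0) (g := 0)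
    (by intro z; rw [LinearMap.comp_apply, toTot_gen, bd_chain_zero, LinearMap.zero_apply])) c)

theorem ofTot_bd (n : ℕ) (c : Tot R Z) :
    ofTot R Z n (bd R Z c) = (chains R Z).d (n + 1) n (ofTot R Z (n + 1) c) :=
  congr($(tot_hom_ext (f := ofTot R Z n ∘ₗ bd R Z)
    (g := ((chains R Z).d (n + 1) n).hom ∘ₗ ofTot R Z (n + 1)) (by
      rintro (_ | m) z
      · simp [ofTot_chain_of_ne]
      · by_cases h : m = n
        · subst h
          change ofTot R Z m (bd R Z (chain R z)) =
            (chains R Z).d (m + 1) m (ofTot R Z (m + 1) (chain R z))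
          simp [bd_chain_succ, ofTot_chain, d_gen]
        · simp [bd_chain_succ, ofTot_chain_of_ne, h])) c)

theorem bd_bd (c : Tot R Z) : bd R Z (bd R Z c) = 0 :=
  congr($(tot_hom_ext (f := bd R Z ∘ₗ bd R Z) (g := 0) (by
    rintro (_ | _ | n) z
    · simp
    · rw [← toTot_gen, LinearMap.comp_apply, bd_toTot, bd_toTot_zero]; rfl
    · rw [← toTot_gen, LinearMap.comp_apply, bd_toTot, bd_toTot, ← ModuleCat.comp_apply,
        HomologicalComplex.d_comp_d]
      simp)) c)

theorem chainComplexMap_gen (f : Z ⟶ Z') {n : ℕ} (z : Z _⦋n⦌) :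
    (SSet.chainComplexMap f (ModuleCat.of R R)).f n (gen R z) = gen R (f.app _ z) :=
  congr($(SSet.ι_chainComplexMap_f _ _ f (ModuleCat.of R R) z) (1 : R))

theorem totMap_toTot (f : Z ⟶ Z') {n : ℕ} (c : (chains R Z).X n) :
    totMap R f (toTot R Z n c) =
      toTot R Z' n ((SSet.chainComplexMap f (ModuleCat.of R R)).f n c) :=
  congr($(chains_hom_ext (f := totMap R f ∘ₗ toTot R Z n)
    (g := toTot R Z' n ∘ₗ ((SSet.chainComplexMap f (ModuleCat.of R R)).f n).hom) (by
      intro z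
      change totMap R f (toTot R Z n (gen R z)) =
        toTot R Z' n ((SSet.chainComplexMap f (ModuleCat.of R R)).f n (gen R z))
      rw [chainComplexMap_gen, toTot_gen, toTot_gen, totMap_chain])) c)

theorem ofTot_totMap (f : Z ⟶ Z') (n : ℕ) (c : Tot R Z) :
    ofTot R Z' n (totMap R f c) =
      (SSet.chainComplexMap f (ModuleCat.of R R)).f n (ofTot R Z n c) :=
  congr($(tot_hom_ext (f := ofTot R Z' n ∘ₗ totMap R f)
    (g := ((SSet.chainComplexMap f (ModuleCat.of R R)).f n).hom ∘ₗ ofTot R Z n) (by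
      intro m z
      by_cases h : m = n
      · subst h
        change ofTot R Z' m (totMap R f (chain R z)) =
          (SSet.chainComplexMap f (ModuleCat.of R R)).f m (ofTot R Z m (chain R z))
        rw [ofTot_chain, totMap_chain, chainComplexMap_gen, ofTot_chain]
      · simp [ofTot_chain_of_ne, h])) c)

theorem exists_sum_toTot_eq (c : Tot R Z) :
    ∃ I : Finset ℕ, ∑ n ∈ I, toTot R Z n (ofTot R Z n c) = c := by
  suffices ∃ I : Finset ℕ, ∀ J, I ⊆ J → ∑ n ∈ J, toTot R Z n (ofTot R Z n c) = c from
    this.imp fun I hI ↦ hI I subset_rfl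
  induction c using Finsupp.induction_linear with
  | zero => exact ⟨∅, by simp⟩
  | add c c' h h' =>
    obtain ⟨I, hI⟩ := h
    obtain ⟨I', hI'⟩ := h'
    refine ⟨I ∪ I', fun J hJ ↦ ?_⟩
    simp only [map_add, Finset.sum_add_distrib]
    rw [hI J (Finset.union_subset_left hJ), hI' J (Finset.union_subset_right hJ)]
  | single z r =>
    obtain ⟨n, z⟩ := z
    refine ⟨{n}, fun J hJ ↦ ?_⟩
    have hz : Finsupp.single ⟨n, z⟩ r = r • chain R z := by simp [chain]
    rw [hz, Finset.sum_eq_single n]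
    · rw [map_smul, map_smul, ofTot_chain, toTot_gen]
    · intro m _ hm
      rw [map_smul, ofTot_chain_of_ne _ hm.symm, smul_zero, map_zero]
    · intro hn
      exact absurd (hJ (Finset.mem_singleton_self n)) hn

theorem dFrom_eq_zero_iff {n : ℕ} (c : (chains R Z).X n) :
    (chains R Z).dFrom n c = 0 ↔ bd R Z (toTot R Z n c) = 0 := by
  cases n with
  | zero =>
    rw [bd_toTot_zero, HomologicalComplex.dFrom_eq_zero _ (by simp)]
    simp
  | succ n =>
    rw [bd_toTot, HomologicalComplex.dFrom_eq _ (show (ComplexShape.down ℕ).Rel (n + 1) n by simp),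
      ModuleCat.comp_apply, map_eq_zero_iff _ (Function.LeftInverse.injective ofTot_toTot)]
    exact map_eq_zero_iff _ ((ModuleCat.mono_iff_injective
      ((chains R Z).xNextIso (show (ComplexShape.down ℕ).Rel (n + 1) n by simp)).inv).1
        inferInstance)

theorem dFrom_ofTot (n : ℕ) (c : Tot R Z) (hc : bd R Z c = 0) :
    (chains R Z).dFrom n (ofTot R Z n c) = 0 := by
  rw [dFrom_eq_zero_iff]
  cases n with
  | zero => exact bd_toTot_zero _
  | succ n => rw [bd_toTot, ← ofTot_bd, hc, map_zero, map_zero]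

/-- Quasi-isomorphisms of simplicial chain complexes can be detected on total complexes. -/
theorem isQuasiIso_totMap_iff (f : Z ⟶ Z') :
    IsQuasiIso (bd R Z) (bd R Z') (totMap R f) ⊤ ⊤ ↔
      QuasiIso (SSet.chainComplexMap f (ModuleCat.of R R)) := by
  rw [quasiIso_iff_elements, isQuasiIso_top_iff (totMap_bd f)]
  constructor
  · rintro ⟨h1, h2⟩ n
    refine ⟨fun z hz ⟨s, hs⟩ ↦ ?_, fun z' hz' ↦ ?_⟩
    · obtain ⟨t, ht⟩ := h1 (toTot R Z n z) ((dFrom_eq_zero_iff z).1 hz)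
        ⟨toTot R Z' (n + 1) s, by rw [bd_toTot, totMap_toTot, hs]⟩
      exact ⟨ofTot R Z (n + 1) t, by rw [← ofTot_bd, ht, ofTot_toTot]⟩
    · obtain ⟨z, hz, t, ht⟩ := h2 (toTot R Z' n z') ((dFrom_eq_zero_iff z').1 hz')
      refine ⟨ofTot R Z n z, dFrom_ofTot n z hz, ofTot R Z' (n + 1) t, ?_⟩
      rw [← ofTot_bd, ← ofTot_totMap, ← map_sub, ht, ofTot_toTot]
  · intro h
    refine ⟨fun z hz ⟨s, hs⟩ ↦ ?_, fun z' hz' ↦ ?_⟩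
    · choose t ht using fun n ↦ (h n).1 (ofTot R Z n z) (dFrom_ofTot n z hz)
        ⟨ofTot R Z' (n + 1) s, by rw [← ofTot_totMap, hs, ofTot_bd]⟩
      obtain ⟨I, hI⟩ := exists_sum_toTot_eq z
      refine ⟨∑ n ∈ I, toTot R Z (n + 1) (t n), ?_⟩
      simp only [map_sum, bd_toTot, ht, hI]
    · choose z hz t ht using fun n ↦ (h n).2 (ofTot R Z' n z') (dFrom_ofTot n z' hz')
      obtain ⟨I, hI⟩ := exists_sum_toTot_eq z'
      refine ⟨∑ n ∈ I, toTot R Z n (z n), ?_, ∑ n ∈ I, toTot R Z' (n + 1) (t n), ?_⟩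
      · simp only [map_sum, (dFrom_eq_zero_iff _).1 (hz _), Finset.sum_const_zero]
      · simp only [map_sum, bd_toTot, totMap_toTot, ← Finset.sum_sub_distrib, ← map_sub, ht, hI]

end TotalComplex

end Conley

/-! ### Singular simplices and affine simplices -/

namespace Conley

open Simplicial

section SingularSimplices

variable {X Y : Type u} [TopologicalSpace X] [TopologicalSpace Y]

/-- The singular simplicial set of a space. -/
noncomputable abbrev Sing (X : Type u) [TopologicalSpace X] : SSet.{u} :=
  TopCat.toSSet.obj (TopCat.of X)

/-- The singular simplex given by a continuous map on a standard simplex. -/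
noncomputable def sMk {n : ℕ} (σ : C(stdSimplex ℝ (Fin (n + 1)), X)) : Sing X _⦋n⦌ :=
  (TopCat.toSSetObjEquiv (TopCat.of X) (.op ⦋n⦌)).symm σ

/-- The continuous map on a standard simplex given by a singular simplex. -/
noncomputable def sMap {n : ℕ} (z : Sing X _⦋n⦌) : C(stdSimplex ℝ (Fin (n + 1)), X) :=
  TopCat.toSSetObjEquiv (TopCat.of X) (.op ⦋n⦌) z

@[simp] theorem sMap_sMk {n : ℕ} (σ : C(stdSimplex ℝ (Fin (n + 1)), X)) : sMap (sMk σ) = σ :=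
  Equiv.apply_symm_apply _ _

@[simp] theorem sMk_sMap {n : ℕ} (z : Sing X _⦋n⦌) : sMk (sMap z) = z :=
  Equiv.symm_apply_apply _ _

/-- The affine map of standard simplices given by a map of the vertices. -/
noncomputable def simplexMap {n m : ℕ} (θ : Fin (n + 1) → Fin (m + 1)) :
    C(stdSimplex ℝ (Fin (n + 1)), stdSimplex ℝ (Fin (m + 1))) :=
  ⟨stdSimplex.map θ, stdSimplex.continuous_map θ⟩

theorem sing_δ_sMk {n : ℕ} (i : Fin (n + 2)) (σ : C(stdSimplex ℝ (Fin (n + 2)), X)) :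
    (Sing X).δ i (sMk σ) = sMk (σ.comp (simplexMap i.succAbove)) := rfl

theorem toSSet_map_sMk (f : C(X, Y)) {n : ℕ} (σ : C(stdSimplex ℝ (Fin (n + 1)), X)) :
    (TopCat.toSSet.map (TopCat.ofHom f)).app _ (sMk σ) = sMk (f.comp σ) := rfl

/-- The affine singular simplex with given vertices in a standard simplex. -/
noncomputable def aff {n m : ℕ} (v : Fin (n + 1) → stdSimplex ℝ (Fin (m + 1))) :
    C(stdSimplex ℝ (Fin (n + 1)), stdSimplex ℝ (Fin (m + 1))) where
  toFun t := ⟨∑ i, t i • (v i : Fin (m + 1) → ℝ),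
    (convex_stdSimplex ℝ _).sum_mem (fun i _ ↦ t.2.1 i) t.2.2 fun i _ ↦ (v i).2⟩
  continuous_toFun := by
    refine Continuous.subtype_mk (continuous_finsetSum _ fun i _ ↦ ?_) _
    exact ((continuous_apply i).comp continuous_subtype_val).smul continuous_const

theorem aff_comp_simplexMap {n m k : ℕ} (v : Fin (n + 1) → stdSimplex ℝ (Fin (m + 1)))
    (θ : Fin (k + 1) → Fin (n + 1)) : (aff v).comp (simplexMap θ) = aff (v ∘ θ) := by
  ext t j
  change (∑ i, (stdSimplex.map θ t) i • (v i : Fin (m + 1) → ℝ)) j =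
    (∑ i, t i • (v (θ i) : Fin (m + 1) → ℝ)) j
  refine congrFun ?_ j
  simp only [stdSimplex.map_coe, FunOnFinite.linearMap_apply_apply, Finset.sum_smul]
  refine Eq.trans (Finset.sum_congr rfl fun i _ ↦ ?_) (Finset.sum_fiberwise Finset.univ θ
    fun i ↦ t i • (v (θ i) : Fin (m + 1) → ℝ))
  refine Finset.sum_congr rfl fun x hx ↦ ?_
  obtain rfl : θ x = i := by simpa using hx
  rfl

theorem aff_comp_aff {n m k : ℕ} (v : Fin (n + 1) → stdSimplex ℝ (Fin (m + 1)))
    (w : Fin (k + 1) → stdSimplex ℝ (Fin (n + 1))) :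
    (aff v).comp (aff w) = aff (aff v ∘ w) := by
  ext t j
  change (∑ i, (∑ l, t l • (w l : Fin (n + 1) → ℝ)) i • (v i : Fin (m + 1) → ℝ)) j =
    (∑ l, t l • ∑ i, w l i • (v i : Fin (m + 1) → ℝ)) j
  simp only [Finset.sum_apply, Finset.sum_smul, Finset.smul_sum, Pi.smul_apply, smul_eq_mul,
    mul_smul]
  exact Finset.sum_comm

theorem aff_vertex (n : ℕ) : aff (fun i : Fin (n + 1) ↦ stdSimplex.vertex (S := ℝ) i) =
    ContinuousMap.id _ := by
  ext t j
  change (∑ i, t i • (stdSimplex.vertex i : Fin (n + 1) → ℝ)) j = t j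
  simp [Finset.sum_apply, stdSimplex.vertex_coe, Pi.single_apply]

theorem aff_apply_vertex {n m : ℕ} (v : Fin (n + 1) → stdSimplex ℝ (Fin (m + 1)))
    (i : Fin (n + 1)) : aff v (stdSimplex.vertex i) = v i := by
  ext j
  change (∑ l, (stdSimplex.vertex i : Fin (n + 1) → ℝ) l • (v l : Fin (m + 1) → ℝ)) j = v i j
  simp [Finset.sum_apply, stdSimplex.vertex_coe, Pi.single_apply, ite_apply]

end SingularSimplices

section SupportedChains

variable (R : Type u) [Ring R]

/-- The chains supported on a set of simplices. -/
noncomputable abbrev chainsOn {Z : SSet.{u}} (s : Set (Σ n : ℕ, Z _⦋n⦌)) :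
    Submodule R (Tot R Z) := Finsupp.supported R R s

variable {R} {Z : SSet.{u}}

theorem chain_mem_chainsOn {s : Set (Σ n : ℕ, Z _⦋n⦌)} {n : ℕ} {z : Z _⦋n⦌} (h : ⟨n, z⟩ ∈ s) :
    chain R z ∈ chainsOn R s :=
  Finsupp.single_mem_supported R 1 h

theorem map_mem_of_mem_chainsOn {M : Type*} [AddCommGroup M] [Module R M]
    {s : Set (Σ n : ℕ, Z _⦋n⦌)} {P : Submodule R M} (f : Tot R Z →ₗ[R] M)
    (h : ∀ (n : ℕ) (z : Z _⦋n⦌), ⟨n, z⟩ ∈ s → f (chain R z) ∈ P) {c : Tot R Z}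
    (hc : c ∈ chainsOn R s) : f c ∈ P := by
  rw [chainsOn, Finsupp.supported_eq_span_single] at hc
  have : Submodule.span R ((fun i ↦ Finsupp.single i (1 : R)) '' s) ≤ P.comap f := by
    rw [Submodule.span_le]
    rintro _ ⟨⟨n, z⟩, hz, rfl⟩
    exact h n z hz
  exact this hc

theorem chainsOn_union (s t : Set (Σ n : ℕ, Z _⦋n⦌)) :
    chainsOn R (s ∪ t) = chainsOn R s ⊔ chainsOn R t :=
  Finsupp.supported_union _ _

theorem chainsOn_inter (s t : Set (Σ n : ℕ, Z _⦋n⦌)) :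
    chainsOn R (s ∩ t) = chainsOn R s ⊓ chainsOn R t :=
  Finsupp.supported_inter _ _

theorem chainsOn_mono {s t : Set (Σ n : ℕ, Z _⦋n⦌)} (h : s ⊆ t) :
    chainsOn R s ≤ chainsOn R t :=
  Finsupp.supported_mono h

theorem bd_mem_chainsOn {s : Set (Σ n : ℕ, Z _⦋n⦌)}
    (hs : ∀ (n : ℕ) (z : Z _⦋n + 1⦌), ⟨n + 1, z⟩ ∈ s → ∀ i, ⟨n, Z.δ i z⟩ ∈ s) {c : Tot R Z}
    (hc : c ∈ chainsOn R s) : bd R Z c ∈ chainsOn R s := by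
  refine map_mem_of_mem_chainsOn (bd R Z) ?_ hc
  rintro (_ | n) z hz
  · simp
  · rw [bd_chain_succ]
    exact Submodule.sum_mem _ fun i _ ↦ zsmul_mem (chain_mem_chainsOn (hs n z hz i)) _

theorem totMap_mem_chainsOn {Z' : SSet.{u}} (f : Z ⟶ Z') {s : Set (Σ n : ℕ, Z _⦋n⦌)}
    {t : Set (Σ n : ℕ, Z' _⦋n⦌)}
    (h : ∀ (n : ℕ) (z : Z _⦋n⦌), ⟨n, z⟩ ∈ s → ⟨n, f.app _ z⟩ ∈ t) {c : Tot R Z}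
    (hc : c ∈ chainsOn R s) : totMap R f c ∈ chainsOn R t := by
  refine map_mem_of_mem_chainsOn _ (fun n z hz ↦ ?_) hc
  rw [totMap_chain]
  exact chain_mem_chainsOn (h n z hz)

variable (R) in
/-- The linear extension of an operation raising the degree of simplices by one. -/
noncomputable def raise (κ : ∀ n : ℕ, Z _⦋n⦌ → Z _⦋n + 1⦌) : Tot R Z →ₗ[R] Tot R Z :=
  Finsupp.lmapDomain R R fun z ↦ ⟨z.1 + 1, κ z.1 z.2⟩

@[simp]
theorem raise_chain (κ : ∀ n : ℕ, Z _⦋n⦌ → Z _⦋n + 1⦌) {n : ℕ} (z : Z _⦋n⦌) :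
    raise R κ (chain R z) = chain R (κ n z) := by
  simp [raise, chain]

variable (R) in
/-- The augmentation, which vanishes in positive degrees. -/
noncomputable def augment (Z : SSet.{u}) : Tot R Z →ₗ[R] R :=
  Finsupp.linearCombination R fun z ↦ if z.1 = 0 then 1 else 0

@[simp]
theorem augment_chain_zero (z : Z _⦋0⦌) : augment R Z (chain R z) = 1 := by
  simp [augment, chain]

@[simp]
theorem augment_chain_succ {n : ℕ} (z : Z _⦋n + 1⦌) : augment R Z (chain R z) = 0 := by
  simp [augment, chain]

/-- The boundary of a cone with apex `p`. -/
theorem bd_raise_chain (κ : ∀ n : ℕ, Z _⦋n⦌ → Z _⦋n + 1⦌) (p : Z _⦋0⦌)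
    {s : Set (Σ n : ℕ, Z _⦋n⦌)}
    (h₀ : ∀ (n : ℕ) (z : Z _⦋n⦌), ⟨n, z⟩ ∈ s → Z.δ 0 (κ n z) = z)
    (h₁ : ∀ z : Z _⦋0⦌, ⟨0, z⟩ ∈ s → Z.δ 1 (κ 0 z) = p)
    (h₂ : ∀ (n : ℕ) (z : Z _⦋n + 1⦌), ⟨n + 1, z⟩ ∈ s →
      ∀ i : Fin (n + 2), Z.δ i.succ (κ (n + 1) z) = κ n (Z.δ i z))
    {c : Tot R Z} (hc : c ∈ chainsOn R s) :
    bd R Z (raise R κ c) = c - raise R κ (bd R Z c) - augment R Z c • chain R p := by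
  have := map_mem_of_mem_chainsOn (P := ⊥) (bd R Z ∘ₗ raise R κ - LinearMap.id
    + raise R κ ∘ₗ bd R Z + (augment R Z).smulRight (chain R p)) ?_ hc
  · simp only [Submodule.mem_bot, LinearMap.add_apply, LinearMap.sub_apply,
      LinearMap.comp_apply, LinearMap.id_apply, LinearMap.smulRight_apply] at this
    rw [← sub_eq_zero, ← this]
    abel
  · rintro (_ | n) z hz
    · simp [bd_chain_succ, Fin.sum_univ_two, h₀ 0 z hz, h₁ z hz]
    · simp [bd_chain_succ, Fin.sum_univ_succ (n := n + 2), h₀ _ z hz, h₂ _ z hz, pow_succ]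

end SupportedChains

end Conley

/-! ### Barycentric subdivision -/

namespace Conley

section Tuples

/-- The simplicial set of all tuples of elements of `K`. -/
def tuples (K : Type u) : SSet.{u} where
  obj n := Fin (n.unop.len + 1) → K
  map θ := ↾fun v ↦ v ∘ θ.unop.toOrderHom

variable {K K' : Type u}

/-- A tuple, as a simplex. -/
def tup {n : ℕ} (v : Fin (n + 1) → K) : (tuples K).obj (.op (.mk n)) := v

variable (R : Type u) [Ring R]

/-- The cone operator with apex `p`, which adds a first element to a tuple. -/
noncomputable def tupleCone (p : K) : Tot R (tuples K) →ₗ[R] Tot R (tuples K) :=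
  raise R (Z := tuples K) fun n (v : Fin (n + 1) → K) ↦ tup (Fin.cons p v : Fin (n + 2) → K)

/-- The chain homotopy `T` between the identity and the subdivision operator on a tuple, for a
choice `b` of a barycenter of every tuple. It is defined by the recursion that `T v` is the cone
from the barycenter over `v - T (∂ v)`. -/
noncomputable def homotopyAux (b : ∀ n : ℕ, (Fin (n + 1) → K) → K) :
    ∀ n : ℕ, (Fin (n + 1) → K) → Tot R (tuples K)
  | 0, _ => 0
  | n + 1, v => tupleCone R (b (n + 1) v) (chain R (tup v) -
      ∑ i : Fin (n + 2), (-1 : ℤ) ^ (i : ℕ) • homotopyAux b n (v ∘ i.succAbove))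

/-- The chain homotopy between the identity and the subdivision operator on tuples. -/
noncomputable def tupleHomotopy (b : ∀ n : ℕ, (Fin (n + 1) → K) → K) :
    Tot R (tuples K) →ₗ[R] Tot R (tuples K) :=
  Finsupp.linearCombination R fun z ↦ homotopyAux R b z.1 z.2

open Simplicial

variable {R}

theorem tuples_δ {n : ℕ} (i : Fin (n + 2)) (v : Fin (n + 2) → K) :
    (tuples K).δ i (tup v) = tup (v ∘ i.succAbove) := rfl

theorem exists_tup_eq {n : ℕ} (z : tuples K _⦋n⦌) : ∃ v : Fin (n + 1) → K, tup v = z := ⟨z, rfl⟩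

/-- The map on tuples induced by a map of sets. -/
def tuplesMap (h : K → K') : tuples K ⟶ tuples K' where
  app n := ↾fun v ↦ h ∘ v

theorem tuplesMap_tup (h : K → K') {n : ℕ} (v : Fin (n + 1) → K) :
    (tuplesMap h).app _ (tup v) = tup (h ∘ v) := rfl

theorem tuples_hom_ext {M : Type*} [AddCommGroup M] [Module R M] {f g : Tot R (tuples K) →ₗ[R] M}
    (h : ∀ (n : ℕ) (v : Fin (n + 1) → K), f (chain R (tup v)) = g (chain R (tup v))) : f = g :=
  tot_hom_ext h

theorem tupleCone_chain (p : K) {n : ℕ} (v : Fin (n + 1) → K) :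
    tupleCone R p (chain R (tup v)) = chain R (tup (Fin.cons p v : Fin (n + 2) → K)) :=
  raise_chain (Z := tuples K) _ _

theorem bd_tupleCone (p : K) (c : Tot R (tuples K)) :
    bd R _ (tupleCone R p c) = c - tupleCone R p (bd R _ c) -
      augment R _ c • chain R (tup (n := 0) fun _ ↦ p) := by
  refine bd_raise_chain (s := Set.univ) _ _ (fun n z _ ↦ ?_) (fun z _ ↦ ?_)
    (fun n z _ i ↦ ?_) (by simp [chainsOn])
  · rw [tuples_δ]
    exact funext fun i ↦ rfl
  · rw [tuples_δ]
    refine congrArg tup (funext fun i ↦ ?_)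
    obtain rfl : i = 0 := Fin.fin_one_eq_zero i
    rfl
  · rw [tuples_δ]
    refine congrArg tup (funext fun j ↦ ?_)
    refine Fin.cases rfl (fun j ↦ ?_) j
    rw [Function.comp_apply, Fin.succ_succAbove_succ]
    rfl

variable (b : ∀ n : ℕ, (Fin (n + 1) → K) → K) (b' : ∀ n : ℕ, (Fin (n + 1) → K') → K')

theorem tupleHomotopy_chain {n : ℕ} (v : Fin (n + 1) → K) :
    tupleHomotopy R b (chain R (tup v)) = homotopyAux R b n v := by
  simp [tupleHomotopy, chain, tup]

theorem tupleHomotopy_chain_zero (v : Fin 1 → K) :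
    tupleHomotopy R b (chain R (tup v)) = 0 :=
  tupleHomotopy_chain b v

theorem tupleHomotopy_chain_succ {n : ℕ} (v : Fin (n + 2) → K) :
    tupleHomotopy R b (chain R (tup v)) =
      tupleCone R (b (n + 1) v) (chain R (tup v) -
        tupleHomotopy R b (bd R _ (chain R (tup v)))) := by
  rw [tupleHomotopy_chain, homotopyAux, bd_chain_succ]
  simp only [map_sum, map_zsmul, tuples_δ, tupleHomotopy_chain]

theorem augment_tupleCone (p : K) (c : Tot R (tuples K)) : augment R _ (tupleCone R p c) = 0 :=
  congr($(tuples_hom_ext (f := augment R _ ∘ₗ tupleCone R p) (g := 0) (by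
    intro n v
    rw [LinearMap.comp_apply, tupleCone_chain, augment_chain_succ, LinearMap.zero_apply])) c)

theorem augment_tupleHomotopy (c : Tot R (tuples K)) :
    augment R _ (tupleHomotopy R b c) = 0 :=
  congr($(tuples_hom_ext (f := augment R _ ∘ₗ tupleHomotopy R b) (g := 0) (by
    rintro (_ | n) v
    · rw [LinearMap.comp_apply, tupleHomotopy_chain_zero, map_zero, LinearMap.zero_apply]
    · rw [LinearMap.comp_apply, tupleHomotopy_chain_succ, augment_tupleCone,
        LinearMap.zero_apply])) c)

theorem totMap_tupleCone (h : K → K') (p : K) (c : Tot R (tuples K)) :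
    totMap R (tuplesMap h) (tupleCone R p c) =
      tupleCone R (h p) (totMap R (tuplesMap h) c) :=
  congr($(tuples_hom_ext (f := totMap R (tuplesMap h) ∘ₗ tupleCone R p)
    (g := tupleCone R (h p) ∘ₗ totMap R (tuplesMap h)) (by
      intro n v
      rw [LinearMap.comp_apply, LinearMap.comp_apply, tupleCone_chain, totMap_chain,
        totMap_chain]
      rw [tuplesMap_tup, tuplesMap_tup, tupleCone_chain, Fin.comp_cons])) c)

variable {b b'} in
/-- The homotopy is natural for maps preserving barycenters. -/
theorem totMap_tupleHomotopy {h : K → K'}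
    (hb : ∀ (n : ℕ) (v : Fin (n + 1) → K), h (b n v) = b' n (h ∘ v)) (c : Tot R (tuples K)) :
    totMap R (tuplesMap h) (tupleHomotopy R b c) =
      tupleHomotopy R b' (totMap R (tuplesMap h) c) := by
  refine congr($(tuples_hom_ext (f := totMap R (tuplesMap h) ∘ₗ tupleHomotopy R b)
    (g := tupleHomotopy R b' ∘ₗ totMap R (tuplesMap h)) ?_) c)
  intro n
  induction n with
  | zero =>
    intro v
    rw [LinearMap.comp_apply, LinearMap.comp_apply, tupleHomotopy_chain_zero, map_zero,
      totMap_chain, tuplesMap_tup, tupleHomotopy_chain_zero]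
  | succ n ih =>
    intro v
    rw [LinearMap.comp_apply, LinearMap.comp_apply, tupleHomotopy_chain_succ,
      totMap_tupleCone, totMap_chain, hb, tuplesMap_tup, tupleHomotopy_chain_succ, map_sub,
      totMap_chain, tuplesMap_tup]
    congr 2
    rw [← tuplesMap_tup, ← totMap_chain, ← totMap_bd, bd_chain_succ]
    simp only [map_sum, map_zsmul]
    exact Finset.sum_congr rfl fun i _ ↦ congrArg _ (ih _)

variable (R) in
/-- The subdivision operator `id - ∂ T - T ∂` on tuples; defined in this way it is a chain map
homotopic to the identity. -/
noncomputable def tupleSubd : Tot R (tuples K) →ₗ[R] Tot R (tuples K) :=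
  LinearMap.id - bd R _ ∘ₗ tupleHomotopy R b - tupleHomotopy R b ∘ₗ bd R _

theorem tupleSubd_apply (c : Tot R (tuples K)) : tupleSubd R b c =
    c - bd R _ (tupleHomotopy R b c) - tupleHomotopy R b (bd R _ c) := rfl

theorem tupleSubd_chain_zero (v : Fin 1 → K) :
    tupleSubd R b (chain R (tup v)) = chain R (tup v) := by
  rw [tupleSubd_apply, tupleHomotopy_chain_zero, bd_chain_zero, map_zero, map_zero]
  simp

/-- The subdivision of a tuple is the cone over the subdivision of its boundary. -/
theorem tupleSubd_chain_succ {n : ℕ} (v : Fin (n + 2) → K) :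
    tupleSubd R b (chain R (tup v)) =
      tupleCone R (b (n + 1) v)
        (tupleSubd R b (bd R _ (chain R (tup v)))) := by
  rw [tupleSubd_apply, tupleHomotopy_chain_succ, bd_tupleCone, map_sub (augment R _),
    augment_tupleHomotopy, tupleSubd_apply, bd_bd]
  have : augment R (tuples K) (chain R (tup v)) = 0 :=
    augment_chain_succ _
  rw [this]
  simp only [map_sub, map_zero, sub_zero, zero_smul]
  abel

end Tuples

end Conley

/-! ### Small simplices -/

namespace Conley

open Simplicial

section Subdivision

variable {X : Type u} [TopologicalSpace X]

/-- The points of a standard simplex, lifted to the ambient universe. -/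
abbrev Pt (m : ℕ) : Type u := ULift.{u} (stdSimplex ℝ (Fin (m + 1)))

/-- The affine simplex with given vertices. -/
noncomputable def affU {n m : ℕ} (v : Fin (n + 1) → Pt.{u} m) :
    C(stdSimplex ℝ (Fin (n + 1)), stdSimplex ℝ (Fin (m + 1))) :=
  aff fun i ↦ (v i).down

theorem affU_comp_simplexMap {n m k : ℕ} (v : Fin (n + 1) → Pt.{u} m)
    (θ : Fin (k + 1) → Fin (n + 1)) : (affU v).comp (simplexMap θ) = affU (v ∘ θ) :=
  aff_comp_simplexMap _ _

/-- The affine map between standard simplices given by the images of the vertices. -/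
noncomputable def affMap {n m : ℕ} (v : Fin (n + 1) → Pt.{u} m) (p : Pt.{u} n) : Pt.{u} m :=
  ⟨affU v p.down⟩

theorem affU_comp_affU {n m k : ℕ} (v : Fin (n + 1) → Pt.{u} m) (w : Fin (k + 1) → Pt.{u} n) :
    (affU v).comp (affU w) = affU (affMap v ∘ w) :=
  aff_comp_aff _ _

/-- The barycenter of an affine simplex. -/
noncomputable def bary {m : ℕ} (n : ℕ) (v : Fin (n + 1) → Pt.{u} m) : Pt.{u} m :=
  ⟨affU v stdSimplex.barycenter⟩

theorem affMap_bary {n m k : ℕ} (v : Fin (n + 1) → Pt.{u} m) (w : Fin (k + 1) → Pt.{u} n) :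
    affMap v (bary k w) = bary k (affMap v ∘ w) := by
  change ULift.up ((affU v).comp (affU w) _) = _
  rw [affU_comp_affU]
  rfl

/-- The vertices of the standard simplex. -/
def verts (n : ℕ) (i : Fin (n + 1)) : Pt.{u} n := ⟨stdSimplex.vertex i⟩

theorem affU_verts (n : ℕ) : affU (verts.{u} n) = ContinuousMap.id _ := aff_vertex n

theorem affMap_comp_verts {n m : ℕ} (v : Fin (n + 1) → Pt.{u} m) :
    affMap v ∘ verts n = v := funext fun i ↦ congrArg ULift.up (aff_apply_vertex _ i)

/-- The map of simplicial sets sending a tuple of points of a standard simplex to the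
composition of the affine simplex with these vertices and a singular simplex `σ`. -/
noncomputable def affSimplices {m : ℕ} (σ : C(stdSimplex ℝ (Fin (m + 1)), X)) :
    tuples (Pt.{u} m) ⟶ Sing X where
  app n := ↾fun v ↦ sMk (n := n.unop.len) (σ.comp (affU v))
  naturality n n' θ := by
    ext v
    exact congrArg (fun τ ↦ sMk (n := n'.unop.len) (σ.comp τ))
      (affU_comp_simplexMap (n := n.unop.len) v θ.unop.toOrderHom).symm

theorem affSimplices_tup {m n : ℕ} (σ : C(stdSimplex ℝ (Fin (m + 1)), X))
    (v : Fin (n + 1) → Pt.{u} m) :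
    (affSimplices σ).app _ (tup v) = sMk (σ.comp (affU v)) := rfl

theorem tuplesMap_comp_affSimplices {n m : ℕ} (σ : C(stdSimplex ℝ (Fin (m + 1)), X))
    (v : Fin (n + 1) → Pt.{u} m) :
    tuplesMap (affMap v) ≫ affSimplices σ = affSimplices (σ.comp (affU v)) := by
  ext k w
  exact congrArg (fun τ ↦ sMk (n := k.unop.len) (σ.comp τ))
    (affU_comp_affU (k := k.unop.len) v w).symm

variable (R : Type u) [Ring R]

variable (X) in
/-- The chain homotopy between the identity and the subdivision of singular chains. -/
noncomputable def singHomotopy : Tot R (Sing X) →ₗ[R] Tot R (Sing X) :=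
  Finsupp.linearCombination R fun z ↦
    totMap R (affSimplices (sMap z.2)) (tupleHomotopy R bary (chain R (tup (verts z.1))))

variable (X) in
/-- The subdivision of singular chains. -/
noncomputable def singSubd : Tot R (Sing X) →ₗ[R] Tot R (Sing X) :=
  LinearMap.id - bd R _ ∘ₗ singHomotopy X R - singHomotopy X R ∘ₗ bd R _

variable {R}

theorem singHomotopy_chain {n : ℕ} (z : Sing X _⦋n⦌) : singHomotopy X R (chain R z) =
    totMap R (affSimplices (sMap z)) (tupleHomotopy R bary (chain R (tup (verts n)))) := by
  simp [singHomotopy, chain]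

theorem singSubd_apply (c : Tot R (Sing X)) : singSubd X R c =
    c - bd R _ (singHomotopy X R c) - singHomotopy X R (bd R _ c) := rfl

/-- The homotopy of singular chains is natural, since affine maps preserve barycenters. -/
theorem totMap_affSimplices_tupleHomotopy {m : ℕ} (σ : C(stdSimplex ℝ (Fin (m + 1)), X))
    (c : Tot R (tuples (Pt.{u} m))) :
    totMap R (affSimplices σ) (tupleHomotopy R bary c) =
      singHomotopy X R (totMap R (affSimplices σ) c) :=
  congr($(tuples_hom_ext (f := totMap R (affSimplices σ) ∘ₗ tupleHomotopy R bary)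
    (g := singHomotopy X R ∘ₗ totMap R (affSimplices σ)) (by
      intro n v
      rw [LinearMap.comp_apply, LinearMap.comp_apply, totMap_chain, affSimplices_tup,
        singHomotopy_chain, sMap_sMk, ← tuplesMap_comp_affSimplices, totMap_comp,
        totMap_tupleHomotopy (fun k w ↦ affMap_bary v w), totMap_chain, tuplesMap_tup,
        affMap_comp_verts])) c)

theorem totMap_affSimplices_tupleSubd {m : ℕ} (σ : C(stdSimplex ℝ (Fin (m + 1)), X))
    (c : Tot R (tuples (Pt.{u} m))) :
    totMap R (affSimplices σ) (tupleSubd R bary c) =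
      singSubd X R (totMap R (affSimplices σ) c) := by
  rw [singSubd_apply, tupleSubd_apply, map_sub, map_sub, totMap_bd,
    totMap_affSimplices_tupleHomotopy, totMap_affSimplices_tupleHomotopy, totMap_bd]

theorem totMap_affSimplices_iterate {m : ℕ} (σ : C(stdSimplex ℝ (Fin (m + 1)), X)) (k : ℕ)
    (c : Tot R (tuples (Pt.{u} m))) :
    totMap R (affSimplices σ) ((tupleSubd R bary)^[k] c) =
      (singSubd X R)^[k] (totMap R (affSimplices σ) c) := by
  induction k generalizing c with
  | zero => rfl
  | succ k ih => rw [Function.iterate_succ_apply, Function.iterate_succ_apply, ih,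
      totMap_affSimplices_tupleSubd]

theorem chain_eq_totMap_affSimplices {n : ℕ} (z : Sing X _⦋n⦌) :
    chain R z = totMap R (affSimplices (sMap z)) (chain R (tup (verts n))) := by
  rw [totMap_chain, affSimplices_tup, affU_verts, ContinuousMap.comp_id, sMk_sMap]

/-- The singular simplices with image in a set. -/
def simplicesIn (A : Set X) : Set (Σ n : ℕ, Sing X _⦋n⦌) := {z | ∀ t, sMap z.2 t ∈ A}

theorem simplicesIn_mono {A B : Set X} (h : A ⊆ B) : simplicesIn A ⊆ simplicesIn B :=
  fun _ hz t ↦ h (hz t)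

theorem simplicesIn_inter (A B : Set X) :
    simplicesIn (A ∩ B) = simplicesIn A ∩ simplicesIn B := by
  ext z
  simp [simplicesIn, forall_and]

theorem δ_mem_simplicesIn {A : Set X} {n : ℕ} (z : Sing X _⦋n + 1⦌)
    (h : ⟨n + 1, z⟩ ∈ simplicesIn A) (i : Fin (n + 2)) :
    (⟨n, (Sing X).δ i z⟩ : Σ n : ℕ, Sing X _⦋n⦌) ∈ simplicesIn A := by
  intro t
  obtain ⟨σ, rfl⟩ : ∃ σ, sMk σ = z := ⟨sMap z, sMk_sMap z⟩
  rw [sing_δ_sMk, sMap_sMk]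
  simpa using h (simplexMap i.succAbove t)

theorem bd_mem_simplicesIn {A : Set X} {c : Tot R (Sing X)}
    (hc : c ∈ chainsOn R (simplicesIn A)) : bd R _ c ∈ chainsOn R (simplicesIn A) :=
  bd_mem_chainsOn (fun _ z hz i ↦ δ_mem_simplicesIn z hz i) hc

theorem singHomotopy_mem_simplicesIn {A : Set X} {c : Tot R (Sing X)}
    (hc : c ∈ chainsOn R (simplicesIn A)) :
    singHomotopy X R c ∈ chainsOn R (simplicesIn A) := by
  refine map_mem_of_mem_chainsOn _ (fun n z hz ↦ ?_) hc
  rw [singHomotopy_chain]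
  refine totMap_mem_chainsOn (s := Set.univ) _ (fun k v _ ↦ ?_) (by simp [chainsOn])
  obtain ⟨v, rfl⟩ := exists_tup_eq v
  intro t
  rw [affSimplices_tup, sMap_sMk]
  exact hz _

theorem singHomotopy_mem_sup {A B : Set X} {c : Tot R (Sing X)}
    (hc : c ∈ chainsOn R (simplicesIn A) ⊔ chainsOn R (simplicesIn B)) :
    singHomotopy X R c ∈ chainsOn R (simplicesIn A) ⊔ chainsOn R (simplicesIn B) := by
  obtain ⟨a, ha, b, hb, rfl⟩ := Submodule.mem_sup.1 hc
  rw [map_add]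
  exact Submodule.add_mem_sup (singHomotopy_mem_simplicesIn ha) (singHomotopy_mem_simplicesIn hb)

theorem bd_mem_sup {A B : Set X} {c : Tot R (Sing X)}
    (hc : c ∈ chainsOn R (simplicesIn A) ⊔ chainsOn R (simplicesIn B)) :
    bd R _ c ∈ chainsOn R (simplicesIn A) ⊔ chainsOn R (simplicesIn B) := by
  obtain ⟨a, ha, b, hb, rfl⟩ := Submodule.mem_sup.1 hc
  rw [map_add]
  exact Submodule.add_mem_sup (bd_mem_simplicesIn ha) (bd_mem_simplicesIn hb)

theorem singSubd_iterate_mem_sup {A B : Set X} {c : Tot R (Sing X)}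
    (hc : c ∈ chainsOn R (simplicesIn A) ⊔ chainsOn R (simplicesIn B)) (k : ℕ) :
    (singSubd X R)^[k] c ∈ chainsOn R (simplicesIn A) ⊔ chainsOn R (simplicesIn B) := by
  induction k with
  | zero => exact hc
  | succ k ih =>
    rw [Function.iterate_succ_apply', singSubd_apply]
    exact Submodule.sub_mem _ (Submodule.sub_mem _ ih (bd_mem_sup (singHomotopy_mem_sup ih)))
      (singHomotopy_mem_sup (bd_mem_sup ih))

end Subdivision

section Mesh

theorem dist_aff_le {n m : ℕ} (v : Fin (n + 1) → stdSimplex ℝ (Fin (m + 1)))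
    (t : stdSimplex ℝ (Fin (n + 1))) (p : stdSimplex ℝ (Fin (m + 1))) {d : ℝ}
    (h : ∀ i, dist (v i) p ≤ d) : dist (aff v t) p ≤ d := by
  have hb := (convex_closedBall (p : Fin (m + 1) → ℝ) d).sum_mem (t := Finset.univ)
    (fun i _ ↦ t.2.1 i) t.2.2 (z := fun i ↦ (v i : Fin (m + 1) → ℝ)) (fun i _ ↦ h i)
  exact hb

/-- The distance of a vertex from the barycenter, bounded in terms of the diameter `d` with a
constant depending only on a bound `N` for the dimension. -/
theorem dist_barycenter_le {n m N : ℕ} (hn : n ≤ N)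
    (v : Fin (n + 1) → stdSimplex ℝ (Fin (m + 1))) (i : Fin (n + 1)) {d : ℝ}
    (h : ∀ i j, dist (v i) (v j) ≤ d) :
    dist (v i) (aff v stdSimplex.barycenter) ≤ (N : ℝ) / (N + 1) * d := by
  have hd : 0 ≤ d := dist_nonneg.trans (h i i)
  rw [Subtype.dist_eq, dist_comm, dist_eq_norm]
  have : (aff v stdSimplex.barycenter).val - (v i).val =
      ((n : ℝ) + 1)⁻¹ • ∑ l, ((v l).val - (v i).val) := by
    change ∑ l, (stdSimplex.barycenter : stdSimplex ℝ (Fin (n + 1))).val l • (v l).val - _ = _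
    simp only [stdSimplex.barycenter_apply, Fintype.card_fin, Finset.sum_sub_distrib,
      Finset.sum_const, Finset.card_univ, smul_sub, Finset.smul_sum]
    congr 1
    · simp
    · rw [← Nat.cast_smul_eq_nsmul ℝ, smul_smul]
      push_cast
      rw [inv_mul_cancel₀ (by positivity), one_smul]
  rw [this, norm_smul, norm_inv, Real.norm_of_nonneg (by positivity)]
  have hsum : ‖∑ l, ((v l).val - (v i).val)‖ ≤ n * d := by
    refine (norm_sum_le _ _).trans ?_
    rw [← Finset.add_sum_erase _ _ (Finset.mem_univ i), sub_self, norm_zero, zero_add]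
    refine (Finset.sum_le_card_nsmul _ _ d fun l _ ↦ ?_).trans ?_
    · rw [← dist_eq_norm]
      exact h l i
    · simp
  calc ((n : ℝ) + 1)⁻¹ * _ ≤ ((n : ℝ) + 1)⁻¹ * (n * d) := by gcongr
    _ = (n : ℝ) / (n + 1) * d := by ring
    _ ≤ (N : ℝ) / (N + 1) * d := by
      refine mul_le_mul_of_nonneg_right ?_ hd
      have : (n : ℝ) ≤ N := by exact_mod_cast hn
      rw [div_le_div_iff₀ (by positivity) (by positivity)]
      nlinarith

/-- The tuples of at most `N + 1` points of a simplex with pairwise distances at most `d`. -/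
def fineTuples (m N : ℕ) (d : ℝ) : Set (Σ n : ℕ, tuples (Pt.{u} m) _⦋n⦌) :=
  {z | z.1 ≤ N ∧ ∀ i j : Fin (z.1 + 1), dist (show Pt.{u} m from z.2 i).down
    (show Pt.{u} m from z.2 j).down ≤ d}

variable {R : Type u} [Ring R]

/-- The subdivision of an affine simplex of diameter at most `d` consists of simplices in its
hull with diameter at most `N / (N + 1) * d`. -/
theorem tupleSubd_mem {m N n : ℕ} (hn : n ≤ N) (v : Fin (n + 1) → Pt.{u} m) {d : ℝ}
    (h : ∀ i j, dist (v i).down (v j).down ≤ d) :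
    tupleSubd R bary (chain R (tup v)) ∈ chainsOn R {z : Σ n : ℕ, tuples (Pt.{u} m) _⦋n⦌ |
      z ∈ fineTuples m N ((N : ℝ) / (N + 1) * d) ∧ z.1 = n ∧
      ∀ i : Fin (z.1 + 1), (show Pt.{u} m from z.2 i).down ∈ Set.range (affU v)} := by
  have hd : 0 ≤ d := dist_nonneg.trans (h 0 0)
  induction n with
  | zero =>
    rw [tupleSubd_chain_zero]
    refine chain_mem_chainsOn ⟨⟨hn, fun i j ↦ ?_⟩, rfl, fun i ↦ ?_⟩
    · obtain rfl : i = j := (Fin.fin_one_eq_zero i).trans (Fin.fin_one_eq_zero j).symm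
      rw [dist_self]
      positivity
    · exact ⟨_, aff_apply_vertex _ i⟩
  | succ n ih =>
    rw [tupleSubd_chain_succ, bd_chain_succ, map_sum, map_sum]
    refine Submodule.sum_mem _ fun l _ ↦ ?_
    rw [map_zsmul, map_zsmul]
    refine zsmul_mem ?_ _
    rw [tuples_δ]
    refine map_mem_of_mem_chainsOn _ ?_ (ih (by omega) (v ∘ l.succAbove) fun i j ↦ h _ _)
    rintro k z ⟨⟨-, hz⟩, hk, hr⟩
    obtain ⟨w, rfl⟩ := exists_tup_eq z
    obtain rfl : k = n := hk
    rw [tupleCone_chain]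
    have hr' : ∀ i, (w i).down ∈ Set.range (affU v) := fun i ↦ by
      obtain ⟨t, ht⟩ := hr i
      rw [← affU_comp_simplexMap] at ht
      exact ⟨_, ht⟩
    have hb : ∀ i, dist (w i).down (bary (k + 1) v).down ≤ (N : ℝ) / (N + 1) * d := fun i ↦ by
      obtain ⟨t, ht⟩ := hr' i
      rw [← ht]
      exact dist_aff_le _ _ _ fun j ↦ dist_barycenter_le hn (fun i ↦ (v i).down) j h
    refine chain_mem_chainsOn ⟨⟨hn, fun i j ↦ ?_⟩, rfl, fun i ↦ ?_⟩
    · change dist ((Fin.cons (bary (k + 1) v) w : Fin (k + 2) → Pt.{u} m) i).down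
        ((Fin.cons (bary (k + 1) v) w : Fin (k + 2) → Pt.{u} m) j).down ≤ _
      refine Fin.cases ?_ (fun i ↦ ?_) i <;> refine Fin.cases ?_ (fun j ↦ ?_) j
      · rw [dist_self]
        positivity
      · rw [dist_comm]
        exact hb j
      · exact hb i
      · exact hz i j
    · change ((Fin.cons (bary (k + 1) v) w : Fin (k + 2) → Pt.{u} m) i).down ∈ _
      refine Fin.cases ?_ (fun i ↦ ?_) i
      · exact ⟨_, rfl⟩
      · exact hr' i

theorem tupleSubd_mem_fineTuples {m N : ℕ} {d : ℝ} {c : Tot R (tuples (Pt.{u} m))}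
    (hc : c ∈ chainsOn R (fineTuples m N d)) :
    tupleSubd R bary c ∈ chainsOn R (fineTuples m N ((N : ℝ) / (N + 1) * d)) := by
  refine map_mem_of_mem_chainsOn _ (fun n z hz ↦ ?_) hc
  exact chainsOn_mono (fun _ h ↦ h.1) (tupleSubd_mem hz.1 z hz.2)

theorem iterate_tupleSubd_mem (N k : ℕ) :
    (tupleSubd R bary)^[k] (chain R (tup (verts.{u} N))) ∈
      chainsOn R (fineTuples N N (((N : ℝ) / (N + 1)) ^ k)) := by
  induction k with
  | zero =>
    refine chain_mem_chainsOn ⟨le_rfl, fun i j ↦ ?_⟩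
    rw [pow_zero]
    exact (Metric.dist_le_diam_of_mem (bounded_stdSimplex (Fin (N + 1)))
      (verts.{u} N i).down.2 (verts.{u} N j).down.2).trans diam_stdSimplex_le
  | succ k ih =>
    rw [Function.iterate_succ_apply', pow_succ']
    exact tupleSubd_mem_fineTuples ih

variable {X : Type u} [TopologicalSpace X]

/-- A sufficiently fine subdivision of a singular simplex is small for a given open cover, by the
Lebesgue number lemma in the standard simplex. -/
theorem exists_iterate_singSubd_mem {U V O₁ O₂ : Set X} (h₁ : IsOpen O₁) (h₂ : IsOpen O₂)
    (hU : (U ∪ V) ∩ O₁ ⊆ U) (hV : (U ∪ V) ∩ O₂ ⊆ V) (hO : U ∪ V ⊆ O₁ ∪ O₂) {N : ℕ}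
    (z : Sing X _⦋N⦌) (hz : ⟨N, z⟩ ∈ simplicesIn (U ∪ V)) :
    ∃ k, (singSubd X R)^[k] (chain R z) ∈
      chainsOn R (simplicesIn U) ⊔ chainsOn R (simplicesIn V) := by
  obtain ⟨δ, hδ, hball⟩ := lebesgue_number_lemma_of_metric
    (isCompact_univ (X := stdSimplex ℝ (Fin (N + 1))))
    (c := fun b : Bool ↦ sMap z ⁻¹' (if b then O₁ else O₂))
    (by rintro (_ | _) <;> simp [h₁.preimage, h₂.preimage, ContinuousMap.continuous])
    (fun t _ ↦ by
      rcases hO (hz t) with h | h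
      · exact Set.mem_iUnion.2 ⟨true, by simpa using h⟩
      · exact Set.mem_iUnion.2 ⟨false, by simpa using h⟩)
  obtain ⟨k, hk⟩ := exists_pow_lt_of_lt_one hδ
    (show (N : ℝ) / (N + 1) < 1 by rw [div_lt_one (by positivity)]; linarith)
  refine ⟨k, ?_⟩
  rw [chain_eq_totMap_affSimplices, ← totMap_affSimplices_iterate, ← chainsOn_union]
  refine totMap_mem_chainsOn _ ?_ (iterate_tupleSubd_mem N k)
  rintro n w ⟨-, hw⟩
  obtain ⟨w, rfl⟩ := exists_tup_eq w
  obtain ⟨b, hb⟩ := hball (w 0).down trivial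
  have key : ∀ t, affU w t ∈ Metric.ball (w 0).down δ := fun t ↦
    (dist_aff_le _ t _ fun i ↦ hw i 0).trans_lt hk
  rw [affSimplices_tup]
  cases b with
  | true =>
    refine Or.inl fun t ↦ ?_
    rw [sMap_sMk]
    exact hU ⟨hz _, by simpa using hb (key t)⟩
  | false =>
    refine Or.inr fun t ↦ ?_
    rw [sMap_sMk]
    exact hV ⟨hz _, by simpa using hb (key t)⟩

/-- The theorem of small simplices, for a cover by two relatively open sets. The hypotheses say
that `U` and `V` contain the traces on `U ∪ V` of two open sets which cover `U ∪ V`. -/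
theorem relAcyclic_of_isOpen {U V O₁ O₂ : Set X} (h₁ : IsOpen O₁) (h₂ : IsOpen O₂)
    (hU : (U ∪ V) ∩ O₁ ⊆ U) (hV : (U ∪ V) ∩ O₂ ⊆ V) (hO : U ∪ V ⊆ O₁ ∪ O₂) :
    RelAcyclic (bd R (Sing X)) (chainsOn R (simplicesIn (U ∪ V)))
      (chainsOn R (simplicesIn U) ⊔ chainsOn R (simplicesIn V)) := by
  set P := chainsOn R (simplicesIn U) ⊔ chainsOn R (simplicesIn V) with hP
  -- all simplices of a chain become small after a common number of subdivisions
  have fine : ∀ c ∈ chainsOn R (simplicesIn (U ∪ V)), ∃ k, (singSubd X R)^[k] c ∈ P := by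
    intro c hc
    rw [chainsOn, Finsupp.supported_eq_span_single] at hc
    have iter (k : ℕ) (c : Tot R (Sing X)) : (singSubd X R)^[k] c = (singSubd X R ^ k) c :=
      (Module.End.pow_apply _ _ _).symm
    induction hc using Submodule.span_induction with
    | mem c hc =>
      obtain ⟨⟨n, z⟩, hz, rfl⟩ := hc
      exact exists_iterate_singSubd_mem h₁ h₂ hU hV hO z hz
    | zero => exact ⟨0, P.zero_mem⟩
    | add c c' _ _ h h' =>
      obtain ⟨k, hk⟩ := h
      obtain ⟨k', hk'⟩ := h'
      refine ⟨k + k', ?_⟩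
      rw [iter, map_add, ← iter, ← iter]
      refine P.add_mem ?_ ?_
      · rw [add_comm, Function.iterate_add_apply]
        exact singSubd_iterate_mem_sup hk k'
      · rw [Function.iterate_add_apply]
        exact singSubd_iterate_mem_sup hk' k
    | smul r c _ h =>
      obtain ⟨k, hk⟩ := h
      refine ⟨k, ?_⟩
      rw [iter, map_smul, ← iter]
      exact P.smul_mem r hk
  -- subdividing changes a chain by a boundary, modulo small chains
  have step : ∀ (k : ℕ) (c : Tot R (Sing X)), c ∈ chainsOn R (simplicesIn (U ∪ V)) →
      bd R _ c ∈ P → (singSubd X R)^[k] c ∈ P →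
      ∃ b ∈ chainsOn R (simplicesIn (U ∪ V)), c - bd R _ b ∈ P := by
    intro k
    induction k with
    | zero => exact fun c _ _ h ↦ ⟨0, Submodule.zero_mem _, by simpa using h⟩
    | succ k ih =>
      intro c hc hdc hk
      have hS : singSubd X R c ∈ chainsOn R (simplicesIn (U ∪ V)) := by
        rw [singSubd_apply]
        exact Submodule.sub_mem _ (Submodule.sub_mem _ hc
          (bd_mem_simplicesIn (singHomotopy_mem_simplicesIn hc)))
          (singHomotopy_mem_simplicesIn (bd_mem_simplicesIn hc))
      obtain ⟨b, hb, h⟩ := ih (singSubd X R c) hS (by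
        rw [singSubd_apply, map_sub, map_sub, bd_bd, sub_zero]
        exact P.sub_mem hdc (bd_mem_sup (singHomotopy_mem_sup hdc))) hk
      refine ⟨b + singHomotopy X R c,
        Submodule.add_mem _ hb (singHomotopy_mem_simplicesIn hc), ?_⟩
      have := P.add_mem h (singHomotopy_mem_sup hdc)
      rw [singSubd_apply] at this
      convert this using 1
      rw [map_add]
      abel
  intro c hc hdc
  obtain ⟨k, hk⟩ := fine c hc
  exact step k c hc hdc hk

end Mesh

end Conley

/-! ### Finite spaces: flags of points -/

namespace Conley

open Simplicial

section Flags

theorem simplexMap_apply_of_injective {n m : ℕ} {θ : Fin (n + 1) → Fin (m + 1)}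
    (hθ : Function.Injective θ) (t : stdSimplex ℝ (Fin (n + 1))) (i : Fin (n + 1)) :
    simplexMap θ t (θ i) = t i := by
  change (stdSimplex.map θ t) (θ i) = _
  rw [stdSimplex.map_coe, FunOnFinite.linearMap_apply_apply]
  rw [Finset.sum_eq_single i]
  · intro j hj hji
    exact absurd (hθ (by simpa using hj)) hji
  · simp

theorem simplexMap_apply_of_notMem {n m : ℕ} {θ : Fin (n + 1) → Fin (m + 1)}
    (t : stdSimplex ℝ (Fin (n + 1))) (j : Fin (m + 1)) (hj : ∀ i, θ i ≠ j) :
    simplexMap θ t j = 0 := by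
  change (stdSimplex.map θ t) j = _
  rw [stdSimplex.map_coe, FunOnFinite.linearMap_apply_apply]
  refine Finset.sum_eq_zero fun i hi ↦ ?_
  exact absurd (by simpa using hi) (hj i)

/-- The last vertex with a nonzero coordinate at `t` is `i`. -/
def IsTop {n : ℕ} (t : stdSimplex ℝ (Fin (n + 1))) (i : Fin (n + 1)) : Prop :=
  t i ≠ 0 ∧ ∀ j, i < j → t j = 0

theorem exists_isTop {n : ℕ} (t : stdSimplex ℝ (Fin (n + 1))) : ∃ i, IsTop t i := by
  have hne : (Finset.univ.filter fun i ↦ t i ≠ 0).Nonempty := by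
    by_contra h
    rw [Finset.not_nonempty_iff_eq_empty, Finset.filter_eq_empty_iff] at h
    have h' : ∀ i, t.val i = 0 := fun i ↦ not_not.1 (h (Finset.mem_univ i))
    have := t.2.2
    rw [Finset.sum_eq_zero fun i _ ↦ h' i] at this
    exact zero_ne_one this
  refine ⟨Finset.max' _ hne, ?_, fun j hj ↦ ?_⟩
  · simpa using Finset.max'_mem _ hne
  · by_contra h
    exact absurd (Finset.le_max' _ j (by simpa using h)) (not_le.2 hj)

theorem isTop_vertex {n : ℕ} (i : Fin (n + 1)) : IsTop (stdSimplex.vertex (S := ℝ) i) i := by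
  refine ⟨by simp [stdSimplex.vertex_coe], fun j hj ↦ ?_⟩
  simp [stdSimplex.vertex_coe, hj.ne']

theorem IsTop.simplexMap {n m : ℕ} {θ : Fin (n + 1) → Fin (m + 1)} (hθ : StrictMono θ)
    {t : stdSimplex ℝ (Fin (n + 1))} {i : Fin (n + 1)} (h : IsTop t i) :
    IsTop (simplexMap θ t) (θ i) := by
  refine ⟨by rw [simplexMap_apply_of_injective hθ.injective]; exact h.1, fun j hj ↦ ?_⟩
  by_cases hk : ∃ k, θ k = j
  · obtain ⟨k, rfl⟩ := hk
    rw [simplexMap_apply_of_injective hθ.injective]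
    exact h.2 k (hθ.lt_iff_lt.1 hj)
  · exact simplexMap_apply_of_notMem t j (not_exists.1 hk)

/-- A point with last vertex `i ≤ j` is a limit of points with last vertex `j`, along a segment. -/
theorem mem_closure_setOf_isTop {n : ℕ} {t s : stdSimplex ℝ (Fin (n + 1))} {i j : Fin (n + 1)}
    (ht : IsTop t i) (hs : IsTop s j) (hij : i ≤ j) : t ∈ closure {r | IsTop r j} := by
  rw [closure_subtype]
  have h : openSegment ℝ t.val s.val ⊆ Subtype.val '' {r | IsTop (n := n) r j} := by
    intro r hr
    refine ⟨⟨r, (convex_stdSimplex ℝ _).openSegment_subset t.2 s.2 hr⟩, ?_, rfl⟩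
    obtain ⟨a, b, ha, hb, -, rfl⟩ := hr
    refine ⟨?_, fun k hk ↦ ?_⟩
    · change a * t j + b * s j ≠ 0
      have h1 : 0 ≤ t j := t.2.1 j
      have h2 : 0 < s j := lt_of_le_of_ne (s.2.1 j) hs.1.symm
      positivity
    · change a * t k + b * s k = 0
      rw [ht.2 k (hij.trans_lt hk), hs.2 k hk]
      simp
  refine closure_mono h ?_
  rw [closure_openSegment]
  exact left_mem_segment ℝ _ _

variable (X : Type u) [TopologicalSpace X]

/-- The singular simplices constant on the sets of points of the standard simplex with a given
last vertex; in a finite space they correspond to chains of points in the specialization order. -/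
def flags : Set (Σ n : ℕ, Sing X _⦋n⦌) :=
  {z | ∀ t s i, IsTop t i → IsTop s i → sMap z.2 t = sMap z.2 s}

variable {X}

/-- The values of a flag decrease along the vertices, in the sense that those at later vertices
specialize to those at earlier vertices. -/
theorem specializes_of_mem_flags {n : ℕ} {z : Sing X _⦋n⦌} (hz : ⟨n, z⟩ ∈ flags X)
    {t s : stdSimplex ℝ (Fin (n + 1))} {i j : Fin (n + 1)}
    (ht : IsTop t i) (hs : IsTop s j) (hij : i ≤ j) : sMap z s ⤳ sMap z t := by
  rw [specializes_iff_mem_closure]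
  refine closure_mono ?_ (map_mem_closure (sMap z).continuous
    (mem_closure_setOf_isTop ht hs hij) (Set.mapsTo_image (sMap z) _))
  rintro _ ⟨r, hr, rfl⟩
  exact hz r s j hr hs

theorem δ_mem_flags {n : ℕ} (z : Sing X _⦋n + 1⦌) (h : ⟨n + 1, z⟩ ∈ flags X) (i : Fin (n + 2)) :
    (⟨n, (Sing X).δ i z⟩ : Σ n : ℕ, Sing X _⦋n⦌) ∈ flags X := by
  intro t s j ht hs
  obtain ⟨σ, rfl⟩ : ∃ σ, sMk σ = z := ⟨sMap z, sMk_sMap z⟩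
  rw [sing_δ_sMk, sMap_sMk]
  simpa using h _ _ _ (ht.simplexMap (Fin.strictMono_succAbove i))
    (hs.simplexMap (Fin.strictMono_succAbove i))

end Flags

section Cone

variable {X : Type u} [TopologicalSpace X]

/-- The projection of a point of a standard simplex to the face opposite to the vertex `0`,
from that vertex, at which the value is arbitrary. -/
noncomputable def tail {n : ℕ} (t : stdSimplex ℝ (Fin (n + 2))) : stdSimplex ℝ (Fin (n + 1)) :=
  open Classical in
  if h : t 0 = 1 then stdSimplex.vertex 0 else ⟨fun i ↦ t i.succ / (1 - t 0), fun i ↦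
    div_nonneg (t.2.1 _) (sub_nonneg.2 (stdSimplex.le_one t 0)), by
      rw [← Finset.sum_div, div_eq_one_iff_eq (sub_ne_zero.2 (Ne.symm h)), eq_sub_iff_add_eq',
        ← Fin.sum_univ_succ (fun i ↦ t i)]
      exact t.2.2⟩

theorem tail_apply {n : ℕ} {t : stdSimplex ℝ (Fin (n + 2))} (h : t 0 ≠ 1) (i : Fin (n + 1)) :
    tail t i = t i.succ / (1 - t 0) := by
  rw [tail, dif_neg h]
  rfl

theorem continuousOn_tail (n : ℕ) :
    ContinuousOn (tail (n := n)) {t | t 0 ≠ 1} := by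
  rw [Topology.IsInducing.subtypeVal.continuousOn_iff]
  have : ContinuousOn (fun (t : stdSimplex ℝ (Fin (n + 2))) (i : Fin (n + 1)) ↦
      t i.succ / (1 - t 0)) {t | t 0 ≠ 1} := by
    have hc : ∀ i, Continuous fun t : stdSimplex ℝ (Fin (n + 2)) ↦ t i := fun i ↦
      (continuous_apply i).comp continuous_subtype_val
    refine continuousOn_pi.2 fun i ↦ (hc _).continuousOn.div
      (continuous_const.sub (hc 0)).continuousOn fun t ht ↦ sub_ne_zero.2 (Ne.symm ht)
  exact this.congr fun t ht ↦ funext fun i ↦ tail_apply ht i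

theorem apply_zero_ne_one_of_isTop {n : ℕ} {t : stdSimplex ℝ (Fin (n + 2))} {i : Fin (n + 1)}
    (h : IsTop t i.succ) : t 0 ≠ 1 := by
  intro h0
  have h1 : 0 < t i.succ := lt_of_le_of_ne (t.2.1 _) h.1.symm
  have h2 := t.2.2
  rw [Fin.sum_univ_succ] at h2
  have h3 := Finset.single_le_sum (f := fun j : Fin (n + 1) ↦ t.val j.succ)
    (fun j _ ↦ t.2.1 _) (Finset.mem_univ i)
  have h4 : t.val 0 = 1 := h0
  have h5 : 0 < t.val i.succ := h1
  linarith

theorem apply_zero_of_isTop {n : ℕ} {t : stdSimplex ℝ (Fin (n + 2))} (h : IsTop t 0) :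
    t 0 = 1 := by
  have hz : ∀ i : Fin (n + 1), t.val i.succ = 0 := fun i ↦ h.2 _ (Fin.succ_pos i)
  have h2 := t.2.2
  rw [Fin.sum_univ_succ, Finset.sum_eq_zero fun i _ ↦ hz i, add_zero] at h2
  exact h2

theorem IsTop.tail {n : ℕ} {t : stdSimplex ℝ (Fin (n + 2))} {i : Fin (n + 1)}
    (h : IsTop t i.succ) : IsTop (tail t) i := by
  have h0 := apply_zero_ne_one_of_isTop h
  refine ⟨?_, fun j hj ↦ ?_⟩
  · rw [tail_apply h0]
    exact div_ne_zero h.1 (sub_ne_zero.2 h0.symm)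
  · rw [tail_apply h0, h.2 _ (Fin.succ_lt_succ_iff.2 hj), zero_div]

/-- The cone with apex `x` over a singular simplex, with the apex as first vertex. -/
noncomputable def coneFun {n : ℕ} (x : X) (σ : C(stdSimplex ℝ (Fin (n + 1)), X))
    (t : stdSimplex ℝ (Fin (n + 2))) : X :=
  open Classical in if t 0 = 1 then x else σ (tail t)

/-- The cone is continuous when the apex is a specialization of all points of the simplex. -/
theorem continuous_coneFun {n : ℕ} {x : X} {σ : C(stdSimplex ℝ (Fin (n + 1)), X)}
    (h : ∀ t, σ t ⤳ x) : Continuous (coneFun x σ) := by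
  refine continuous_def.2 fun O hO ↦ ?_
  by_cases hx : x ∈ O
  · have : coneFun x σ ⁻¹' O = Set.univ := by
      refine Set.eq_univ_of_forall fun t ↦ ?_
      by_cases ht : t 0 = 1
      · simpa [coneFun, ht] using hx
      · simpa [coneFun, ht] using (h _).mem_open hO hx
    rw [this]
    exact isOpen_univ
  · have : coneFun x σ ⁻¹' O = {t | t 0 ≠ 1} ∩ (fun t ↦ σ (tail t)) ⁻¹' O := by
      ext t
      by_cases ht : t 0 = 1
      · simp [coneFun, ht, hx]
      · simp [coneFun, ht]
    rw [this]
    exact (σ.continuous.comp_continuousOn (continuousOn_tail n)).isOpen_inter_preimage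
      (isOpen_ne_fun ((continuous_apply 0).comp continuous_subtype_val) continuous_const) hO

/-- The cone operator with apex `x` on singular simplices, with the value a constant simplex
where the cone is not continuous. -/
noncomputable def coneSimplex (x : X) (n : ℕ) (z : Sing X _⦋n⦌) : Sing X _⦋n + 1⦌ :=
  open Classical in
  if h : Continuous (coneFun x (sMap z)) then sMk ⟨coneFun x (sMap z), h⟩
  else sMk (ContinuousMap.const _ x)

theorem sMap_coneSimplex {x : X} {n : ℕ} {z : Sing X _⦋n⦌} (h : ∀ t, sMap z t ⤳ x)
    (t : stdSimplex ℝ (Fin (n + 2))) : sMap (coneSimplex x n z) t = coneFun x (sMap z) t := by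
  rw [coneSimplex, dif_pos (continuous_coneFun h), sMap_sMk]
  rfl

theorem sing_ext {n : ℕ} {z w : Sing X _⦋n⦌} (h : ∀ t, sMap z t = sMap w t) : z = w := by
  rw [← sMk_sMap z, ← sMk_sMap w, ContinuousMap.ext h]

theorem sMap_δ {n : ℕ} (z : Sing X _⦋n + 1⦌) (i : Fin (n + 2))
    (t : stdSimplex ℝ (Fin (n + 1))) :
    sMap ((Sing X).δ i z) t = sMap z (simplexMap i.succAbove t) := by
  obtain ⟨σ, rfl⟩ : ∃ σ, sMk σ = z := ⟨sMap z, sMk_sMap z⟩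
  rw [sing_δ_sMk, sMap_sMk, sMap_sMk]
  rfl

theorem tail_simplexMap_succ {n : ℕ} (t : stdSimplex ℝ (Fin (n + 1))) :
    simplexMap (Fin.succAbove 0) t 0 = 0 ∧ tail (simplexMap (Fin.succAbove 0) t) = t := by
  have h0 : simplexMap (Fin.succAbove 0) t 0 = 0 :=
    simplexMap_apply_of_notMem _ _ fun i ↦ by simp
  refine ⟨h0, ?_⟩
  ext i
  rw [tail_apply (by rw [h0]; exact zero_ne_one), h0, sub_zero, div_one]
  exact simplexMap_apply_of_injective Fin.succAbove_right_injective t i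

theorem simplexMap_succ_succAbove_zero {n : ℕ} (i : Fin (n + 2))
    (t : stdSimplex ℝ (Fin (n + 2))) : simplexMap i.succ.succAbove t 0 = t 0 := by
  have := simplexMap_apply_of_injective (θ := i.succ.succAbove)
    Fin.succAbove_right_injective t 0
  rwa [Fin.succAbove_ne_zero_zero (Fin.succ_ne_zero i)] at this

theorem tail_simplexMap_succ_succAbove {n : ℕ} (i : Fin (n + 2))
    {t : stdSimplex ℝ (Fin (n + 2))} (ht : t 0 ≠ 1) :
    tail (simplexMap i.succ.succAbove t) = simplexMap i.succAbove (tail t) := by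
  ext j
  rw [tail_apply (by rwa [simplexMap_succ_succAbove_zero]), simplexMap_succ_succAbove_zero]
  rcases Fin.eq_self_or_eq_succAbove i j with rfl | ⟨l, rfl⟩
  · rw [simplexMap_apply_of_notMem (θ := j.succAbove) _ _ fun k ↦ Fin.succAbove_ne j k,
      simplexMap_apply_of_notMem _ _ fun k ↦ Fin.succAbove_ne j.succ k, zero_div]
  · rw [simplexMap_apply_of_injective Fin.succAbove_right_injective, tail_apply ht,
      ← Fin.succ_succAbove_succ,
      simplexMap_apply_of_injective Fin.succAbove_right_injective]

theorem coneSimplex_mem_flags {x : X} {n : ℕ} {z : Sing X _⦋n⦌} (h : ∀ t, sMap z t ⤳ x)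
    (hz : ⟨n, z⟩ ∈ flags X) :
    (⟨n + 1, coneSimplex x n z⟩ : Σ n : ℕ, Sing X _⦋n⦌) ∈ flags X := by
  intro t s i ht hs
  change sMap (coneSimplex x n z) t = sMap (coneSimplex x n z) s
  rw [sMap_coneSimplex h, sMap_coneSimplex h]
  induction i using Fin.cases with
  | zero => rw [coneFun, coneFun, if_pos (apply_zero_of_isTop ht), if_pos (apply_zero_of_isTop hs)]
  | succ i =>
    rw [coneFun, coneFun, if_neg (apply_zero_ne_one_of_isTop ht),
      if_neg (apply_zero_ne_one_of_isTop hs)]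
    exact hz _ _ i ht.tail hs.tail

variable {R : Type u} [Ring R]

/-- A set with a point `x` in the closure of all its points is contractible, compatibly with the
flags. -/
theorem relAcyclic_flags_of_specializes {A : Set X} {x : X} (hx : x ∈ A) (hA : ∀ y ∈ A, y ⤳ x) :
    RelAcyclic (bd R (Sing X)) (chainsOn R (simplicesIn A))
      (chainsOn R (simplicesIn A ∩ flags X)) := by
  have hcone : ∀ (n : ℕ) (z : Sing X _⦋n⦌), ⟨n, z⟩ ∈ simplicesIn A →
      (⟨n + 1, coneSimplex x n z⟩ : Σ n : ℕ, Sing X _⦋n⦌) ∈ simplicesIn A := by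
    intro n z hz t
    change sMap (coneSimplex x n z) t ∈ A
    rw [sMap_coneSimplex fun t ↦ hA _ (hz t), coneFun]
    split_ifs
    · exact hx
    · exact hz _
  have hraise : ∀ c ∈ chainsOn R (simplicesIn A),
      raise R (coneSimplex x) c ∈ chainsOn R (simplicesIn A) := by
    intro c hc
    refine map_mem_of_mem_chainsOn _ (fun n z hz ↦ ?_) hc
    rw [raise_chain]
    exact chain_mem_chainsOn (hcone n z hz)
  intro c hc hdc
  refine ⟨raise R (coneSimplex x) c, hraise c hc, ?_⟩
  rw [bd_raise_chain (s := simplicesIn A) _ (sMk (ContinuousMap.const _ x)) ?_ ?_ ?_ hc]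
  · rw [sub_sub, sub_sub_cancel]
    refine Submodule.add_mem _ ?_ (Submodule.smul_mem _ _ (chain_mem_chainsOn ⟨fun t ↦ ?_,
      fun t s i _ _ ↦ ?_⟩))
    · refine map_mem_of_mem_chainsOn _ (fun n z hz ↦ ?_) hdc
      rw [raise_chain]
      exact chain_mem_chainsOn ⟨hcone n z hz.1,
        coneSimplex_mem_flags (fun t ↦ hA _ (hz.1 t)) hz.2⟩
    · rw [sMap_sMk]
      exact hx
    · rw [sMap_sMk]
      rfl
  · intro n z hz
    refine sing_ext fun t ↦ ?_
    rw [sMap_δ, sMap_coneSimplex fun t ↦ hA _ (hz t), coneFun, if_neg, (tail_simplexMap_succ t).2]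
    rw [(tail_simplexMap_succ t).1]
    exact zero_ne_one
  · intro z hz
    refine sing_ext fun t ↦ ?_
    rw [sMap_δ, sMap_coneSimplex fun t ↦ hA _ (hz t), coneFun, if_pos, sMap_sMk]
    · rfl
    · have := simplexMap_apply_of_injective (θ := Fin.succAbove (1 : Fin 2))
        Fin.succAbove_right_injective t 0
      refine this.trans ?_
      simp
  · intro n z hz i
    refine sing_ext fun t ↦ ?_
    rw [sMap_δ, sMap_coneSimplex fun t ↦ hA _ (hz t),
      sMap_coneSimplex fun t ↦ hA _ (δ_mem_simplicesIn z hz i t), coneFun, coneFun,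
      simplexMap_succ_succAbove_zero]
    by_cases ht : t 0 = 1
    · rw [if_pos ht, if_pos ht]
    · rw [if_neg ht, if_neg ht, sMap_δ, tail_simplexMap_succ_succAbove i ht]

end Cone

section FiniteSpaces

variable {X : Type u} [TopologicalSpace X] {R : Type u} [Ring R]

theorem bd_mem_flags {A : Set X} {c : Tot R (Sing X)}
    (hc : c ∈ chainsOn R (simplicesIn A ∩ flags X)) :
    bd R _ c ∈ chainsOn R (simplicesIn A ∩ flags X) :=
  bd_mem_chainsOn (s := simplicesIn A ∩ flags X)
    (fun _ z hz i ↦ ⟨δ_mem_simplicesIn z hz.1 i, δ_mem_flags z hz.2 i⟩) hc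

/-- The Mayer–Vietoris principle for flags, when all flags in `U ∪ V` lie in `U` or in `V`. -/
theorem RelAcyclic.flags_sup {U V : Set X}
    (hflags : simplicesIn (U ∪ V) ∩ flags X ⊆ simplicesIn U ∪ simplicesIn V)
    (hU : RelAcyclic (bd R (Sing X)) (chainsOn R (simplicesIn U))
      (chainsOn R (simplicesIn U ∩ flags X)))
    (hV : RelAcyclic (bd R (Sing X)) (chainsOn R (simplicesIn V))
      (chainsOn R (simplicesIn V ∩ flags X)))
    (hUV : RelAcyclic (bd R (Sing X)) (chainsOn R (simplicesIn (U ∩ V)))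
      (chainsOn R (simplicesIn (U ∩ V) ∩ flags X))) :
    RelAcyclic (bd R (Sing X)) (chainsOn R (simplicesIn U) ⊔ chainsOn R (simplicesIn V))
      (chainsOn R (simplicesIn (U ∪ V) ∩ flags X)) := by
  have h : simplicesIn (U ∪ V) ∩ flags X =
      (simplicesIn U ∩ flags X) ∪ (simplicesIn V ∩ flags X) := by
    rw [← Set.union_inter_distrib_right]
    refine Set.Subset.antisymm (Set.subset_inter hflags Set.inter_subset_right)
      (Set.inter_subset_inter_left _ (Set.union_subset (simplicesIn_mono Set.subset_union_left)
        (simplicesIn_mono Set.subset_union_right)))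
  rw [h, chainsOn_union]
  rw [simplicesIn_inter, Set.inter_inter_distrib_right, chainsOn_inter, chainsOn_inter] at hUV
  exact RelAcyclic.sup bd_bd (fun _ ↦ bd_mem_flags) (fun _ ↦ bd_mem_flags)
    (fun _ ↦ bd_mem_simplicesIn) (fun _ ↦ bd_mem_simplicesIn)
    (chainsOn_mono Set.inter_subset_left) (chainsOn_mono Set.inter_subset_left) hU hV hUV

theorem chainsOn_flags_le_sup {U V : Set X}
    (hflags : simplicesIn (U ∪ V) ∩ flags X ⊆ simplicesIn U ∪ simplicesIn V) :
    chainsOn R (simplicesIn (U ∪ V) ∩ flags X) ≤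
      chainsOn R (simplicesIn U) ⊔ chainsOn R (simplicesIn V) := by
  rw [← chainsOn_union]
  exact chainsOn_mono hflags

theorem sup_le_chainsOn {U V : Set X} :
    chainsOn R (simplicesIn U) ⊔ chainsOn R (simplicesIn V) ≤
      chainsOn R (simplicesIn (U ∪ V)) :=
  sup_le (chainsOn_mono (simplicesIn_mono Set.subset_union_left))
    (chainsOn_mono (simplicesIn_mono Set.subset_union_right))

variable [Finite X] [T0Space X]

/-- A nonempty set in a finite `T₀` space has a point which is closed in it. -/
theorem exists_forall_specializes_eq {A : Set X} (hA : A.Nonempty) :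
    ∃ x ∈ A, ∀ y ∈ A, x ⤳ y → y = x := by
  let _ := specializationOrder X
  obtain ⟨x, hx⟩ := A.toFinite.exists_minimal hA
  exact ⟨x, hx.prop, fun y hy hxy ↦ le_antisymm hxy (hx.le_of_le hy hxy)⟩

/-- McCord's theorem, for homology: singular chains of a set in a finite `T₀` space can be
replaced by chains of flags. If a closed point `x` of `A` is not a specialization of all points
of `A`, then `A` is covered by two smaller relatively open sets, the smallest neighbourhood of `x`
and the complement of `x`, and a flag lies in one of them, according to its first vertex. -/
theorem relAcyclic_flags (A : Set X) : RelAcyclic (bd R (Sing X)) (chainsOn R (simplicesIn A))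
    (chainsOn R (simplicesIn A ∩ flags X)) := by
  induction hn : A.ncard using Nat.strong_induction_on generalizing A with
  | _ n ih =>
  subst hn
  rcases A.eq_empty_or_nonempty with rfl | hne
  · have : simplicesIn (∅ : Set X) = ∅ :=
      Set.eq_empty_of_forall_notMem fun z hz ↦ hz (stdSimplex.vertex 0)
    intro c hc _
    rw [this, chainsOn, Finsupp.supported_empty, Submodule.mem_bot] at hc
    exact ⟨0, Submodule.zero_mem _, by rw [hc, map_zero, sub_zero]; exact Submodule.zero_mem _⟩
  obtain ⟨x, hxA, hx⟩ := exists_forall_specializes_eq hne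
  by_cases hA : ∀ y ∈ A, y ⤳ x
  · exact relAcyclic_flags_of_specializes hxA hA
  push Not at hA
  obtain ⟨w, hwA, hwx⟩ := hA
  set U := A ∩ nhdsKer {x} with hUdef
  set V := A ∩ (closure {x})ᶜ with hVdef
  have hmemU : ∀ y, y ∈ U ↔ y ∈ A ∧ y ⤳ x := fun y ↦ by
    rw [hUdef, Set.mem_inter_iff, mem_nhdsKer_singleton]
  have hmemV : ∀ y, y ∈ V ↔ y ∈ A ∧ y ≠ x := fun y ↦ by
    rw [hVdef, Set.mem_inter_iff, Set.mem_compl_iff, ← specializes_iff_mem_closure]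
    refine and_congr_right fun hy ↦ not_congr ⟨fun h ↦ hx y hy h, ?_⟩
    rintro rfl
    rfl
  have hUV : A = U ∪ V := by
    refine subset_antisymm (fun y hy ↦ ?_)
      (Set.union_subset Set.inter_subset_left Set.inter_subset_left)
    by_cases hyx : y = x
    · exact Or.inl ((hmemU y).2 ⟨hy, hyx ▸ specializes_rfl⟩)
    · exact Or.inr ((hmemV y).2 ⟨hy, hyx⟩)
  have hxV : x ∉ V := fun h ↦ ((hmemV x).1 h).2 rfl
  have hflags : simplicesIn (U ∪ V) ∩ flags X ⊆ simplicesIn U ∪ simplicesIn V := by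
    rintro ⟨n, z⟩ ⟨hz, hf⟩
    rw [← hUV] at hz
    have hs : ∀ t, sMap z t ⤳ sMap z (stdSimplex.vertex 0) := fun t ↦ by
      obtain ⟨i, hi⟩ := exists_isTop t
      exact specializes_of_mem_flags hf (isTop_vertex 0) hi (Fin.zero_le i)
    by_cases h0 : sMap z (stdSimplex.vertex 0) ⤳ x
    · exact Or.inl fun t ↦ (hmemU _).2 ⟨hz t, (hs t).trans h0⟩
    · refine Or.inr fun t ↦ (hmemV _).2 ⟨hz t, fun h ↦ h0 ?_⟩
      have h' := hs t
      change sMap z t = x at h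
      rw [h] at h'
      rw [hx _ (hz _) h']
  have cardU : U.ncard < A.ncard := Set.ncard_lt_ncard
    ⟨Set.inter_subset_left, fun h ↦ hwx ((hmemU w).1 (h hwA)).2⟩
  have cardV : V.ncard < A.ncard := Set.ncard_lt_ncard
    ⟨Set.inter_subset_left, fun h ↦ hxV (h hxA)⟩
  have cardUV : (U ∩ V).ncard < A.ncard :=
    (Set.ncard_le_ncard Set.inter_subset_left).trans_lt cardU
  rw [hUV]
  refine RelAcyclic.trans bd_bd (chainsOn_flags_le_sup hflags) sup_le_chainsOn
    (relAcyclic_of_isOpen (O₁ := nhdsKer {x}) (O₂ := (closure {x})ᶜ) isOpen_nhdsKer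
      isClosed_closure.isOpen_compl ?_ ?_ ?_)
    (RelAcyclic.flags_sup hflags (ih _ cardU U rfl) (ih _ cardV V rfl) (ih _ cardUV _ rfl))
  · rw [← hUV]
  · rw [← hUV]
  · exact Set.union_subset_union Set.inter_subset_right Set.inter_subset_right

/-- Excision for a cover by two relatively closed sets in a finite `T₀` space: a flag lies in the
closure of its value at the last vertex, hence in one of the two sets. -/
theorem relAcyclic_of_isClosed {A B C₁ C₂ : Set X} (h₁ : IsClosed C₁) (h₂ : IsClosed C₂)
    (hA : (A ∪ B) ∩ C₁ ⊆ A) (hB : (A ∪ B) ∩ C₂ ⊆ B) (hC : A ∪ B ⊆ C₁ ∪ C₂) :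
    RelAcyclic (bd R (Sing X)) (chainsOn R (simplicesIn (A ∪ B)))
      (chainsOn R (simplicesIn A) ⊔ chainsOn R (simplicesIn B)) := by
  have hflags : simplicesIn (A ∪ B) ∩ flags X ⊆ simplicesIn A ∪ simplicesIn B := by
    rintro ⟨n, z⟩ ⟨hz, hf⟩
    have hs : ∀ t, sMap z (stdSimplex.vertex (Fin.last n)) ⤳ sMap z t := fun t ↦ by
      obtain ⟨i, hi⟩ := exists_isTop t
      exact specializes_of_mem_flags hf hi (isTop_vertex _) (Fin.le_last i)
    rcases hC (hz (stdSimplex.vertex (Fin.last n))) with h | h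
    · exact Or.inl fun t ↦ hA ⟨hz t, (hs t).mem_closed h₁ h⟩
    · exact Or.inr fun t ↦ hB ⟨hz t, (hs t).mem_closed h₂ h⟩
  exact RelAcyclic.of_relAcyclic bd_bd (chainsOn_flags_le_sup hflags) sup_le_chainsOn
    (relAcyclic_flags _) (RelAcyclic.flags_sup hflags (relAcyclic_flags _) (relAcyclic_flags _)
      (relAcyclic_flags _))

end FiniteSpaces

end Conley

/-! ### Subspaces and homotopies of comparable maps -/

namespace Conley

open Simplicial

variable {X Y Z : Type u} [TopologicalSpace X] [TopologicalSpace Y] [TopologicalSpace Z]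
  {R : Type u} [Ring R]

variable (R) in
/-- The map on singular chains induced by a continuous map. -/
noncomputable def chainMap (f : C(X, Y)) : Tot R (Sing X) →ₗ[R] Tot R (Sing Y) :=
  totMap R (TopCat.toSSet.map (TopCat.ofHom f))

theorem chainMap_comp (g : C(Y, Z)) (f : C(X, Y)) (c : Tot R (Sing X)) :
    chainMap R (g.comp f) c = chainMap R g (chainMap R f c) := by
  rw [chainMap, TopCat.ofHom_comp, Functor.map_comp, totMap_comp]
  rfl

theorem chainMap_id (c : Tot R (Sing X)) : chainMap R (ContinuousMap.id X) c = c := by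
  rw [chainMap, TopCat.ofHom_id, CategoryTheory.Functor.map_id, totMap_id]

theorem sMap_toSSet_map (f : C(X, Y)) {n : ℕ} (z : Sing X _⦋n⦌) :
    sMap ((TopCat.toSSet.map (TopCat.ofHom f)).app _ z) = f.comp (sMap z) := rfl

theorem chainMap_bd (f : C(X, Y)) (c : Tot R (Sing X)) :
    chainMap R f (bd R _ c) = bd R _ (chainMap R f c) := totMap_bd _ c

theorem chainMap_mem_simplicesIn (f : C(X, Y)) {A : Set X} {B : Set Y} (h : Set.MapsTo f A B)
    {c : Tot R (Sing X)} (hc : c ∈ chainsOn R (simplicesIn A)) :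
    chainMap R f c ∈ chainsOn R (simplicesIn B) := by
  refine totMap_mem_chainsOn (s := simplicesIn A) (t := simplicesIn B) _ (fun n z hz t ↦ ?_) hc
  rw [sMap_toSSet_map]
  exact h (hz t)

/-- The inclusion of a subspace. -/
def subIncl (A : Set X) : C(A, X) := ⟨Subtype.val, continuous_subtype_val⟩

theorem chainMap_subIncl_injective (A : Set X) :
    Function.Injective (chainMap R (subIncl A)) := by
  have : Mono (TopCat.ofHom (subIncl A)) :=
    (TopCat.mono_iff_injective _).2 Subtype.val_injective
  exact totMap_injective _

theorem range_chainMap_subIncl (A : Set X) :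
    LinearMap.range (chainMap R (subIncl A)) = chainsOn R (simplicesIn A) := by
  apply le_antisymm
  · rintro _ ⟨c, rfl⟩
    refine chainMap_mem_simplicesIn (A := Set.univ) _ (fun a _ ↦ a.2) ?_
    rw [show simplicesIn (Set.univ : Set A) = Set.univ from
      Set.eq_univ_of_forall fun z t ↦ Set.mem_univ _, chainsOn, Finsupp.supported_univ]
    exact Submodule.mem_top
  · intro c hc
    refine map_mem_of_mem_chainsOn (s := simplicesIn A) LinearMap.id (fun n z hz ↦ ?_) hc
    let σ : C(stdSimplex ℝ (Fin (n + 1)), A) := ⟨fun t ↦ ⟨sMap z t, hz t⟩, by fun_prop⟩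
    refine ⟨chain R (sMk σ), ?_⟩
    rw [chainMap, totMap_chain, toSSet_map_sMk]
    exact congrArg (chain R) (sMk_sMap z)

/-- The restriction of a continuous map to subspaces. -/
def restrictMap (f : C(X, Y)) {A : Set X} {B : Set Y} (h : Set.MapsTo f A B) : C(A, B) :=
  ⟨h.restrict, f.continuous.restrict h⟩

/-- Quasi-isomorphisms between chains of subspaces, in terms of the singular chain complexes of
the subspaces. -/
theorem isQuasiIso_chainMap_iff (f : C(X, Y)) {A : Set X} {B : Set Y} (h : Set.MapsTo f A B) :
    IsQuasiIso (bd R (Sing X)) (bd R (Sing Y)) (chainMap R f) (chainsOn R (simplicesIn A))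
      (chainsOn R (simplicesIn B)) ↔
    QuasiIso ((singularChains R).map (TopCat.ofHom (restrictMap f h))) := by
  rw [← range_chainMap_subIncl, ← range_chainMap_subIncl]
  refine (isQuasiIso_range_iff (chainMap_subIncl_injective A) (chainMap_subIncl_injective B)
    (totMap_bd _) (totMap_bd _) (g := chainMap R (restrictMap f h)) fun c ↦ ?_).trans
    (isQuasiIso_totMap_iff _)
  rw [← chainMap_comp, ← chainMap_comp]
  rfl

/-- Comparable maps are homotopic: the homotopy is constant up to the end, where it jumps to
a specialization. -/
noncomputable def homotopyOfSpecializes (f g : C(X, Y)) (h : ∀ x, f x ⤳ g x) :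
    ContinuousMap.Homotopy f g where
  toFun p := open Classical in if p.1 = 1 then g p.2 else f p.2
  continuous_toFun := by
    rw [continuous_def]
    intro O hO
    have : (fun p : unitInterval × X ↦ open Classical in if p.1 = 1 then g p.2 else f p.2) ⁻¹' O =
        ({1}ᶜ ×ˢ (f ⁻¹' O)) ∪ Set.univ ×ˢ (g ⁻¹' O) := by
      ext ⟨t, x⟩
      have := fun hx ↦ (h x).mem_open hO hx
      by_cases ht : t = 1 <;> simp [ht]
      exact this
    rw [this]
    exact (isOpen_compl_singleton.prod (hO.preimage f.continuous)).union
      (isOpen_univ.prod (hO.preimage g.continuous))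
  map_zero_left x := by simp
  map_one_left x := by simp

/-- A map with an inverse up to comparability is a quasi-isomorphism. -/
theorem quasiIso_of_specializes (f : C(X, Y)) (g : C(Y, X)) (hgf : ∀ x, g (f x) ⤳ x)
    (hfg : ∀ y, f (g y) ⤳ y) : QuasiIso ((singularChains R).map (TopCat.ofHom f)) := by
  let e : HomotopyEquiv ((singularChains R).obj (TopCat.of X))
      ((singularChains R).obj (TopCat.of Y)) :=
    { hom := (singularChains R).map (TopCat.ofHom f)
      inv := (singularChains R).map (TopCat.ofHom g)
      homotopyHomInvId := by
        refine (Homotopy.ofEq ?_).trans ((TopCat.Homotopy.singularChainComplexFunctorObjMap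
          (f := TopCat.ofHom (g.comp f)) (g := TopCat.ofHom (ContinuousMap.id X))
          (homotopyOfSpecializes _ _ hgf) (ModuleCat.of R R)).trans (Homotopy.ofEq ?_))
        · rw [TopCat.ofHom_comp, Functor.map_comp]
        · exact CategoryTheory.Functor.map_id _ _
      homotopyInvHomId := by
        refine (Homotopy.ofEq ?_).trans ((TopCat.Homotopy.singularChainComplexFunctorObjMap
          (f := TopCat.ofHom (f.comp g)) (g := TopCat.ofHom (ContinuousMap.id Y))
          (homotopyOfSpecializes _ _ hfg) (ModuleCat.of R R)).trans (Homotopy.ofEq ?_))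
        · rw [TopCat.ofHom_comp, Functor.map_comp]
        · exact CategoryTheory.Functor.map_id _ _ }
  exact e.quasiIso_hom

/-! ### The projection of the graph -/

/-- The Mayer–Vietoris principle for a continuous map and covers with the excision property. -/
theorem IsQuasiIso.union {f : C(X, Y)} {A B : Set X} {A' B' : Set Y} (hfA : Set.MapsTo f A A')
    (hfB : Set.MapsTo f B B')
    (hA : IsQuasiIso (bd R (Sing X)) (bd R (Sing Y)) (chainMap R f)
      (chainsOn R (simplicesIn A)) (chainsOn R (simplicesIn A')))
    (hB : IsQuasiIso (bd R (Sing X)) (bd R (Sing Y)) (chainMap R f)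
      (chainsOn R (simplicesIn B)) (chainsOn R (simplicesIn B')))
    (hAB : IsQuasiIso (bd R (Sing X)) (bd R (Sing Y)) (chainMap R f)
      (chainsOn R (simplicesIn (A ∩ B))) (chainsOn R (simplicesIn (A' ∩ B'))))
    (h : RelAcyclic (bd R (Sing X)) (chainsOn R (simplicesIn (A ∪ B)))
      (chainsOn R (simplicesIn A) ⊔ chainsOn R (simplicesIn B)))
    (h' : RelAcyclic (bd R (Sing Y)) (chainsOn R (simplicesIn (A' ∪ B')))
      (chainsOn R (simplicesIn A') ⊔ chainsOn R (simplicesIn B'))) :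
    IsQuasiIso (bd R (Sing X)) (bd R (Sing Y)) (chainMap R f)
      (chainsOn R (simplicesIn (A ∪ B))) (chainsOn R (simplicesIn (A' ∪ B'))) := by
  rw [simplicesIn_inter, simplicesIn_inter, chainsOn_inter, chainsOn_inter] at hAB
  have hs := IsQuasiIso.sup (A := chainsOn R (simplicesIn A)) (B := chainsOn R (simplicesIn B))
    (A' := chainsOn R (simplicesIn A')) (B' := chainsOn R (simplicesIn B'))
    bd_bd bd_bd (chainMap_bd f) (fun _ ↦ bd_mem_simplicesIn) (fun _ ↦ bd_mem_simplicesIn)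
    (fun _ ↦ bd_mem_simplicesIn) (fun _ ↦ bd_mem_simplicesIn)
    (fun _ ↦ chainMap_mem_simplicesIn f hfA) (fun _ ↦ chainMap_mem_simplicesIn f hfB) hA hB hAB
  refine IsQuasiIso.extend bd_bd bd_bd (chainMap_bd f) ?_
    (fun _ ↦ chainMap_mem_simplicesIn f (hfA.union_union hfB)) sup_le_chainsOn sup_le_chainsOn
    hs h h'
  intro c hc
  obtain ⟨a, ha, b, hb, rfl⟩ := Submodule.mem_sup.1 hc
  rw [map_add]
  exact Submodule.add_mem_sup (chainMap_mem_simplicesIn f hfA ha)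
    (chainMap_mem_simplicesIn f hfB hb)

/-- The graph of `F` over `A`. -/
def graphOn (F : X → Set Y) (A : Set X) : Set (X × Y) := {q | q.1 ∈ A ∧ q.2 ∈ F q.1}

theorem mapsTo_fst_graphOn (F : X → Set Y) (A : Set X) :
    Set.MapsTo (ContinuousMap.fst : C(X × Y, X)) (graphOn F A) A := fun _ h ↦ h.1

/-- The values of a lower semicontinuous map with closed values decrease under specialization. -/
theorem subset_of_specializes {F : X → Set Y} (hF : LowerHemicontinuous F)
    (hF' : ∀ x, IsClosed (F x)) {x a : X} (h : x ⤳ a) : F a ⊆ F x := by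
  have := (lowerHemicontinuous_iff_frequently.1 hF) a (F x) (hF' x)
  refine this ?_
  rw [Filter.frequently_iff]
  intro U hU
  exact ⟨x, mem_of_mem_nhds (h hU), subset_rfl⟩

theorem quasiIso_of_isAcyclic (h : IsAcyclic R Y) :
    QuasiIso ((singularChains R).map
      (TopCat.ofHom (ContinuousMap.const Y PUnit.unit.{u + 1}))) := by
  rw [quasiIso_iff]
  intro n
  rw [quasiIsoAt_iff_isIso_homologyMap]
  exact h n

/-- The projection of the graph over the closure of a point `x`. The graph is homotopy equivalent to
the acyclic set `F x`, and the closure of `x` is contractible. -/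
theorem isQuasiIso_fst_closure {F : X → Set Y} (hF : LowerHemicontinuous F)
    (hF' : ∀ x, IsClosed (F x)) (hF_acyclic : ∀ x, IsAcyclic R (F x)) (x : X) :
    IsQuasiIso (bd R (Sing (X × Y))) (bd R (Sing X)) (chainMap R ContinuousMap.fst)
      (chainsOn R (simplicesIn (graphOn F (closure {x}))))
      (chainsOn R (simplicesIn (closure {x}))) := by
  have hx : ∀ a ∈ closure {x}, x ⤳ a := fun a ha ↦ specializes_iff_mem_closure.2 ha
  rw [isQuasiIso_chainMap_iff _ (mapsTo_fst_graphOn F _)]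
  let pt := PUnit.unit.{u + 1}
  have h₁ : QuasiIso ((singularChains R).map (TopCat.ofHom (ContinuousMap.const
      (closure {x} : Set X) pt))) :=
    quasiIso_of_specializes _ (ContinuousMap.const _ ⟨x, subset_closure rfl⟩)
      (fun a ↦ Topology.IsInducing.subtypeVal.specializes_iff.1 (hx a a.2)) fun _ ↦ specializes_rfl
  let q : C(graphOn F (closure {x}), F x) :=
    ⟨fun p ↦ ⟨p.1.2, subset_of_specializes hF hF' (hx _ p.2.1) p.2.2⟩, by fun_prop⟩
  let s : C(F x, graphOn F (closure {x})) :=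
    ⟨fun y ↦ ⟨(x, y), subset_closure rfl, y.2⟩, by fun_prop⟩
  have h₂ : QuasiIso ((singularChains R).map (TopCat.ofHom q)) :=
    quasiIso_of_specializes q s (fun p ↦ Topology.IsInducing.subtypeVal.specializes_iff.1
      ((hx _ p.2.1).prod specializes_rfl)) fun _ ↦ specializes_rfl
  have h₃ := quasiIso_of_isAcyclic (hF_acyclic x)
  have h : (singularChains R).map (TopCat.ofHom (restrictMap ContinuousMap.fst
        (mapsTo_fst_graphOn F (closure {x})))) ≫
      (singularChains R).map (TopCat.ofHom (ContinuousMap.const (closure {x} : Set X) pt)) =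
      (singularChains R).map (TopCat.ofHom q) ≫
        (singularChains R).map (TopCat.ofHom (ContinuousMap.const (F x) pt)) := by
    rw [← Functor.map_comp, ← Functor.map_comp]
    rfl
  have h₄ : QuasiIso ((singularChains R).map (TopCat.ofHom q) ≫
      (singularChains R).map (TopCat.ofHom (ContinuousMap.const (F x) pt))) := inferInstance
  rw [← h] at h₄
  exact quasiIso_of_comp_right _ ((singularChains R).map (TopCat.ofHom (ContinuousMap.const
    (closure {x} : Set X) pt)))

omit [TopologicalSpace X] [TopologicalSpace Y] in
theorem graphOn_union (F : X → Set Y) (A B : Set X) :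
    graphOn F (A ∪ B) = graphOn F A ∪ graphOn F B := by
  ext q
  simp [graphOn, or_and_right]

omit [TopologicalSpace X] [TopologicalSpace Y] in
theorem graphOn_inter (F : X → Set Y) (A B : Set X) :
    graphOn F (A ∩ B) = graphOn F A ∩ graphOn F B := by
  ext q
  simp only [graphOn, Set.mem_inter_iff, Set.mem_ofPred_eq]
  tauto

variable [Finite X] [T0Space X] [Finite Y] [T0Space Y]

/-- The Vietoris–Begle theorem for a lower semicontinuous map with closed acyclic values. The
closed set `D` is the union of the closure of a point `x` and of `D \ {x}`, which is closed if `x`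
is not a specialization of other points of `D`. -/
theorem isQuasiIso_fst {F : X → Set Y} (hF : LowerHemicontinuous F)
    (hF' : ∀ x, IsClosed (F x)) (hF_acyclic : ∀ x, IsAcyclic R (F x)) {D : Set X}
    (hD : IsClosed D) :
    IsQuasiIso (bd R (Sing (X × Y))) (bd R (Sing X)) (chainMap R ContinuousMap.fst)
      (chainsOn R (simplicesIn (graphOn F D))) (chainsOn R (simplicesIn D)) := by
  induction hn : D.ncard using Nat.strong_induction_on generalizing D with
  | _ n ih =>
  subst hn
  rcases D.eq_empty_or_nonempty with rfl | hne
  · have : graphOn F ∅ = ∅ := Set.eq_empty_of_forall_notMem fun q hq ↦ hq.1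
    have h : ∀ A : Set X, A = ∅ → simplicesIn A = ∅ := by
      rintro _ rfl
      exact Set.eq_empty_of_forall_notMem fun z hz ↦ hz (stdSimplex.vertex 0)
    have h' : simplicesIn (∅ : Set (X × Y)) = ∅ :=
      Set.eq_empty_of_forall_notMem fun z hz ↦ hz (stdSimplex.vertex 0)
    rw [this, h _ rfl, h', chainsOn, chainsOn, Finsupp.supported_empty, Finsupp.supported_empty,
      isQuasiIso_iff]
    rintro s rfl s' rfl - -
    exact ⟨0, rfl, 0, rfl, by simp, by simp⟩
  -- a generic point of an irreducible component
  obtain ⟨x, hxD, hx⟩ : ∃ x ∈ D, ∀ y ∈ D, y ⤳ x → y = x := by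
    let _ := specializationOrder X
    obtain ⟨x, hx⟩ := D.toFinite.exists_maximal hne
    exact ⟨x, hx.prop, fun y hy hxy ↦ le_antisymm (hx.le_of_ge hy hxy) hxy⟩
  have hcl : closure {x} ⊆ D := hD.closure_subset_iff.2 (Set.singleton_subset_iff.2 hxD)
  have hE : IsClosed (D \ {x}) := by
    have : D \ {x} = D \ nhdsKer {x} := by
      ext y
      simp only [Set.mem_sdiff, Set.mem_singleton_iff, mem_nhdsKer_singleton]
      refine and_congr_right fun hy ↦ not_congr ⟨?_, hx y hy⟩
      rintro rfl
      rfl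
    rw [this]
    exact hD.sdiff isOpen_nhdsKer
  have hDE : D = closure {x} ∪ D \ {x} := by
    refine subset_antisymm (fun y hy ↦ ?_) (Set.union_subset hcl Set.sdiff_subset)
    by_cases hyx : y = x
    · exact Or.inl (hyx ▸ subset_closure rfl)
    · exact Or.inr ⟨hy, hyx⟩
  by_cases hDx : D ⊆ closure {x}
  · rw [subset_antisymm hDx hcl]
    exact isQuasiIso_fst_closure hF hF' hF_acyclic x
  have cardE : (D \ {x}).ncard < D.ncard := Set.ncard_lt_ncard
    ⟨Set.sdiff_subset, fun h ↦ (h hxD).2 rfl⟩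
  have cardI : (closure {x} ∩ (D \ {x})).ncard < D.ncard :=
    (Set.ncard_le_ncard Set.inter_subset_right).trans_lt cardE
  have hI := ih _ cardI (isClosed_closure.inter hE) rfl
  rw [graphOn_inter] at hI
  rw [hDE, graphOn_union]
  refine IsQuasiIso.union (mapsTo_fst_graphOn F _) (mapsTo_fst_graphOn F _)
    (isQuasiIso_fst_closure hF hF' hF_acyclic x) (ih _ cardE hE rfl) hI
    (relAcyclic_of_isClosed (C₁ := Prod.fst ⁻¹' closure {x}) (C₂ := Prod.fst ⁻¹' (D \ {x}))
      (isClosed_closure.preimage continuous_fst) (hE.preimage continuous_fst) ?_ ?_ ?_)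
    (relAcyclic_of_isClosed isClosed_closure hE Set.inter_subset_right Set.inter_subset_right
      subset_rfl)
  · rintro q ⟨hq | hq, h⟩
    exacts [⟨h, hq.2⟩, ⟨h, hq.2⟩]
  · rintro q ⟨hq | hq, h⟩
    exacts [⟨h, hq.2⟩, ⟨h, hq.2⟩]
  · rintro q (hq | hq)
    exacts [Or.inl hq.1, Or.inr hq.1]

end Conley

/-! ### Relative homology in terms of chains -/

namespace Conley

open Simplicial

section Components

variable {R : Type u} [Ring R] {X Y : Type u} [TopologicalSpace X] [TopologicalSpace Y]

/-- The component of degree `n` of a chain. -/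
noncomputable def component (n : ℕ) : Tot R (Sing X) →ₗ[R] Tot R (Sing X) :=
  toTot R (Sing X) n ∘ₗ ofTot R (Sing X) n

theorem component_chainMap (f : C(X, Y)) (n : ℕ) (c : Tot R (Sing X)) :
    component n (chainMap R f c) = chainMap R f (component n c) := by
  rw [component, LinearMap.comp_apply, chainMap, ofTot_totMap, ← totMap_toTot]
  rfl

theorem component_bd (n : ℕ) (c : Tot R (Sing X)) :
    component n (bd R _ c) = bd R _ (component (n + 1) c) := by
  rw [component, LinearMap.comp_apply, ofTot_bd, ← bd_toTot]
  rfl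

theorem component_mem {A : Set X} (n : ℕ) {c : Tot R (Sing X)}
    (hc : c ∈ chainsOn R (simplicesIn A)) : component n c ∈ chainsOn R (simplicesIn A) := by
  rw [← range_chainMap_subIncl] at hc ⊢
  obtain ⟨b, rfl⟩ := hc
  exact ⟨component n b, (component_chainMap _ _ _).symm⟩

variable (R) in
/-- The singular chains of degree `n`, as elements of the total complex. -/
noncomputable def toSing (X : Type u) [TopologicalSpace X] (n : ℕ) :
    ((singularChains R).obj (TopCat.of X)).X n →ₗ[R] Tot R (Sing X) :=
  toTot R (Sing X) n

theorem toSing_injective (X : Type u) [TopologicalSpace X] (n : ℕ) :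
    Function.Injective (toSing R X n) :=
  Function.LeftInverse.injective (f := toTot R (Sing X) n) ofTot_toTot

theorem component_toSing {n : ℕ} (x : ((singularChains R).obj (TopCat.of X)).X n) :
    component n (toSing R X n x) = toSing R X n x :=
  congrArg (toTot R (Sing X) n) (ofTot_toTot _)

theorem exists_toSing_eq (n : ℕ) (c : Tot R (Sing X)) :
    ∃ x, toSing R X n x = component n c := ⟨ofTot R (Sing X) n c, rfl⟩

theorem bd_toSing {n : ℕ} (x : ((singularChains R).obj (TopCat.of X)).X (n + 1)) :
    bd R _ (toSing R X (n + 1) x) =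
      toSing R X n (((singularChains R).obj (TopCat.of X)).d (n + 1) n x) := bd_toTot _

theorem bd_toSing_zero (x : ((singularChains R).obj (TopCat.of X)).X 0) :
    bd R _ (toSing R X 0 x) = 0 := bd_toTot_zero _

theorem toSing_map (f : C(X, Y)) {n : ℕ} (x : ((singularChains R).obj (TopCat.of X)).X n) :
    toSing R Y n (((singularChains R).map (TopCat.ofHom f)).f n x) =
      chainMap R f (toSing R X n x) := (totMap_toTot _ _).symm

variable (R) in
/-- The chains of degree `n` of a subspace, as chains of the ambient space. -/
noncomputable def subChains (A : Set X) (n : ℕ) :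
    ((singularChains R).obj (TopCat.of A)).X n →ₗ[R] Tot R (Sing X) :=
  chainMap R (subIncl A) ∘ₗ toSing R A n

theorem subChains_apply (A : Set X) {n : ℕ} (x : ((singularChains R).obj (TopCat.of A)).X n) :
    subChains R A n x = chainMap R (subIncl A) (toSing R A n x) := rfl

theorem subChains_mem (A : Set X) {n : ℕ} (x : ((singularChains R).obj (TopCat.of A)).X n) :
    subChains R A n x ∈ chainsOn R (simplicesIn A) := by
  rw [← range_chainMap_subIncl]
  exact ⟨_, rfl⟩

theorem component_subChains (A : Set X) {n : ℕ}
    (x : ((singularChains R).obj (TopCat.of A)).X n) :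
    component n (subChains R A n x) = subChains R A n x := by
  rw [subChains_apply, component_chainMap, component_toSing]

theorem exists_subChains_eq {A : Set X} (n : ℕ) {c : Tot R (Sing X)}
    (hc : c ∈ chainsOn R (simplicesIn A)) : ∃ x, subChains R A n x = component n c := by
  rw [← range_chainMap_subIncl] at hc
  obtain ⟨b, rfl⟩ := hc
  obtain ⟨x, hx⟩ := exists_toSing_eq n b
  exact ⟨x, by rw [subChains_apply, hx, component_chainMap]⟩

theorem subChains_injective (A : Set X) (n : ℕ) : Function.Injective (subChains R A n) :=
  (chainMap_subIncl_injective A).comp (toSing_injective A n)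

theorem bd_subChains (A : Set X) {n : ℕ}
    (x : ((singularChains R).obj (TopCat.of A)).X (n + 1)) :
    bd R _ (subChains R A (n + 1) x) =
      subChains R A n (((singularChains R).obj (TopCat.of A)).d (n + 1) n x) := by
  rw [subChains_apply, ← chainMap_bd, bd_toSing, subChains_apply]

theorem bd_subChains_zero (A : Set X) (x : ((singularChains R).obj (TopCat.of A)).X 0) :
    bd R _ (subChains R A 0 x) = 0 := by
  rw [subChains_apply, ← chainMap_bd, bd_toSing_zero, map_zero]

theorem subChains_map (f : C(X, Y)) {A : Set X} {B : Set Y} (h : Set.MapsTo f A B) {n : ℕ}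
    (x : ((singularChains R).obj (TopCat.of A)).X n) :
    subChains R B n (((singularChains R).map (TopCat.ofHom (restrictMap f h))).f n x) =
      chainMap R f (subChains R A n x) := by
  rw [subChains_apply, subChains_apply, toSing_map, ← chainMap_comp, ← chainMap_comp]
  rfl

end Components

section Relative

variable {R : Type u} [Ring R] {X Y : Type u} [TopologicalSpace X] [TopologicalSpace Y]

variable (R) in
/-- The projection of the chains of `P₁` to the relative chains of `(P₁, P₂)`. -/
noncomputable def relπ (P : SetPair X) :
    (singularChains R).obj (TopCat.of P.fst) ⟶ (relChains R).obj P.toTopPair :=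
  Limits.cokernel.π ((singularChains R).map P.toTopPair.map)

theorem relπ_naturality (f : C(X, Y)) {P : SetPair X} {Q : SetPair Y}
    (h₁ : Set.MapsTo f P.fst Q.fst) (h₂ : Set.MapsTo f P.snd Q.snd) :
    relπ R P ≫ (relChains R).map (SetPair.mapHom f h₁ h₂) =
      (singularChains R).map (TopCat.ofHom (restrictMap f h₁)) ≫ relπ R Q := by
  exact Limits.cokernel.π_desc _ _ _

theorem relπ_surjective (P : SetPair X) (n : ℕ) : Function.Surjective ((relπ R P).f n) := by
  have : Epi (relπ R P) := Limits.coequalizer.π_epi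
  exact (ModuleCat.epi_iff_surjective _).1 inferInstance

theorem relπ_eq_zero_iff (P : SetPair X) {n : ℕ}
    (x : ((singularChains R).obj (TopCat.of P.fst)).X n) :
    (relπ R P).f n x = 0 ↔ subChains R P.fst n x ∈ chainsOn R (simplicesIn P.snd) := by
  let i : C(P.snd, P.fst) := restrictMap (ContinuousMap.id X) P.snd_subset
  have hi : ∀ w, subChains R P.fst n (((singularChains R).map (TopCat.ofHom i)).f n w) =
      subChains R P.snd n w := fun w ↦ by
    have := subChains_map (R := R) (ContinuousMap.id X) P.snd_subset w
    rwa [chainMap_id] at this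
  have hex := (HomologicalComplex.exact_iff_degreewise_exact _).1
    (ShortComplex.exact_cokernel ((singularChains R).map P.toTopPair.map)) n
  rw [ShortComplex.moduleCat_exact_iff] at hex
  constructor
  · intro h
    obtain ⟨w, rfl⟩ := hex x h
    have := hi w
    exact this ▸ subChains_mem _ w
  · intro h
    obtain ⟨w, hw⟩ := exists_subChains_eq n h
    rw [component_subChains, ← hi] at hw
    rw [← subChains_injective _ _ hw]
    exact congr($(Limits.cokernel.condition ((singularChains R).map P.toTopPair.map)).f n w)

theorem relπ_d (P : SetPair X) {n : ℕ}
    (x : ((singularChains R).obj (TopCat.of P.fst)).X (n + 1)) :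
    ((relChains R).obj P.toTopPair).d (n + 1) n ((relπ R P).f (n + 1) x) =
      (relπ R P).f n (((singularChains R).obj (TopCat.of P.fst)).d (n + 1) n x) :=
  congr($((relπ R P).comm (n + 1) n) x)

theorem bd_mem_of_dFrom_eq_zero (P : SetPair X) {n : ℕ}
    (x : ((singularChains R).obj (TopCat.of P.fst)).X n)
    (h : ((relChains R).obj P.toTopPair).dFrom n ((relπ R P).f n x) = 0) :
    bd R _ (subChains R P.fst n x) ∈ chainsOn R (simplicesIn P.snd) := by
  cases n with
  | zero =>
    rw [bd_subChains_zero]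
    exact Submodule.zero_mem _
  | succ n =>
    rw [bd_subChains, ← relπ_eq_zero_iff, ← relπ_d]
    rw [HomologicalComplex.dFrom_eq _ (show (ComplexShape.down ℕ).Rel (n + 1) n by simp),
      ModuleCat.comp_apply] at h
    exact (map_eq_zero_iff _ ((ModuleCat.mono_iff_injective
      (((relChains R).obj P.toTopPair).xNextIso
        (show (ComplexShape.down ℕ).Rel (n + 1) n by simp)).inv).1 inferInstance)).1 h

theorem dFrom_eq_zero_of_bd_mem (P : SetPair X) {n : ℕ}
    (x : ((singularChains R).obj (TopCat.of P.fst)).X n)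
    (h : bd R _ (subChains R P.fst n x) ∈ chainsOn R (simplicesIn P.snd)) :
    ((relChains R).obj P.toTopPair).dFrom n ((relπ R P).f n x) = 0 := by
  cases n with
  | zero =>
    rw [HomologicalComplex.dFrom_eq_zero _ (by simp)]
    simp
  | succ n =>
    rw [bd_subChains, ← relπ_eq_zero_iff, ← relπ_d] at h
    rw [HomologicalComplex.dFrom_eq _ (show (ComplexShape.down ℕ).Rel (n + 1) n by simp),
      ModuleCat.comp_apply, h, map_zero]

/-- A map of pairs is an isomorphism in relative homology if it is injective and surjective on
relative homology classes, represented by chains in the ambient spaces. -/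
theorem isIso_homologyMap (f : C(X, Y)) {P : SetPair X} {Q : SetPair Y}
    (h₁ : Set.MapsTo f P.fst Q.fst) (h₂ : Set.MapsTo f P.snd Q.snd)
    (hinj : ∀ z ∈ chainsOn R (simplicesIn P.fst), bd R _ z ∈ chainsOn R (simplicesIn P.snd) →
      ∀ s ∈ chainsOn R (simplicesIn Q.fst),
        chainMap R f z - bd R _ s ∈ chainsOn R (simplicesIn Q.snd) →
      ∃ t ∈ chainsOn R (simplicesIn P.fst), z - bd R _ t ∈ chainsOn R (simplicesIn P.snd))
    (hsurj : ∀ z' ∈ chainsOn R (simplicesIn Q.fst), bd R _ z' ∈ chainsOn R (simplicesIn Q.snd) →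
      ∃ z ∈ chainsOn R (simplicesIn P.fst), bd R _ z ∈ chainsOn R (simplicesIn P.snd) ∧
      ∃ t ∈ chainsOn R (simplicesIn Q.fst),
        chainMap R f z - bd R _ t - z' ∈ chainsOn R (simplicesIn Q.snd)) :
    IsIso (SetPair.homologyMap R f h₁ h₂) := by
  have hnat : ∀ (n : ℕ) (x : ((singularChains R).obj (TopCat.of P.fst)).X n),
      ((relChains R).map (SetPair.mapHom f h₁ h₂)).f n ((relπ R P).f n x) =
        (relπ R Q).f n (((singularChains R).map (TopCat.ofHom (restrictMap f h₁))).f n x) :=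
    fun n x ↦ congr(($(relπ_naturality f h₁ h₂)).f n x)
  suffices QuasiIso ((relChains R).map (SetPair.mapHom f h₁ h₂)) by
    have : ∀ n, IsIso (SetPair.homologyMap R f h₁ h₂ n) := fun n ↦
      (quasiIsoAt_iff_isIso_homologyMap _ n).1 inferInstance
    exact GradedObject.isIso_of_isIso_apply _
  rw [quasiIso_iff_elements]
  intro n
  constructor
  · intro z hz ⟨s, hs⟩
    obtain ⟨x, rfl⟩ := relπ_surjective P n z
    obtain ⟨y, rfl⟩ := relπ_surjective Q (n + 1) s
    rw [hnat, relπ_d, ← sub_eq_zero, ← map_sub, relπ_eq_zero_iff, map_sub, subChains_map,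
      ← bd_subChains] at hs
    obtain ⟨t, ht, htx⟩ := hinj _ (subChains_mem _ x) (bd_mem_of_dFrom_eq_zero P x hz)
      _ (subChains_mem _ y) hs
    obtain ⟨w, hw⟩ := exists_subChains_eq (n + 1) ht
    refine ⟨(relπ R P).f (n + 1) w, ?_⟩
    rw [relπ_d, eq_comm, ← sub_eq_zero, ← map_sub, relπ_eq_zero_iff, map_sub, ← bd_subChains, hw,
      ← component_bd, ← component_subChains, ← map_sub]
    exact component_mem n htx
  · intro z' hz'
    obtain ⟨x', rfl⟩ := relπ_surjective Q n z'
    obtain ⟨z, hz, hdz, t, ht, h⟩ := hsurj _ (subChains_mem _ x')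
      (bd_mem_of_dFrom_eq_zero Q x' hz')
    obtain ⟨x, hx⟩ := exists_subChains_eq n hz
    obtain ⟨w, hw⟩ := exists_subChains_eq (n + 1) ht
    refine ⟨(relπ R P).f n x, dFrom_eq_zero_of_bd_mem P x ?_, (relπ R Q).f (n + 1) w, ?_⟩
    · cases n with
      | zero =>
        rw [bd_subChains_zero]
        exact Submodule.zero_mem _
      | succ n =>
        rw [hx, ← component_bd]
        exact component_mem n hdz
    · rw [hnat, relπ_d, ← sub_eq_zero, ← map_sub, ← map_sub, relπ_eq_zero_iff, map_sub, map_sub,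
        subChains_map, ← bd_subChains, hw, hx, ← component_chainMap, ← component_bd,
        ← component_subChains, ← map_sub, ← map_sub]
      exact component_mem n h

/-- The five lemma for maps of pairs. -/
theorem isIso_homologyMap_of_isQuasiIso (f : C(X, Y)) {P : SetPair X} {Q : SetPair Y}
    (h₁ : Set.MapsTo f P.fst Q.fst) (h₂ : Set.MapsTo f P.snd Q.snd)
    (hf₁ : IsQuasiIso (bd R (Sing X)) (bd R (Sing Y)) (chainMap R f)
      (chainsOn R (simplicesIn P.fst)) (chainsOn R (simplicesIn Q.fst)))
    (hf₂ : IsQuasiIso (bd R (Sing X)) (bd R (Sing Y)) (chainMap R f)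
      (chainsOn R (simplicesIn P.snd)) (chainsOn R (simplicesIn Q.snd))) :
    IsIso (SetPair.homologyMap R f h₁ h₂) := by
  rw [isQuasiIso_iff] at hf₁ hf₂
  have hP := chainsOn_mono (R := R) (simplicesIn_mono P.snd_subset)
  have hQ := chainsOn_mono (R := R) (simplicesIn_mono Q.snd_subset)
  refine isIso_homologyMap f h₁ h₂ (fun z hz hdz s hs hzs ↦ ?_) fun z' hz' hdz' ↦ ?_
  · obtain ⟨t, ht, t', ht', hdt, h⟩ := hf₂ _ hdz _ hzs (bd_bd z)
      (by rw [chainMap_bd, map_sub, bd_bd, sub_zero])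
    obtain ⟨w, hw, w', hw', hdw, -⟩ := hf₁ (z - t) (Submodule.sub_mem _ hz (hP ht)) (s - t')
      (Submodule.sub_mem _ hs (hQ ht')) (by rw [map_sub, hdt, sub_self])
      (by
        rw [sub_eq_sub_iff_add_eq_add] at h
        rw [map_sub, map_sub, sub_eq_sub_iff_add_eq_add, ← h, add_comm])
    exact ⟨w, hw, by rwa [hdw, sub_sub_cancel]⟩
  · obtain ⟨t, ht, t', ht', hdt, h⟩ := hf₂ 0 (Submodule.zero_mem _) _ hdz' (map_zero _)
      (by rw [map_zero, bd_bd])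
    obtain ⟨w, hw, w', hw', hdw, hfw⟩ := hf₁ t (hP ht) (z' + t')
      (Submodule.add_mem _ hz' (hQ ht')) hdt (by rw [map_add, ← h]; abel)
    refine ⟨w, hw, hdw ▸ ht, w', hw', ?_⟩
    rwa [hfw, add_sub_cancel_left]

/-- Excision: the inclusion `(A, A ∩ B) ⟶ (A ∪ B, B)`. -/
theorem isIso_homologyMap_of_relAcyclic {P Q : SetPair X}
    (h₁ : Set.MapsTo (ContinuousMap.id X) P.fst Q.fst)
    (h₂ : Set.MapsTo (ContinuousMap.id X) P.snd Q.snd)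
    (hQ : Q.fst = P.fst ∪ Q.snd) (hP : P.fst ∩ Q.snd ⊆ P.snd)
    (h : RelAcyclic (bd R (Sing X)) (chainsOn R (simplicesIn (P.fst ∪ Q.snd)))
      (chainsOn R (simplicesIn P.fst) ⊔ chainsOn R (simplicesIn Q.snd))) :
    IsIso (SetPair.homologyMap R (ContinuousMap.id X) h₁ h₂) := by
  have hmem : ∀ c ∈ chainsOn R (simplicesIn P.fst), c ∈ chainsOn R (simplicesIn Q.snd) →
      c ∈ chainsOn R (simplicesIn P.snd) := fun c hc hc' ↦ by
    have : c ∈ chainsOn R (simplicesIn (P.fst ∩ Q.snd)) := by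
      rw [simplicesIn_inter, chainsOn_inter]
      exact ⟨hc, hc'⟩
    exact chainsOn_mono (simplicesIn_mono hP) this
  have hPQ := chainsOn_mono (R := R) (simplicesIn_mono h₂)
  rw [← hQ] at h
  refine isIso_homologyMap _ h₁ h₂ (fun z hz hdz s hs hzs ↦ ?_) fun z' hz' hdz' ↦ ?_
  · rw [chainMap_id] at hzs
    have hds : bd R _ s ∈ chainsOn R (simplicesIn P.fst) ⊔ chainsOn R (simplicesIn Q.snd) := by
      rw [← sub_sub_cancel z (bd R _ s)]
      exact Submodule.sub_mem _ (Submodule.mem_sup_left hz) (Submodule.mem_sup_right hzs)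
    obtain ⟨b, hb, hsb⟩ := h s hs hds
    obtain ⟨p, hp, q, hq, hpq⟩ := Submodule.mem_sup.1 hsb
    have hd : bd R _ p + bd R _ q = bd R _ s := by
      rw [← map_add, hpq, map_sub, bd_bd, sub_zero]
    refine ⟨p, hp, hmem _ (Submodule.sub_mem _ hz (bd_mem_simplicesIn hp)) ?_⟩
    have := Submodule.add_mem _ hzs (bd_mem_simplicesIn hq)
    rwa [← hd, sub_add_eq_sub_sub, sub_add_cancel] at this
  · obtain ⟨b, hb, hzb⟩ := h z' hz' (Submodule.mem_sup_right hdz')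
    obtain ⟨p, hp, q, hq, hpq⟩ := Submodule.mem_sup.1 hzb
    have hd : bd R _ p + bd R _ q = bd R _ z' := by
      rw [← map_add, hpq, map_sub, bd_bd, sub_zero]
    refine ⟨p, hp, hmem _ (bd_mem_simplicesIn hp) ?_, -b, Submodule.neg_mem _ hb, ?_⟩
    · rw [eq_sub_of_add_eq hd]
      exact Submodule.sub_mem _ hdz' (bd_mem_simplicesIn hq)
    · rw [chainMap_id]
      have : p - bd R _ (-b) - z' = -q := by
        rw [map_neg, eq_sub_of_add_eq hpq]
        abel
      rw [this]
      exact Submodule.neg_mem _ hq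

end Relative

end Conley

/-! ### Normal functors and shift equivalence -/

namespace Conley

/-- The shift equivalence principle: a normal functor identifies `(A, a)` and `(B, b)` if `a` and
`b` are the two compositions of a pair of morphisms between `A` and `B`. -/
theorem IsNormal.nonempty_iso {E C : Type*} [Category* E] [Category* C] {L : EndoObj E ⥤ C}
    (hL : IsNormal L) {A B : EndoObj E} (f : A.pt ⟶ B.pt) (g : B.pt ⟶ A.pt)
    (hfg : f ≫ g = A.endo) (hgf : g ≫ f = B.endo) : Nonempty (L.obj A ≅ L.obj B) := by
  let φ : A ⟶ B := EndoObj.Hom.mk f (by rw [← hfg, ← hgf, Category.assoc])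
  let ψ : B ⟶ A := EndoObj.Hom.mk g (by rw [← hfg, ← hgf, Category.assoc])
  have h₁ : φ ≫ ψ = A.induced := EndoObj.Hom.ext hfg
  have h₂ : ψ ≫ φ = B.induced := EndoObj.Hom.ext hgf
  have i₁ : IsIso (L.map φ ≫ L.map ψ) := by rw [← L.map_comp, h₁]; exact hL A
  have i₂ : IsIso (L.map ψ ≫ L.map φ) := by rw [← L.map_comp, h₂]; exact hL B
  have : Mono (L.map φ) := mono_of_mono (L.map φ) (L.map ψ)
  have : IsSplitEpi (L.map φ) := IsSplitEpi.mk' ⟨CategoryTheory.inv (L.map ψ ≫ L.map φ) ≫ L.map ψ,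
    by rw [Category.assoc, IsIso.inv_hom_id]⟩
  have : IsIso (L.map φ) := isIso_of_mono_of_isSplitEpi _
  exact ⟨asIso (L.map φ)⟩

/-! ### Naturality of the homomorphisms induced by multivalued maps -/

section Maps

variable {X Y : Type u} [TopologicalSpace X] [TopologicalSpace Y]
  (R : Type u) [Ring R]

theorem invOrZero_eq {A B : GrMod R} (f : A ⟶ B) [h : IsIso f] :
    invOrZero R f = CategoryTheory.inv f := dif_pos h

/-- The homomorphism induced by an inclusion of pairs. -/
noncomputable def inclMap {P Q : SetPair X} (h₁ : P.fst ⊆ Q.fst) (h₂ : P.snd ⊆ Q.snd) :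
    P.homology R ⟶ Q.homology R :=
  SetPair.homologyMap R (ContinuousMap.id X) (fun _ h ↦ h₁ h) fun _ h ↦ h₂ h

variable {R}

theorem inclMap_comp {P Q T : SetPair X} (h₁ : P.fst ⊆ Q.fst) (h₂ : P.snd ⊆ Q.snd)
    (k₁ : Q.fst ⊆ T.fst) (k₂ : Q.snd ⊆ T.snd) :
    inclMap R h₁ h₂ ≫ inclMap R k₁ k₂ = inclMap R (h₁.trans k₁) (h₂.trans k₂) :=
  ((relHomology R).map_comp _ _).symm

theorem projFst_comp_inclMap (F : X → Set Y) {P P' : SetPair X} (h₁ : P.fst ⊆ P'.fst)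
    (h₂ : P.snd ⊆ P'.snd) : projFst R F P ≫ inclMap R h₁ h₂ =
      inclMap R (P := graphPair F P) (Q := graphPair F P') (fun _ h ↦ ⟨h₁ h.1, h.2⟩)
        (fun _ h ↦ ⟨h₂ h.1, h.2⟩) ≫ projFst R F P' :=
  ((relHomology R).map_comp _ _).symm.trans ((relHomology R).map_comp
    (SetPair.mapHom (P := graphPair F P) (Q := graphPair F P') (ContinuousMap.id (X × Y))
      (fun _ h ↦ ⟨h₁ h.1, h.2⟩) fun _ h ↦ ⟨h₂ h.1, h.2⟩)
    (SetPair.mapHom (P := graphPair F P') ContinuousMap.fst (fun _ h ↦ h.1) fun _ h ↦ h.1))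

theorem inclMap_comp_projSnd (F : X → Set Y) {P P' : SetPair X} {Q : SetPair Y}
    (h₁ : P.fst ⊆ P'.fst) (h₂ : P.snd ⊆ P'.snd) (h : MultiMapsTo F P Q)
    (h' : MultiMapsTo F P' Q) :
    inclMap R (P := graphPair F P) (Q := graphPair F P') (fun _ h ↦ ⟨h₁ h.1, h.2⟩)
        (fun _ h ↦ ⟨h₂ h.1, h.2⟩) ≫ projSnd R F h' = projSnd R F h :=
  ((relHomology R).map_comp _ _).symm

theorem multiMap_comp_inclMap (F : X → Set Y) {P : SetPair X} {Q Q' : SetPair Y}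
    (h : MultiMapsTo F P Q) (h' : MultiMapsTo F P Q') (h₁ : Q.fst ⊆ Q'.fst)
    (h₂ : Q.snd ⊆ Q'.snd) : multiMap R F h ≫ inclMap R h₁ h₂ = multiMap R F h' := by
  rw [multiMap, multiMap, Category.assoc]
  exact congrArg _ ((relHomology R).map_comp _ _).symm

theorem inclMap_comp_multiMap (F : X → Set Y) {P P' : SetPair X} {Q : SetPair Y}
    (h₁ : P.fst ⊆ P'.fst) (h₂ : P.snd ⊆ P'.snd) (h : MultiMapsTo F P Q)
    (h' : MultiMapsTo F P' Q) [IsIso (projFst R F P)] [IsIso (projFst R F P')] :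
    inclMap R h₁ h₂ ≫ multiMap R F h' = multiMap R F h := by
  rw [multiMap, multiMap, invOrZero_eq, invOrZero_eq, IsIso.eq_inv_comp, ← Category.assoc,
    projFst_comp_inclMap, Category.assoc, IsIso.hom_inv_id_assoc,
    inclMap_comp_projSnd F h₁ h₂]

theorem fst_subset_barPair (F : X → Set X) (N : Set X) (P : SetPair X) :
    P.fst ⊆ (barPair F N P).fst := Set.subset_union_left

theorem snd_subset_barPair (F : X → Set X) (N : Set X) (P : SetPair X) :
    P.snd ⊆ (barPair F N P).snd := Set.subset_union_left

theorem inclBar_eq (F : X → Set X) (N : Set X) (P : SetPair X) :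
    inclBar R F N P = inclMap R (fst_subset_barPair F N P) (snd_subset_barPair F N P) := rfl

variable [Finite X] [T0Space X]

theorem isIso_projFst [Finite Y] [T0Space Y] {F : X → Set Y} (hF : LowerHemicontinuous F)
    (hF' : ∀ x, IsClosed (F x)) (hF_acyclic : ∀ x, IsAcyclic R (F x)) {P : SetPair X}
    (hP₁ : IsClosed P.fst) (hP₂ : IsClosed P.snd) : IsIso (projFst R F P) :=
  isIso_homologyMap_of_isQuasiIso (P := graphPair F P) _ _ _
    (isQuasiIso_fst hF hF' hF_acyclic hP₁) (isQuasiIso_fst hF hF' hF_acyclic hP₂)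

theorem isIso_inclMap {P Q : SetPair X} (h₁ : P.fst ⊆ Q.fst) (h₂ : P.snd ⊆ Q.snd)
    (hP₁ : IsClosed P.fst) (hQ₂ : IsClosed Q.snd) (hQ : Q.fst ⊆ P.fst ∪ Q.snd)
    (hP : P.fst ∩ Q.snd ⊆ P.snd) : IsIso (inclMap R h₁ h₂) :=
  isIso_homologyMap_of_relAcyclic _ _
    (subset_antisymm hQ (Set.union_subset h₁ Q.snd_subset)) hP
    (relAcyclic_of_isClosed hP₁ hQ₂ Set.inter_subset_right Set.inter_subset_right subset_rfl)

theorem IsIndexPair.isIso_inclBar {F : X → Set X} {S N : Set X} {P : SetPair X}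
    (hP : IsIndexPair F S N P) : IsIso (inclBar R F N P) := by
  rw [inclBar_eq]
  refine isIso_inclMap _ _ hP.closed_fst (hP.closed_snd.union isClosed_closure) ?_ ?_
  · exact Set.union_subset_union_right _ Set.subset_union_right
  · rintro x ⟨hx, h | h⟩
    exacts [h, hP.exit ⟨hx, h⟩]

theorem IsIndexPair.indexMap_comp_inclBar {F : X → Set X} {S N : Set X} {P : SetPair X}
    (hP : IsIndexPair F S N P) :
    indexMap R hP ≫ inclBar R F N P = multiMap R F hP.multiMapsTo := by
  have := hP.isIso_inclBar (R := R)
  rw [indexMap, invOrZero_eq, Category.assoc, IsIso.inv_hom_id, Category.comp_id]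

end Maps

/-! ### Comparison of index pairs -/

section Comparison

variable {R : Type u} [Ring R] {X : Type u} [TopologicalSpace X] [Finite X] [T0Space X]
  {F : X → Set X} (hF : LowerHemicontinuous F) (hF' : ∀ x, IsClosed (F x))
  (hF_acyclic : ∀ x, IsAcyclic R (F x)) {C : Type*} [Category* C] {L : EndoObj (GrMod R) ⥤ C}
  (hL : IsNormal L) {S N M : Set X} {P Q : SetPair X}

include hF hF' hF_acyclic hL

/-- Two index pairs have the same index if the inclusion is an isomorphism by excision. -/
theorem IsIndexPair.nonempty_iso_of_excision (hP : IsIndexPair F S N P)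
    (hQ : IsIndexPair F S M Q) (h₁ : P.fst ⊆ Q.fst) (h₂ : P.snd ⊆ Q.snd)
    (hPQ : Q.fst ⊆ P.fst ∪ Q.snd) (hQP : P.fst ∩ Q.snd ⊆ P.snd)
    (h : closure (image F P.fst \ N) ⊆ (barPair F M Q).snd) :
    Nonempty (L.obj ⟨P.homology R, indexMap R hP⟩ ≅ L.obj ⟨Q.homology R, indexMap R hQ⟩) := by
  have := isIso_projFst hF hF' hF_acyclic hP.closed_fst hP.closed_snd
  have := isIso_projFst hF hF' hF_acyclic hQ.closed_fst hQ.closed_snd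
  have hi : IsIso (inclMap R h₁ h₂) := isIso_inclMap _ _ hP.closed_fst hQ.closed_snd hPQ hQP
  have := hQ.isIso_inclBar (R := R)
  have hb₂ : (barPair F N P).snd ⊆ (barPair F M Q).snd :=
    Set.union_subset (h₂.trans Set.subset_union_left) h
  have hb₁ : (barPair F N P).fst ⊆ (barPair F M Q).fst :=
    Set.union_subset (h₁.trans Set.subset_union_left) (h.trans (barPair F M Q).snd_subset)
  have hm : MultiMapsTo F P (barPair F M Q) :=
    ⟨fun x hx ↦ (hP.multiMapsTo.1 x hx).trans hb₁, fun x hx ↦ (hP.multiMapsTo.2 x hx).trans hb₂⟩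
  have hcomm : indexMap R hP ≫ inclMap R h₁ h₂ = inclMap R h₁ h₂ ≫ indexMap R hQ := by
    rw [← cancel_mono (inclBar R F M Q), Category.assoc, Category.assoc,
      hQ.indexMap_comp_inclBar, inclMap_comp_multiMap F h₁ h₂ hm,
      ← multiMap_comp_inclMap F hP.multiMapsTo hm hb₁ hb₂, ← hP.indexMap_comp_inclBar,
      Category.assoc, inclBar_eq, inclBar_eq, inclMap_comp, inclMap_comp]
  refine hL.nonempty_iso (A := ⟨_, _⟩) (B := ⟨_, _⟩) (inclMap R h₁ h₂)
    (CategoryTheory.inv (inclMap R h₁ h₂) ≫ indexMap R hP) ?_ ?_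
  · rw [IsIso.hom_inv_id_assoc]
  · rw [Category.assoc, hcomm, IsIso.inv_hom_id_assoc]

/-- Two index pairs have the same index if the larger one is mapped to the smaller one, up to
an exit set which is disjoint from the difference of the smaller one. -/
theorem IsIndexPair.nonempty_iso_of_image_subset (hP : IsIndexPair F S N P)
    (hQ : IsIndexPair F S N Q) (h₁ : P.fst ⊆ Q.fst) (h₂ : P.snd ⊆ Q.snd)
    (hQ₁ : image F Q.fst ∩ N ⊆ P.fst) (hQ₂ : image F Q.snd ∩ N ⊆ P.snd)
    (hexit : P.fst ∩ closure (image F Q.fst \ N) ⊆ P.snd) :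
    Nonempty (L.obj ⟨P.homology R, indexMap R hP⟩ ≅ L.obj ⟨Q.homology R, indexMap R hQ⟩) := by
  have := isIso_projFst hF hF' hF_acyclic hP.closed_fst hP.closed_snd
  have := isIso_projFst hF hF' hF_acyclic hQ.closed_fst hQ.closed_snd
  have := hQ.isIso_inclBar (R := R)
  let D := closure (image F Q.fst \ N)
  let T : SetPair X := ⟨P.fst ∪ D, P.snd ∪ D, Set.union_subset_union_left _ P.snd_subset⟩
  have hD : ∀ x ∈ Q.fst, ∀ y ∈ F x, y ∉ N → y ∈ D := fun x hx y hy hN ↦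
    subset_closure ⟨Set.mem_biUnion hx hy, hN⟩
  have hQT : MultiMapsTo F Q T := by
    refine ⟨fun x hx y hy ↦ ?_, fun x hx y hy ↦ ?_⟩
    · by_cases hN : y ∈ N
      · exact Or.inl (hQ₁ ⟨Set.mem_biUnion hx hy, hN⟩)
      · exact Or.inr (hD x hx y hy hN)
    · by_cases hN : y ∈ N
      · exact Or.inl (hQ₂ ⟨Set.mem_biUnion hx hy, hN⟩)
      · exact Or.inr (hD x (Q.snd_subset hx) y hy hN)
  have hPT : MultiMapsTo F P T := ⟨fun x hx ↦ hQT.1 x (h₁ hx), fun x hx ↦ hQT.2 x (h₂ hx)⟩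
  have hDD : closure (image F P.fst \ N) ⊆ D := closure_mono
    (Set.sdiff_subset_sdiff_left (Set.biUnion_subset_biUnion_left h₁))
  have hP₁ : P.fst ⊆ T.fst := Set.subset_union_left
  have hP₂ : P.snd ⊆ T.snd := Set.subset_union_left
  have hb₁ : (barPair F N P).fst ⊆ T.fst := Set.union_subset_union_right _ hDD
  have hb₂ : (barPair F N P).snd ⊆ T.snd := Set.union_subset_union_right _ hDD
  have hT₁ : T.fst ⊆ (barPair F N Q).fst := Set.union_subset_union_left _ h₁
  have hT₂ : T.snd ⊆ (barPair F N Q).snd := Set.union_subset_union_left _ h₂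
  have hi : IsIso (inclMap R hP₁ hP₂) := by
    refine isIso_inclMap _ _ hP.closed_fst (hP.closed_snd.union isClosed_closure) ?_ ?_
    · exact Set.union_subset_union_right _ Set.subset_union_right
    · rintro x ⟨hx, h | h⟩
      exacts [h, hexit ⟨hx, h⟩]
  refine hL.nonempty_iso (A := ⟨_, _⟩) (B := ⟨_, _⟩) (inclMap R h₁ h₂)
    (multiMap R F hQT ≫ CategoryTheory.inv (inclMap R hP₁ hP₂)) ?_ ?_
  · rw [← cancel_mono (inclMap R hP₁ hP₂), Category.assoc, Category.assoc, IsIso.inv_hom_id,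
      Category.comp_id, inclMap_comp_multiMap F h₁ h₂ hPT,
      ← multiMap_comp_inclMap F hP.multiMapsTo hPT hb₁ hb₂, ← hP.indexMap_comp_inclBar,
      Category.assoc, inclBar_eq, inclMap_comp]
  · rw [← cancel_mono (inclBar R F N Q), hQ.indexMap_comp_inclBar,
      ← multiMap_comp_inclMap F hQT hQ.multiMapsTo hT₁ hT₂, Category.assoc, Category.assoc,
      inclBar_eq, inclMap_comp, ← inclMap_comp hP₁ hP₂ hT₁ hT₂, IsIso.inv_hom_id_assoc]

end Comparison

end Conley

/-! ### Invariant parts -/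

namespace Conley

section Invariant

variable {X : Type u} {F : X → Set X} {A B S : Set X}

theorem image_mono (h : A ⊆ B) : image F A ⊆ image F B := Set.biUnion_subset_biUnion_left h

theorem mem_image_of_mem {x y : X} (hx : x ∈ A) (hy : y ∈ F x) : y ∈ image F A :=
  Set.mem_biUnion hx hy

theorem image_union : image F (A ∪ B) = image F A ∪ image F B := Set.biUnion_union _ _ _

theorem inv_subset (F : X → Set X) (A : Set X) : inv F A ⊆ A := fun _ h ↦ h.1

theorem inv_mono (h : A ⊆ B) : inv F A ⊆ inv F B := fun _ ⟨hx, σ, hσ, hi⟩ ↦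
  ⟨h hx, σ, ⟨fun i ↦ h (hσ.1 i), hσ.2⟩, hi⟩

theorem IsInvariant.subset_inv (hS : IsInvariant F S) (h : S ⊆ A) : S ⊆ inv F A := fun x hx ↦
  inv_mono h ⟨hx, hS x hx⟩

theorem IsInvariant.exists_succ (hS : IsInvariant F S) {x : X} (hx : x ∈ S) :
    ∃ y ∈ S, y ∈ F x := by
  obtain ⟨σ, hσ, i, rfl⟩ := hS x hx
  exact ⟨σ (i + 1), hσ.1 _, hσ.2 i⟩

theorem IsInvariant.subset_image (hS : IsInvariant F S) : S ⊆ image F S := fun x hx ↦ by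
  obtain ⟨σ, hσ, i, rfl⟩ := hS x hx
  have := mem_image_of_mem (hσ.1 (i - 1)) (hσ.2 (i - 1))
  rwa [sub_add_cancel] at this

/-- A nonempty finite set in which every point has a predecessor contains a periodic full
solution. -/
theorem inv_nonempty [Finite X] (hB : B.Nonempty) (h : ∀ y ∈ B, ∃ x ∈ B, y ∈ F x) :
    (inv F B).Nonempty := by
  choose! p hp hpF using h
  obtain ⟨y, hy⟩ := hB
  have hpB : ∀ n, p^[n] y ∈ B := fun n ↦ by
    induction n with
    | zero => exact hy
    | succ n ih => rw [Function.iterate_succ_apply']; exact hp _ ih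
  obtain ⟨n, m, hnm, heq⟩ : ∃ n m, n < m ∧ p^[n] y = p^[m] y := by
    obtain ⟨n, m, hne, heq⟩ := Finite.exists_ne_map_eq_of_infinite fun n ↦ p^[n] y
    rcases hne.lt_or_gt with h | h
    exacts [⟨n, m, h, heq⟩, ⟨m, n, h, heq.symm⟩]
  have hper : p^[n] y ∈ Function.periodicPts p := by
    refine Function.mk_mem_periodicPts (Nat.sub_pos_of_lt hnm) ?_
    rw [Function.IsPeriodicPt, Function.IsFixedPt, ← Function.iterate_add_apply,
      Nat.sub_add_cancel hnm.le, heq]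
  -- the predecessor map is invertible on its periodic points
  let P : Set X := {x ∈ B | x ∈ Function.periodicPts p}
  have hbij : Set.BijOn p P P := by
    refine ⟨fun x hx ↦ ⟨hp x hx.1, (Function.bijOn_periodicPts p).mapsTo hx.2⟩,
      (Function.bijOn_periodicPts p).injOn.mono fun x hx ↦ hx.2, fun x hx ↦ ?_⟩
    obtain ⟨k, hk, hx'⟩ := hx.2
    have hmem : ∀ j, p^[j] x ∈ P := fun j ↦ by
      induction j with
      | zero => exact hx
      | succ j ih =>
        rw [Function.iterate_succ_apply']
        exact ⟨hp _ ih.1, (Function.bijOn_periodicPts p).mapsTo ih.2⟩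
    refine ⟨p^[k - 1] x, hmem _, ?_⟩
    rw [← Function.iterate_succ_apply' p, Nat.succ_eq_add_one, Nat.sub_add_cancel hk]
    exact hx'
  let e : Equiv.Perm P := hbij.equiv
  let x₀ : P := ⟨p^[n] y, hpB n, hper⟩
  refine ⟨x₀, hpB n, fun i ↦ ((e ^ (-i)) x₀ : P), ⟨fun i ↦ ((e ^ (-i)) x₀).2.1, fun i ↦ ?_⟩, 0,
    by simp⟩
  have : (e ^ (-i)) x₀ = e ((e ^ (-(i + 1))) x₀) := by
    rw [← Equiv.Perm.mul_apply, ← zpow_one_add]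
    congr 2
    ring
  have h := hpF _ ((e ^ (-(i + 1))) x₀).2.1
  rwa [← show ((e ^ (-i)) x₀ : X) = p ((e ^ (-(i + 1))) x₀) from congrArg Subtype.val this] at h

end Invariant

/-! ### Isolating sets and reachable points -/

section Isolating

variable {X : Type u} {F : X → Set X} {S N M : Set X}

/-- A step of `F` which ends in `N`. -/
def Step (F : X → Set X) (N : Set X) (x y : X) : Prop := y ∈ F x ∧ y ∈ N

/-- The points which can be reached from `S` by a path in `N`. -/
def reach (F : X → Set X) (S N : Set X) : Set X :=
  {y | ∃ x ∈ S, Relation.ReflTransGen (Step F N) x y}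

theorem subset_reach : S ⊆ reach F S N := fun x hx ↦ ⟨x, hx, .refl⟩

theorem image_reach_inter_subset : image F (reach F S N) ∩ N ⊆ reach F S N := by
  rintro y ⟨hy, hyN⟩
  obtain ⟨x, ⟨s, hs, hsx⟩, hxy⟩ := Set.mem_iUnion₂.1 hy
  exact ⟨s, hs, hsx.tail ⟨hxy, hyN⟩⟩

theorem reach_subset {A : Set X} (hS : S ⊆ A) (hA : image F A ∩ N ⊆ A) : reach F S N ⊆ A := by
  rintro y ⟨x, hx, hxy⟩
  induction hxy with
  | refl => exact hS hx
  | tail _ h ih => exact hA ⟨mem_image_of_mem ih h.1, h.2⟩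

theorem reach_mono (h : M ⊆ N) : reach F S M ⊆ reach F S N :=
  reach_subset subset_reach ((Set.inter_subset_inter_right _ h).trans image_reach_inter_subset)

variable [TopologicalSpace X]

theorem IsIsolatingSet.subset (hN : IsIsolatingSet F S N) : S ⊆ N := fun x hx ↦ by
  by_contra h
  exact Set.eq_empty_iff_forall_notMem.1 hN.disjoint x
    ⟨hx, subset_closure ⟨hN.invariant.subset_image hx, h⟩⟩

/-- A path of steps which starts in `S` and ends in `S` stays in `S`. -/
theorem IsIsolatingSet.mem_of_reflTransGen (hN : IsIsolatingSet F S N) {x y z : X} (hx : x ∈ S)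
    (hxy : Relation.ReflTransGen (Step F N) x y) (hyz : Relation.ReflTransGen (Step F N) y z)
    (hz : z ∈ S) : y ∈ S := by
  -- extend a path by one step
  have step : ∀ {y z z' : X}, (∃ n σ, IsPath F N 0 n σ ∧ σ 0 = x ∧ σ n = z ∧
      ∃ i ∈ Set.Icc 0 n, σ i = y) → Step F N z z' →
      ∃ n σ, IsPath F N 0 n σ ∧ σ 0 = x ∧ σ n = z' ∧
        (∃ i ∈ Set.Icc 0 n, σ i = y) := by
    rintro y z z' ⟨n, σ, ⟨hn, hσN, hσF⟩, h0, rfl, i, hi, rfl⟩ hz'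
    refine ⟨n + 1, Function.update σ (n + 1) z', ⟨by lia, fun j hj ↦ ?_, fun j hj ↦ ?_⟩, ?_, ?_,
      i, ⟨hi.1, by have := hi.2; lia⟩, ?_⟩
    · by_cases h : j = n + 1
      · rw [h, Function.update_self]
        exact hz'.2
      · rw [Function.update_of_ne h]
        exact hσN j ⟨hj.1, by have := hj.2; lia⟩
    · rw [Function.update_of_ne (by have := hj.2; lia : j ≠ n + 1)]
      by_cases h : j = n
      · rw [h, Function.update_self]
        exact hz'.1
      · rw [Function.update_of_ne (by lia)]
        exact hσF j ⟨hj.1, by have := hj.2; lia⟩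
    · rw [Function.update_of_ne (by lia), h0]
    · rw [Function.update_self]
    · rw [Function.update_of_ne (by have := hi.2; lia)]
  have hy : ∃ n σ, IsPath F N 0 n σ ∧ σ 0 = x ∧ σ n = y ∧ ∃ i ∈ Set.Icc 0 n, σ i = x := by
    clear hyz
    induction hxy with
    | refl =>
      refine ⟨0, fun _ ↦ x, ⟨le_rfl, fun _ _ ↦ hN.subset hx, fun i hi ↦ ?_⟩, rfl, rfl, 0,
        ⟨le_rfl, le_rfl⟩, rfl⟩
      exact absurd hi.2 (not_lt.2 hi.1)
    | tail _ h ih => exact step ih h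
  obtain ⟨n, σ, hσ, h0, hn, i, hi, rfl⟩ : ∃ n σ, IsPath F N 0 n σ ∧ σ 0 = x ∧ σ n = z ∧
      ∃ i ∈ Set.Icc 0 n, σ i = y := by
    clear hz
    induction hyz with
    | refl =>
      obtain ⟨n, σ, hσ, h0, hn, -⟩ := hy
      exact ⟨n, σ, hσ, h0, hn, n, ⟨hσ.1, le_rfl⟩, hn⟩
    | tail _ h ih => exact step ih h
  exact hN.path_subset 0 n σ hσ (h0 ▸ hx) (hn ▸ hz) i hi

theorem IsIsolatingSet.inter (hN : IsIsolatingSet F S N) (hM : IsIsolatingSet F S M) :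
    IsIsolatingSet F S (N ∩ M) where
  invariant := hN.invariant
  closed := hN.closed.inter hM.closed
  path_subset m n σ hσ := hN.path_subset m n σ ⟨hσ.1, fun i hi ↦ (hσ.2.1 i hi).1, hσ.2.2⟩
  disjoint := by
    rw [Set.sdiff_inter, closure_union, Set.inter_union_distrib_left, hN.disjoint, hM.disjoint,
      Set.union_empty]

end Isolating

/-! ### The canonical index pair -/

section Canonical

variable {X : Type u} [TopologicalSpace X] [Finite X] {F : X → Set X} {S N M : Set X}

theorem isClosed_image (hF' : ∀ x, IsClosed (F x)) (A : Set X) : IsClosed (image F A) :=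
  A.toFinite.isClosed_biUnion fun x _ ↦ hF' x

theorem exists_specializes_of_mem_closure {A : Set X} {y : X} (hy : y ∈ closure A) :
    ∃ x ∈ A, x ⤳ y := by
  rw [← Set.biUnion_of_singleton A, A.toFinite.closure_biUnion] at hy
  obtain ⟨x, hx, h⟩ := Set.mem_iUnion₂.1 hy
  exact ⟨x, hx, specializes_iff_mem_closure.2 h⟩

/-- The points reachable from `S`, and those which moreover are not in `S`. -/
def canonicalPair (F : X → Set X) (S N : Set X) : SetPair X where
  fst := reach F S N
  snd := reach F S N \ S
  snd_subset := Set.sdiff_subset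

/-- The pair of the points reachable from `S` is an index pair. The set of the reachable points
outside `S` is closed: if such a point `x` specializes to a point of `S`, then a successor of the
latter in `S` is also a successor of `x`, and `x` lies on a path between points of `S`. -/
theorem IsIsolatingSet.isIndexPair_canonicalPair (hF : LowerHemicontinuous F)
    (hF' : ∀ x, IsClosed (F x)) (hN : IsIsolatingSet F S N) :
    IsIndexPair F S N (canonicalPair F S N) := by
  have hsub : reach F S N ⊆ N := reach_subset hN.subset Set.inter_subset_right
  have heq : reach F S N = image F (reach F S N) ∩ N := by
    refine subset_antisymm (reach_subset (fun x hx ↦ ⟨?_, hN.subset hx⟩) ?_)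
      image_reach_inter_subset
    · exact image_mono subset_reach (hN.invariant.subset_image hx)
    · exact Set.inter_subset_inter_left _ (image_mono image_reach_inter_subset)
  have hclosed : IsClosed (reach F S N) := by
    rw [heq]
    exact (isClosed_image hF' _).inter hN.closed
  have hsnd : image F (reach F S N \ S) ∩ N ⊆ reach F S N \ S := by
    rintro y ⟨hy, hyN⟩
    obtain ⟨x, ⟨hx, hxS⟩, hxy⟩ := Set.mem_iUnion₂.1 hy
    refine ⟨image_reach_inter_subset ⟨mem_image_of_mem hx hxy, hyN⟩, fun hyS ↦ hxS ?_⟩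
    obtain ⟨s, hs, hsx⟩ := hx
    exact hN.mem_of_reflTransGen hs hsx (.single ⟨hxy, hyN⟩) hyS
  refine ⟨hN, hclosed, ?_, hsub, image_reach_inter_subset, hsnd, ?_, ?_⟩
  · refine isClosed_of_closure_subset fun y hy ↦ ?_
    refine ⟨hclosed.closure_subset_iff.2 Set.sdiff_subset hy, fun hyS ↦ ?_⟩
    obtain ⟨x, ⟨⟨s, hs, hsx⟩, hxS⟩, hxy⟩ := exists_specializes_of_mem_closure hy
    obtain ⟨y', hy', hyy'⟩ := hN.invariant.exists_succ hyS
    exact hxS (hN.mem_of_reflTransGen hs hsx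
      (.single ⟨subset_of_specializes hF hF' hxy hyy', hN.subset hy'⟩) hy')
  · rintro y ⟨hy, hyc⟩
    refine ⟨hy, fun hyS ↦ ?_⟩
    change y ∈ closure (image F (reach F S N) \ N) at hyc
    rw [← Set.union_sdiff_cancel (subset_reach (F := F) (S := S) (N := N)), image_union,
      Set.union_sdiff_distrib, closure_union] at hyc
    rcases hyc with h | h
    · exact Set.eq_empty_iff_forall_notMem.1 hN.disjoint y ⟨hyS, h⟩
    · have := (isClosed_image hF' _).closure_subset_iff.2 Set.sdiff_subset h
      exact (hsnd ⟨this, hN.subset hyS⟩).2 hyS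
  · have : reach F S N \ (reach F S N \ S) = S := by
      rw [Set.sdiff_sdiff_right_self, Set.inter_eq_right.2 subset_reach]
    change S = inv F (reach F S N \ (reach F S N \ S))
    rw [this]
    exact subset_antisymm (hN.invariant.subset_inv subset_rfl) (inv_subset _ _)

end Canonical

end Conley

/-! ### Independence of the index pair -/

namespace Conley

section Pairs

variable {X : Type u} [TopologicalSpace X] {F : X → Set X} {S N : Set X} {P : SetPair X}

theorem IsIndexPair.subset_fst (hP : IsIndexPair F S N P) : S ⊆ P.fst := fun x hx ↦ by
  rw [hP.inv_eq] at hx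
  exact (inv_subset _ _ hx).1

theorem IsIndexPair.notMem_snd (hP : IsIndexPair F S N P) {x : X} (hx : x ∈ S) : x ∉ P.snd := by
  rw [hP.inv_eq] at hx
  exact (inv_subset _ _ hx).2

/-- A sufficient condition for a smaller pair to be an index pair. -/
theorem IsIndexPair.of_subset (hP : IsIndexPair F S N P) {Q : SetPair X} (hQ₁ : IsClosed Q.fst)
    (hQ₂ : IsClosed Q.snd) (hQP : Q.fst ⊆ P.fst) (hS : S ⊆ Q.fst \ Q.snd)
    (hsub : Q.fst \ Q.snd ⊆ P.fst \ P.snd) (h₁ : image F Q.fst ∩ N ⊆ Q.fst)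
    (h₂ : image F Q.snd ∩ N ⊆ Q.snd) (hexit : Q.fst ∩ closure (image F Q.fst \ N) ⊆ Q.snd) :
    IsIndexPair F S N Q where
  isolating := hP.isolating
  closed_fst := hQ₁
  closed_snd := hQ₂
  fst_subset := hQP.trans hP.fst_subset
  image_fst := h₁
  image_snd := h₂
  exit := hexit
  inv_eq := by
    refine subset_antisymm (hP.isolating.invariant.subset_inv hS) ((inv_mono hsub).trans ?_)
    rw [← hP.inv_eq]

theorem exit_mono {A B N : Set X} (h : A ⊆ B) :
    A ∩ closure (image F A \ N) ⊆ B ∩ closure (image F B \ N) :=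
  Set.inter_subset_inter h (closure_mono (Set.sdiff_subset_sdiff_left (image_mono h)))

/-- The part of an index pair which is reachable from `S`. -/
def reachablePart (F : X → Set X) (S N : Set X) (P : SetPair X) : SetPair X where
  fst := reach F S N
  snd := reach F S N ∩ P.snd
  snd_subset := Set.inter_subset_left

/-- The exit set of an index pair, together with the points reachable from `S`. -/
def reachableExtension (F : X → Set X) (S N : Set X) (P : SetPair X) : SetPair X where
  fst := reach F S N ∪ P.snd
  snd := P.snd
  snd_subset := Set.subset_union_right

theorem IsIndexPair.reach_subset_fst (hP : IsIndexPair F S N P) : reach F S N ⊆ P.fst :=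
  reach_subset hP.subset_fst hP.image_fst

theorem IsIndexPair.reachablePart (hP : IsIndexPair F S N P) (hcl : IsClosed (reach F S N)) :
    IsIndexPair F S N (reachablePart F S N P) := by
  have h := hP.reach_subset_fst
  refine hP.of_subset hcl (hcl.inter hP.closed_snd) h ?_ ?_ image_reach_inter_subset ?_ ?_
  · exact fun x hx ↦ ⟨subset_reach hx, fun h ↦ hP.notMem_snd hx h.2⟩
  · exact fun x hx ↦ ⟨h hx.1, fun hx' ↦ hx.2 ⟨hx.1, hx'⟩⟩
  · exact fun x hx ↦ ⟨image_reach_inter_subset ⟨image_mono Set.inter_subset_left hx.1, hx.2⟩,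
      hP.image_snd ⟨image_mono Set.inter_subset_right hx.1, hx.2⟩⟩
  · exact fun x hx ↦ ⟨hx.1, hP.exit (exit_mono h hx)⟩

theorem IsIndexPair.reachableExtension (hP : IsIndexPair F S N P)
    (hcl : IsClosed (reach F S N)) : IsIndexPair F S N (reachableExtension F S N P) := by
  have h : reach F S N ∪ P.snd ⊆ P.fst := Set.union_subset hP.reach_subset_fst P.snd_subset
  refine hP.of_subset (hcl.union hP.closed_snd) hP.closed_snd h ?_ ?_ ?_ hP.image_snd ?_
  · exact fun x hx ↦ ⟨Or.inl (subset_reach hx), hP.notMem_snd hx⟩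
  · exact fun x hx ↦ ⟨h hx.1, hx.2⟩
  · change image F (reach F S N ∪ P.snd) ∩ N ⊆ reach F S N ∪ P.snd
    rw [image_union, Set.union_inter_distrib_right]
    exact Set.union_subset_union image_reach_inter_subset hP.image_snd
  · exact fun x hx ↦ hP.exit (exit_mono h hx)

/-- A set in which every point has a predecessor is empty if it is contained in the difference of
an index pair and is disjoint from `S`. -/
theorem IsIndexPair.eq_empty_of_pred [Finite X] (hP : IsIndexPair F S N P) {B : Set X}
    (hB : B ⊆ P.fst \ P.snd) (hBS : ∀ x ∈ B, x ∉ S) (h : ∀ y ∈ B, ∃ x ∈ B, y ∈ F x) :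
    B = ∅ := by
  by_contra hne
  obtain ⟨x, hx⟩ := inv_nonempty (Set.nonempty_iff_ne_empty.2 hne) h
  refine hBS x (inv_subset _ _ hx) ?_
  rw [hP.inv_eq]
  exact inv_mono hB hx

theorem SetPair.eq_of_subset {X : Type u} {P Q : SetPair X} (h₁ : P.fst ⊆ Q.fst)
    (h₂ : P.snd ⊆ Q.snd) (k₁ : Q.fst ⊆ P.fst) (k₂ : Q.snd ⊆ P.snd) : P = Q := by
  obtain ⟨P₁, P₂, _⟩ := P
  obtain ⟨Q₁, Q₂, _⟩ := Q
  obtain rfl : P₁ = Q₁ := subset_antisymm h₁ k₁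
  obtain rfl : P₂ = Q₂ := subset_antisymm h₂ k₂
  rfl

end Pairs

section Independence

variable {R : Type u} [Ring R] {X : Type u} [TopologicalSpace X] [Finite X] [T0Space X]
  {F : X → Set X} (hF : LowerHemicontinuous F) (hF' : ∀ x, IsClosed (F x))
  (hF_acyclic : ∀ x, IsAcyclic R (F x)) {C : Type*} [Category* C] {L : EndoObj (GrMod R) ⥤ C}
  (hL : IsNormal L) {S N M : Set X} {P Q : SetPair X}

include hF hF' hF_acyclic hL

/-- Nested index pairs `P ⊆ Q` in `N` for which `(Q₁, P₂)` is an index pair have the same index.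
The larger one is shrunk to the smaller one in finitely many steps, replacing `Qᵢ` by
`Pᵢ ∪ (F(Qᵢ) ∩ N)`. If this does not change `Q`, then the points in `Qᵢ \ Pᵢ` have predecessors in
`Qᵢ \ Pᵢ`, so that there is a full solution outside `S` unless `P = Q`. -/
theorem IsIndexPair.nonempty_iso_of_subset (hP : IsIndexPair F S N P)
    (hQ : IsIndexPair F S N Q) (h₁ : P.fst ⊆ Q.fst) (h₂ : P.snd ⊆ Q.snd)
    (hQP : IsIndexPair F S N ⟨Q.fst, P.snd, h₂.trans Q.snd_subset⟩) :
    Nonempty (L.obj ⟨P.homology R, indexMap R hP⟩ ≅ L.obj ⟨Q.homology R, indexMap R hQ⟩) := by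
  induction hn : Q.fst.ncard + Q.snd.ncard using Nat.strong_induction_on generalizing Q with
  | _ n ih =>
  subst hn
  let T : SetPair X := ⟨P.fst ∪ (image F Q.fst ∩ N), P.snd ∪ (image F Q.snd ∩ N),
    Set.union_subset_union P.snd_subset (Set.inter_subset_inter_left _ (image_mono Q.snd_subset))⟩
  have hTQ₁ : T.fst ⊆ Q.fst := Set.union_subset h₁ hQ.image_fst
  have hTQ₂ : T.snd ⊆ Q.snd := Set.union_subset h₂ hQ.image_snd
  have hPT₁ : P.fst ⊆ T.fst := Set.subset_union_left
  have hPT₂ : P.snd ⊆ T.snd := Set.subset_union_left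
  have hcl₁ : IsClosed T.fst :=
    hP.closed_fst.union ((isClosed_image hF' _).inter hP.isolating.closed)
  have hcl₂ : IsClosed T.snd :=
    hP.closed_snd.union ((isClosed_image hF' _).inter hP.isolating.closed)
  have himg₁ : image F T.fst ∩ N ⊆ T.fst := fun x hx ↦ Or.inr ⟨image_mono hTQ₁ hx.1, hx.2⟩
  have himg₂ : image F T.snd ∩ N ⊆ T.snd := fun x hx ↦ Or.inr ⟨image_mono hTQ₂ hx.1, hx.2⟩
  have hexit : T.fst ∩ closure (image F T.fst \ N) ⊆ P.snd := fun x hx ↦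
    hQP.exit (exit_mono hTQ₁ hx)
  have hT : IsIndexPair F S N T := hQP.of_subset hcl₁ hcl₂ hTQ₁
    (fun x hx ↦ ⟨hPT₁ (hP.subset_fst hx), fun h ↦ hQ.notMem_snd hx (hTQ₂ h)⟩)
    (fun x hx ↦ ⟨hTQ₁ hx.1, fun h ↦ hx.2 (hPT₂ h)⟩) himg₁ himg₂ (hexit.trans hPT₂)
  have hTP : IsIndexPair F S N ⟨T.fst, P.snd, hPT₂.trans T.snd_subset⟩ :=
    hQP.of_subset hcl₁ hP.closed_snd hTQ₁
      (fun x hx ↦ ⟨hPT₁ (hP.subset_fst hx), hP.notMem_snd hx⟩)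
      (fun x hx ↦ ⟨hTQ₁ hx.1, hx.2⟩) himg₁ hP.image_snd hexit
  obtain ⟨e⟩ := hT.nonempty_iso_of_image_subset hF hF' hF_acyclic hL hQ hTQ₁ hTQ₂
    Set.subset_union_right Set.subset_union_right
    (fun x hx ↦ hPT₂ (hQP.exit ⟨hTQ₁ hx.1, hx.2⟩))
  by_cases hcard : T.fst.ncard + T.snd.ncard < Q.fst.ncard + Q.snd.ncard
  · obtain ⟨e'⟩ := ih _ hcard hT hPT₁ hPT₂ hTP rfl
    exact ⟨e' ≪≫ e⟩
  have hc₁ := Set.ncard_le_ncard hTQ₁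
  have hc₂ := Set.ncard_le_ncard hTQ₂
  have hQ₁ : Q.fst ⊆ T.fst := (Set.eq_of_subset_of_ncard_le hTQ₁ (by lia)).symm.subset
  have hQ₂ : Q.snd ⊆ T.snd := (Set.eq_of_subset_of_ncard_le hTQ₂ (by lia)).symm.subset
  have hD₁ : Q.fst \ P.fst = ∅ := by
    refine hQP.eq_empty_of_pred (fun x hx ↦ ⟨hx.1, fun h ↦ hx.2 (P.snd_subset h)⟩)
      (fun x hx h ↦ hx.2 (hP.subset_fst h)) fun y hy ↦ ?_
    obtain ⟨hyF, hyN⟩ := (hQ₁ hy.1).resolve_left hy.2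
    obtain ⟨x, hx, hxy⟩ := Set.mem_iUnion₂.1 hyF
    exact ⟨x, ⟨hx, fun h ↦ hy.2 (hP.image_fst ⟨mem_image_of_mem h hxy, hyN⟩)⟩, hxy⟩
  have hD₂ : Q.snd \ P.snd = ∅ := by
    refine hQP.eq_empty_of_pred (fun x hx ↦ ⟨Q.snd_subset hx.1, hx.2⟩)
      (fun x hx h ↦ hQ.notMem_snd h hx.1) fun y hy ↦ ?_
    obtain ⟨hyF, hyN⟩ := (hQ₂ hy.1).resolve_left hy.2
    obtain ⟨x, hx, hxy⟩ := Set.mem_iUnion₂.1 hyF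
    exact ⟨x, ⟨hx, fun h ↦ hy.2 (hP.image_snd ⟨mem_image_of_mem h hxy, hyN⟩)⟩, hxy⟩
  obtain rfl : P = Q :=
    SetPair.eq_of_subset h₁ h₂ (Set.sdiff_eq_empty.1 hD₁) (Set.sdiff_eq_empty.1 hD₂)
  exact ⟨Iso.refl _⟩

/-- Every index pair has the same index as the canonical one in the same isolating set. -/
theorem IsIndexPair.nonempty_iso_canonicalPair (hP : IsIndexPair F S N P)
    (hC : IsIndexPair F S N (canonicalPair F S N)) :
    Nonempty (L.obj ⟨P.homology R, indexMap R hP⟩ ≅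
      L.obj ⟨(canonicalPair F S N).homology R, indexMap R hC⟩) := by
  have hcl : IsClosed (reach F S N) := hC.closed_fst
  have h₁ := hP.reachablePart hcl
  have h₂ := hP.reachableExtension hcl
  obtain ⟨e₁⟩ := h₁.nonempty_iso_of_subset hF hF' hF_acyclic hL hC subset_rfl
    (fun x hx ↦ ⟨hx.1, fun h ↦ hP.notMem_snd h hx.2⟩) h₁
  obtain ⟨e₂⟩ := h₁.nonempty_iso_of_excision hF hF' hF_acyclic hL h₂ Set.subset_union_left
    Set.inter_subset_right subset_rfl subset_rfl
    ((closure_mono (Set.sdiff_subset_sdiff_left (image_mono Set.subset_union_left))).trans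
      Set.subset_union_right)
  obtain ⟨e₃⟩ := h₂.nonempty_iso_of_subset hF hF' hF_acyclic hL hP
    (Set.union_subset hP.reach_subset_fst P.snd_subset) subset_rfl hP
  exact ⟨e₃.symm ≪≫ e₂.symm ≪≫ e₁⟩

/-- The canonical index pairs in nested isolating sets have the same difference `S`, hence the
same index. -/
theorem nonempty_iso_canonicalPair_of_subset (hMN : M ⊆ N)
    (hM : IsIndexPair F S M (canonicalPair F S M)) (hN : IsIndexPair F S N (canonicalPair F S N)) :
    Nonempty (L.obj ⟨(canonicalPair F S M).homology R, indexMap R hM⟩ ≅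
      L.obj ⟨(canonicalPair F S N).homology R, indexMap R hN⟩) := by
  have hr := reach_mono (F := F) (S := S) hMN
  refine hM.nonempty_iso_of_excision hF hF' hF_acyclic hL hN hr
    (Set.sdiff_subset_sdiff_left hr) ?_ ?_ ?_
  · intro x hx
    by_cases hS : x ∈ S
    · exact Or.inl (subset_reach hS)
    · exact Or.inr ⟨hx, hS⟩
  · exact fun x hx ↦ ⟨hx.1, hx.2.2⟩
  · refine closure_minimal ?_ (hN.closed_snd.union isClosed_closure)
    rintro y ⟨hy, hyM⟩
    replace hy := image_mono hr hy
    by_cases hyN : y ∈ N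
    · exact Or.inl ⟨image_reach_inter_subset ⟨hy, hyN⟩, fun h ↦ hyM (hM.isolating.subset h)⟩
    · exact Or.inr (subset_closure ⟨hy, hyN⟩)

/-- The index does not depend on the isolating set and on the index pair. -/
theorem IsIndexPair.nonempty_iso (hP : IsIndexPair F S N P) (hQ : IsIndexPair F S M Q) :
    Nonempty (L.obj ⟨P.homology R, indexMap R hP⟩ ≅ L.obj ⟨Q.homology R, indexMap R hQ⟩) := by
  have hN := hP.isolating.isIndexPair_canonicalPair hF hF'
  have hM := hQ.isolating.isIndexPair_canonicalPair hF hF'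
  have hNM := (hP.isolating.inter hQ.isolating).isIndexPair_canonicalPair hF hF'
  obtain ⟨e₁⟩ := hP.nonempty_iso_canonicalPair hF hF' hF_acyclic hL hN
  obtain ⟨e₂⟩ := hQ.nonempty_iso_canonicalPair hF hF' hF_acyclic hL hM
  obtain ⟨e₃⟩ := nonempty_iso_canonicalPair_of_subset hF hF' hF_acyclic hL
    Set.inter_subset_left hNM hN
  obtain ⟨e₄⟩ := nonempty_iso_canonicalPair_of_subset hF hF' hF_acyclic hL
    Set.inter_subset_right hNM hM
  exact ⟨e₁ ≪≫ e₃.symm ≪≫ e₄ ≪≫ e₂.symm⟩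

end Independence

end Conley

theorem theorem6p1 {R : Type u} [Ring R]
    {X : Type u} [TopologicalSpace X] [Finite X] [T0Space X] (F : X → Set X)
    (hF_lsc : LowerHemicontinuous F) (hF_closed : ∀ x, IsClosed (F x))
    (hF_acyclic : ∀ x, Conley.IsAcyclic R (F x))
    {C : Type*} [Category* C] (L : Conley.EndoObj (Conley.GrMod R) ⥤ C)
    (hL : Conley.IsNormal L) (S : Set X) :
    -- the isomorphisms in homology whose inverses enter the definition of the index map
    (∀ (N : Set X) (P : Conley.SetPair X), Conley.IsIndexPair F S N P →
      IsIso (Conley.projFst R F P) ∧ IsIso (Conley.inclBar R F N P)) ∧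
    -- independence of the isolating set and of the index pair
    ∀ (N M : Set X) (P Q : Conley.SetPair X)
      (hP : Conley.IsIndexPair F S N P) (hQ : Conley.IsIndexPair F S M Q),
      Nonempty (L.obj ⟨P.homology R, Conley.indexMap R hP⟩ ≅
        L.obj ⟨Q.homology R, Conley.indexMap R hQ⟩) := by
  refine ⟨fun N P hP ↦ ⟨?_, hP.isIso_inclBar⟩, fun N M P Q hP hQ ↦ ?_⟩
  · exact Conley.isIso_projFst hF_lsc hF_closed hF_acyclic hP.closed_fst hP.closed_snd
  · exact hP.nonempty_iso hF_lsc hF_closed hF_acyclic hL hQ
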